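/- Let $\mathbb K$ be a field of characteristic $0$ and let $A$ be a (not necessarily commutative) Poisson algebra over $\mathbb K$: an associative unital $\mathbb K$-algebra with a Lie bracket $\{-,-\}$ such that $\{ab,c\}=a\{b,c\}+\{a,c\}b$. All unadorned tensor products are over $\mathbb K$; write $A^m=A^{\otimes m}$, $\wedge^j=\wedge^jA$, $A^e=A\otimes A^{op}$ (with elements $a\otimes b'$), and $U(A)$ for the universal enveloping algebra of the Lie algebra $(A,\{-,-\})$. Let $Q=A^e\# U(A)$ be the smash product for the diagonal Lie action of $A$ on $A^e$, let $J\subseteq Q$ be the two-sided ideal generated by the elements $(1\otimes 1')\#(ab)-(a\otimes 1')\# b-(1\otimes b')\# a$ with $a,b\in A$, and let $P=Q/J$, a $P$-$Q$-bimodule. For $x\in A$ we also write $x$ for the image in $P$ of $(1\otimes 1')\# x$. *The characteristic complex.* $\chi_\bullet(A)$ is the total complex of the bicomplex of left $P$-modules with $C_{0,j}=P\otimes\wedge^j$ for $j\ge 0$, $C_{i,j}=P\otimes A^{i+1}\otimes\wedge^{j-1}$ for $i,j\ge 1$, and $C_{i,0}=0$ for $i\ge1$, whose differentials are as follows. The horizontal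 differential $C_{i,j+1}\to C_{i,j}$ is the Chevalley–Eilenberg differential $$n\otimes x_0\wedge\cdots\wedge x_m\mapsto\sum_k(-1)^k\,(n\cdot x_k)\otimes x_0\wedge\cdots\widehat{x_k}\cdots\wedge x_m+\sum_{p<q}(-1)^{p+q}\,n\otimes\{x_p,x_q\}\wedge x_0\wedge\cdots\widehat{x_p}\cdots\widehat{x_q}\cdots\wedge x_m ,$$ where $x\in A$ acts from the right on $n\in P$ by $p\cdot x=px$ (row $0$) and on $n\in P\otimes A^{i+1}$ by $(p\otimes\theta)\cdot x=px\otimes\theta-p\otimes\{x,\theta\}$ (rows $i\ge1$), $\{x,-\}$ being the diagonal Lie action on $A^{i+1}$. Let $$b(p\otimes a_0\otimes\cdots\otimes a_m)=p(a_0\otimes1')\otimes a_1\otimes\cdots\otimes a_m+\sum_{k=0}^{m-1}(-1)^{k+1}p\otimes a_0\otimes\cdots\otimes a_ka_{k+1}\otimes\cdots\otimes a_m+(-1)^{m+1}p(1\otimes a_m')\otimes a_0\otimes\cdots\otimes a_{m-1}.$$ The vertical differential $C_{i+1,j+1}\to C_{i,j+1}$ is $(-1)^j\,b\otimes\mathrm{id}_{\wedge^j}$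 for $i\ge1$, and for $i=0$ it is $b\otimes \mathrm{id}_{\wedge^j}$ followed by $p\otimes a\otimes\omega\mapsto p\otimes (a\wedge\omega)$. *Two complexes of $Q$-modules.* Let $\mathscr K_\bullet$ be the Koszul complex $\cdots\to U(A)\otimes\wedge^1\to U(A)\otimes\wedge^0$, with augmentation $U(A)\to\mathbb K$. Let $A^{m}=A\otimes A^{m-2}\otimes A$ ($m\ge2$) carry the outer bimodule structure and the diagonal Lie action. Let $\Omega^2(A)$ be the quotient of $A^4$ by the $A^e$-submodule generated by the elements $a\otimes b\otimes c\otimes1-1\otimes ab\otimes c\otimes1+1\otimes a\otimes bc\otimes1-1\otimes a\otimes b\otimes c$; this submodule is stable under $Q$. Let $T''_\bullet=A^2\otimes\mathscr K_\bullet$, augmented to $A^2$, and let $T'_\bullet$ be the total complex of the tensor product of the complex $\cdots\to A^6\to A^5\to A^4$ (bar differential) with $\mathscr K_\bullet$, so that $T'_n=\bigoplus_{i+j=n}A^{i+4}\otimes U(A)\otimes\wedge^j$, augmented to $\Omega^2(A)$; in $T'$ the bar differential carries the sign $(-1)^j$ on $A^{i+4}\otimes U(A)\otimes\wedge^j$.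 **Claim.** $T''_\bullet$ and $T'_\bullet$ are free $Q$-resolutions of $A^2$ and of $\Omega^2(A)$, and there is a short exact sequence of complexes of left $P$-modules $$0\to P\otimes_Q T''_\bullet\xrightarrow{\;f\;}\chi_\bullet(A)\xrightarrow{\;g\;}(P\otimes_Q T'_\bullet)[2]\to0,\qquad \big((P\otimes_QT'_\bullet)[2]\big)_n=P\otimes_QT'_{n-2},$$ where, for $p \in P$, $b\in A^e=A^2$, $u\in U(A)$, $\theta\in A^{i+2}$ and $\omega\in\wedge^j$, the map $f$ sends $p\otimes_Q(b\otimes u\otimes\omega)$ to $p\,(b\#u)\otimes\omega\in C_{0,j}$, and $g$ sends $p\otimes\theta\otimes\omega\in C_{i+1,j+1}$ to $p\otimes_Q\big((1\otimes\theta\otimes 1)\otimes1\otimes\omega\big)$. Under the identifications of the homology of $P\otimes_QT''_\bullet$ and $P\otimes_QT'_\bullet$ with $\mathrm{Tor}^Q_\bullet(P,A^2)$ and $\mathrm{Tor}^Q_\bullet(P,\Omega^2(A))$, the homology sequence of this short exact sequence is a long exact sequence of left $P$-modules $$\cdots\to\mathrm{Tor}^Q_n(P,A^2)\to H_n(\chi_\bullet(A))\to\mathrm{Tor}^Q_{n-2}(P,\Omega^2(A))\to\mathrm{Tor}^Q_{n-1}(P,A^2)\to\cdots$$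 $$\cdots\to\mathrm{Tor}^Q_1(P,A^2)\to H_1(\chi_\bullet(A))\to0\to P\otimes_QA^2\to H_0(\chi_\bullet(A))\to0,$$ where the isomorphism $P\otimes_QA^2\cong H_0(\chi_\bullet(A))$ is the map $\mathrm{Tor}_0^Q(P,A^2)\to H_0(\chi_\bullet(A))$ of the sequence composed with the canonical isomorphism $P\otimes_QA^2\cong\mathrm{Tor}^Q_0(P,A^2)$. -/

import Mathlib

set_option maxSynthPendingDepth 3

open CategoryTheory
open scoped TensorProduct

universe u

/-- A (not necessarily commutative) Poisson algebra structure on an associative unital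
`K`-algebra `A`: a Lie bracket `{a, b}` with `{ab, c} = a{b, c} + {a, c}b`. -/
class PoissonAlgebra (K A : Type u) [Field K] [Ring A] [Algebra K A] where
  /-- The Poisson bracket `{a, b}`. -/
  bracket : A →ₗ[K] A →ₗ[K] A
  bracket_self : ∀ a : A, bracket a a = 0
  jacobi : ∀ a b c : A,
    bracket a (bracket b c) + bracket b (bracket c a) + bracket c (bracket a b) = 0
  leibniz : ∀ a b c : A, bracket (a * b) c = a * bracket b c + bracket a c * b

noncomputable section

namespace Poisson

section Basic

variable (K : Type u) {A : Type u} [Field K] [Ring A] [Algebra K A] [PoissonAlgebra K A]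

/-- The linear map `y ↦ {x, y}`, as a linear function of `x`. -/
def ad : A →ₗ[K] A →ₗ[K] A := PoissonAlgebra.bracket

lemma ad_self (x : A) : ad K x x = 0 := PoissonAlgebra.bracket_self x

lemma ad_skew (x y : A) : ad K x y = - ad K y x := by
  have h := ad_self K (x + y)
  simp only [map_add, LinearMap.add_apply, ad_self, zero_add, add_zero] at h
  exact eq_neg_of_add_eq_zero_right h

lemma ad_ad (x y z : A) : ad K (ad K x y) z = ad K x (ad K y z) - ad K y (ad K x z) := by
  have h : ad K x (ad K y z) + ad K y (ad K z x) + ad K z (ad K x y) = 0 :=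
    PoissonAlgebra.jacobi x y z
  rw [ad_skew K z x, ad_skew K z (ad K x y), map_neg] at h
  rw [← sub_eq_zero, ← neg_eq_zero, ← h]
  abel

lemma ad_mul (x a b : A) : ad K x (a * b) = ad K x a * b + a * ad K x b := by
  have h : ad K (a * b) x = a * ad K b x + ad K a x * b := PoissonAlgebra.leibniz a b x
  rw [ad_skew K x, h, ad_skew K x a, ad_skew K x b, neg_mul, mul_neg]
  abel

lemma ad_one (x : A) : ad K x 1 = 0 := by
  have h := ad_mul K x 1 1
  simpa using h

variable (A)

/-- The underlying vector space of `A`, regarded as the Lie algebra `(A, {-,-})`. -/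
def LieOf (_ : Type u) (A : Type u) : Type u := A

instance : AddCommGroup (LieOf K A) := inferInstanceAs (AddCommGroup A)
instance : Module K (LieOf K A) := inferInstanceAs (Module K A)

instance : LieRing (LieOf K A) where
  bracket x y := ad K (show A from x) (show A from y)
  add_lie x y z := by
    change ad K (show A from x + y) _ = ad K _ _ + ad K _ _
    exact LinearMap.map_add₂ (ad K (A := A)) x y z
  lie_add x y z := map_add (ad K (show A from x)) _ _
  lie_self x := ad_self K (show A from x)
  leibniz_lie x y z := by
    have h := ad_ad K (show A from x) (show A from y) (show A from z)
    exact (eq_add_of_sub_eq h.symm)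

instance : LieAlgebra K (LieOf K A) where
  lie_smul c x y := map_smul (ad K (show A from x)) c (show A from y)

/-- The universal enveloping algebra `U(A)` of the Lie algebra `(A, {-,-})`. -/
abbrev UEnv : Type u := UniversalEnvelopingAlgebra K (LieOf K A)

variable {A}

section
attribute [local instance 100] LieRing.ofAssociativeRing

/-- The canonical map `A → U(A)`. -/
def uι : A →ₗ[K] UEnv K A := (UniversalEnvelopingAlgebra.ι K (L := LieOf K A)).toLinearMap

lemma uι_bracket (x y : A) : uι K (ad K x y) = uι K x * uι K y - uι K y * uι K x :=
  (UniversalEnvelopingAlgebra.ι K (L := LieOf K A)).map_lie (show LieOf K A from x) y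

/-- The algebra map `U(A) → S` extending a linear map `f : A → S` which turns brackets
into commutators. -/
def uLift {S : Type u} [Ring S] [Algebra K S] (f : A →ₗ[K] S)
    (hf : ∀ x y : A, f (ad K x y) = f x * f y - f y * f x) : UEnv K A →ₐ[K] S :=
  UniversalEnvelopingAlgebra.lift K
    ({ toLinearMap := (show LieOf K A →ₗ[K] S from f), map_lie' := fun {x y} => hf x y } :
      LieOf K A →ₗ⁅K⁆ S)

@[simp] lemma uLift_uι {S : Type u} [Ring S] [Algebra K S] (f : A →ₗ[K] S)
    (hf : ∀ x y : A, f (ad K x y) = f x * f y - f y * f x) (x : A) :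
    uLift K f hf (uι K x) = f x :=
  UniversalEnvelopingAlgebra.lift_ι_apply K _ _

lemma UEnv.induction {p : UEnv K A → Prop} (hs : ∀ c : K, p (algebraMap K _ c))
    (hι : ∀ x : A, p (uι K x)) (ha : ∀ u v, p u → p v → p (u + v))
    (hm : ∀ u v, p u → p v → p (u * v)) (u : UEnv K A) : p u := by
  let S : Subalgebra K (UEnv K A) :=
    { carrier := {u | p u}
      mul_mem' := fun h h' => hm _ _ h h'
      add_mem' := fun h h' => ha _ _ h h'
      algebraMap_mem' := hs }
  let f : A →ₗ[K] S := (uι K).codRestrict (Subalgebra.toSubmodule S) hι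
  have hf : ∀ x y : A, f (ad K x y) = f x * f y - f y * f x := fun x y =>
    Subtype.ext (uι_bracket K x y)
  have h : S.val.comp (uLift K f hf) = AlgHom.id K _ := by
    apply UniversalEnvelopingAlgebra.hom_ext
    ext x
    exact congrArg Subtype.val (uLift_uι K f hf x)
  have h2 : S.val (uLift K f hf u) = u := DFunLike.congr_fun h u
  rw [← h2]
  exact (uLift K f hf u).2

end

/-- The counit `U(A) → K`. -/
def uε : UEnv K A →ₐ[K] K := uLift K (0 : A →ₗ[K] K) (by simp)

@[simp] lemma uε_uι (x : A) : uε K (uι K x) = 0 := by simp [uε]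

variable (A) in
/-- The enveloping algebra `Aᵉ = A ⊗ Aᵒᵖ`. -/
abbrev Env : Type u := A ⊗[K] Aᵐᵒᵖ

/-- The bracket `{x, -}` on the opposite algebra. -/
def adOp (x : A) : Aᵐᵒᵖ →ₗ[K] Aᵐᵒᵖ := (MulOpposite.opLinearEquiv K).conj (ad K x)

@[simp] lemma adOp_op (x a : A) : adOp K x (MulOpposite.op a) = MulOpposite.op (ad K x a) := rfl

/-- The Lie action of `x ∈ A` on `Aᵉ`: `a ⊗ b' ↦ {x, a} ⊗ b' + a ⊗ {x, b}'`. -/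
def envLie : A →ₗ[K] Module.End K (Env K A) where
  toFun x := (ad K x).rTensor Aᵐᵒᵖ + (adOp K x).lTensor A
  map_add' x y := by
    ext a b
    simp [TensorProduct.add_tmul, TensorProduct.tmul_add, adOp]
    abel
  map_smul' c x := by
    ext a b
    simp [TensorProduct.smul_tmul', adOp]

@[simp] lemma envLie_tmul (x a : A) (b : Aᵐᵒᵖ) :
    envLie K x (a ⊗ₜ b) = ad K x a ⊗ₜ b + a ⊗ₜ adOp K x b := rfl

lemma envLie_mul (x : A) (b c : Env K A) :
    envLie K x (b * c) = envLie K x b * c + b * envLie K x c := by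
  induction b using TensorProduct.induction_on with
  | zero => simp
  | add b b' h h' => simp only [add_mul, map_add, h, h']; abel
  | tmul b b' =>
    induction c using TensorProduct.induction_on with
    | zero => simp
    | add c c' h h' => simp only [mul_add, map_add, h, h']; abel
    | tmul c c' =>
      induction b' using MulOpposite.rec' with | _ b' =>
      induction c' using MulOpposite.rec' with | _ c' =>
      simp only [Algebra.TensorProduct.tmul_mul_tmul, envLie_tmul, ← MulOpposite.op_mul,
        adOp_op, ad_mul, add_mul, mul_add, TensorProduct.add_tmul, TensorProduct.tmul_add,
        MulOpposite.op_add]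
      abel

@[simp] lemma envLie_one (x : A) : envLie K x 1 = 0 := by
  rw [Algebra.TensorProduct.one_def, envLie_tmul, ad_one, ← MulOpposite.op_one, adOp_op, ad_one]
  simp

lemma envLie_bracket (x y : A) :
    envLie K (ad K x y) = envLie K x * envLie K y - envLie K y * envLie K x := by
  ext a b
  induction b using MulOpposite.rec' with | _ b =>
  simp [ad_ad, TensorProduct.sub_tmul, TensorProduct.tmul_sub]
  abel

end Basic

section Smash

variable (K A : Type u) [Field K] [Ring A] [Algebra K A] [PoissonAlgebra K A]

/-- The underlying space `Aᵉ ⊗ U(A)` of the quasi-Poisson enveloping algebra `Q = Aᵉ # U(A)`. -/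
def QEnv : Type u := Env K A ⊗[K] UEnv K A

instance : AddCommGroup (QEnv K A) := inferInstanceAs (AddCommGroup (Env K A ⊗[K] UEnv K A))
instance : Module K (QEnv K A) := inferInstanceAs (Module K (Env K A ⊗[K] UEnv K A))

namespace QEnv

variable {K A}

variable (K) in
/-- The element `b # u` of the smash product, as a bilinear map. -/
def mk : Env K A →ₗ[K] UEnv K A →ₗ[K] QEnv K A := TensorProduct.mk K _ _

lemma ind {p : QEnv K A → Prop} (h0 : p 0) (ht : ∀ b u, p (mk K b u))
    (ha : ∀ s t, p s → p t → p (s + t)) (s : QEnv K A) : p s :=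
  TensorProduct.induction_on s h0 ht ha

/-- The linear map out of the smash product induced by a bilinear map. -/
def liftLin {V : Type u} [AddCommGroup V] [Module K V]
    (f : Env K A →ₗ[K] UEnv K A →ₗ[K] V) : QEnv K A →ₗ[K] V := TensorProduct.lift f

@[simp] lemma liftLin_mk {V : Type u} [AddCommGroup V] [Module K V]
    (f : Env K A →ₗ[K] UEnv K A →ₗ[K] V) (b : Env K A) (u : UEnv K A) :
    liftLin f (mk K b u) = f b u := TensorProduct.lift.tmul _ _

lemma lin_ext {V : Type u} [AddCommGroup V] [Module K V] {f g : QEnv K A →ₗ[K] V}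
    (h : ∀ b u, f (mk K b u) = g (mk K b u)) : f = g := TensorProduct.ext' h

variable (K) in
/-- The operator `c # v ↦ bc # v`. -/
def lmulEnv : Env K A →ₗ[K] Module.End K (QEnv K A) where
  toFun b := liftLin ((mk K) ∘ₗ LinearMap.mulLeft K b)
  map_add' b c := lin_ext fun _ _ => by simp [add_mul]
  map_smul' k b := lin_ext fun c v => by
    have h : (k • b) * c = k • (b * c) := Algebra.smul_mul_assoc k b c
    simp [h]

@[simp] lemma lmulEnv_mk (b c : Env K A) (v : UEnv K A) :
    lmulEnv K b (mk K c v) = mk K (b * c) v := by simp [lmulEnv]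

variable (K) in
/-- The diagonal action of `x ∈ A` on `Aᵉ ⊗ U(A)`, given by the comultiplication
`x ↦ x ⊗ 1 + 1 ⊗ x` of `U(A)`: `c # v ↦ {x, c} # v + c # xv`. -/
def diagLie : A →ₗ[K] Module.End K (QEnv K A) where
  toFun x := liftLin ((mk K) ∘ₗ envLie K x +
    ((mk K).compl₂ (LinearMap.mulLeft K (uι K x))))
  map_add' b c := lin_ext fun _ _ => by simp [add_mul]; abel
  map_smul' b c := lin_ext fun _ _ => by simp

@[simp] lemma diagLie_mk (x : A) (c : Env K A) (v : UEnv K A) :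
    diagLie K x (mk K c v) = mk K (envLie K x c) v + mk K c (uι K x * v) := by simp [diagLie]

variable (K) in
/-- The diagonal action of `U(A)` on `Aᵉ ⊗ U(A)`: `u` acts by `c # v ↦ ∑ (u₁ · c) # u₂v`, where
`∑ u₁ ⊗ u₂` is the comultiplication of `u`. -/
def diag : UEnv K A →ₐ[K] Module.End K (QEnv K A) :=
  uLift K (diagLie K) fun x y => lin_ext fun c v => by
    simp only [diagLie_mk, envLie_bracket, uι_bracket, LinearMap.sub_apply, Module.End.mul_apply,
      map_sub, map_add, sub_mul, mul_assoc]
    abel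

lemma diag_uι (x : A) : diag K (uι K x) = diagLie K x := uLift_uι _ _ _ _

variable (K) in
/-- The multiplication `(b # u)(c # v) = ∑ b(u₁ · c) # u₂v` of the smash product. -/
def mulMap : QEnv K A →ₗ[K] QEnv K A →ₗ[K] QEnv K A :=
  liftLin (((LinearMap.mul K (Module.End K (QEnv K A))).compl₂ (diag K).toLinearMap)
    ∘ₗ lmulEnv K)

@[simp] lemma mulMap_mk (b : Env K A) (u : UEnv K A) (t : QEnv K A) :
    mulMap K (mk K b u) t = lmulEnv K b (diag K u t) := by simp [mulMap]

lemma diag_mk_one (u v : UEnv K A) : diag K u (mk K (1 : Env K A) v) = mk K 1 (u * v) := by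
  induction u using UEnv.induction K generalizing v with
  | hs c => simp [Algebra.algebraMap_eq_smul_one]
  | hι x => simp [diag_uι]
  | ha u u' h h' => simp [h, h', add_mul]
  | hm u u' h h' => simp [h, h', mul_assoc]

lemma lmulEnv_mulMap (b : Env K A) (s t : QEnv K A) :
    mulMap K (lmulEnv K b s) t = lmulEnv K b (mulMap K s t) := by
  induction s using ind with
  | h0 => simp
  | ha s s' h h' => simp [h, h']
  | ht c v =>
    simp only [lmulEnv_mk, mulMap_mk]
    generalize diag K v t = r
    induction r using ind with
    | h0 => simp
    | ha s s' h h' => simp [h, h']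
    | ht c v => simp [mul_assoc]

lemma diagLie_lmulEnv (x : A) (b : Env K A) (t : QEnv K A) :
    diagLie K x (lmulEnv K b t) = lmulEnv K (envLie K x b) t + lmulEnv K b (diagLie K x t) := by
  induction t using ind with
  | h0 => simp
  | ha s s' h h' => simp only [map_add, h, h']; abel
  | ht c v => simp [envLie_mul, add_assoc]

lemma diagLie_mulMap (x : A) (s t : QEnv K A) :
    mulMap K (diagLie K x s) t = diagLie K x (mulMap K s t) := by
  induction s using ind with
  | h0 => simp
  | ha s s' h h' => simp only [map_add, LinearMap.add_apply, h, h']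
  | ht c v => simp [diagLie_lmulEnv, diag_uι]

lemma diag_mulMap (u : UEnv K A) (s t : QEnv K A) :
    mulMap K (diag K u s) t = diag K u (mulMap K s t) := by
  induction u using UEnv.induction K generalizing s with
  | hs c => simp [Algebra.algebraMap_eq_smul_one]
  | hι x => simp [diag_uι, diagLie_mulMap]
  | ha u u' h h' => simp [h, h']
  | hm u u' h h' => simp [h, h']

lemma mulMap_assoc (r s t : QEnv K A) :
    mulMap K (mulMap K r s) t = mulMap K r (mulMap K s t) := by
  induction r using ind with
  | h0 => simp
  | ha r r' h h' => simp [h, h']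
  | ht b u => simp [lmulEnv_mulMap, diag_mulMap]

lemma lmulEnv_one (t : QEnv K A) : lmulEnv K 1 t = t := by
  induction t using ind with
  | h0 => simp
  | ha r r' h h' => simp [h, h']
  | ht b u => simp

/-- The quasi-Poisson enveloping algebra `Q = Aᵉ # U(A)`, with the smash product multiplication. -/
instance : Ring (QEnv K A) :=
  { (inferInstance : AddCommGroup (QEnv K A)) with
    mul := fun s t => mulMap K s t
    one := mk K 1 1
    left_distrib := fun r s t => map_add (mulMap K r) s t
    right_distrib := fun r s t => LinearMap.map_add₂ (mulMap K) r s t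
    zero_mul := fun t => LinearMap.map_zero₂ (mulMap K) t
    mul_zero := fun t => map_zero (mulMap K t)
    mul_assoc := mulMap_assoc
    one_mul := fun t => by
      change mulMap K (mk K 1 1) t = t
      simp [lmulEnv_one]
    mul_one := fun t => by
      change mulMap K t (mk K 1 1) = t
      induction t using ind with
      | h0 => simp
      | ha r r' h h' => simp [h, h']
      | ht b u => simp [diag_mk_one] }

lemma mul_def (s t : QEnv K A) : s * t = mulMap K s t := rfl
lemma one_def : (1 : QEnv K A) = mk K 1 1 := rfl

instance : Algebra K (QEnv K A) :=
  Algebra.ofModule (fun c s t => LinearMap.map_smul₂ (mulMap K) c s t)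
    (fun c s t => map_smul (mulMap K s) c t)

lemma mk_mul_mk_one (b c : Env K A) (u : UEnv K A) : mk K b 1 * mk K c u = mk K (b * c) u := by
  simp [mul_def]

lemma lie_mul (x : A) (t : QEnv K A) : mk K 1 (uι K x) * t = diagLie K x t := by
  simp [mul_def, diag_uι, lmulEnv_one]

variable (K A) in
/-- The inclusion `b ↦ b # 1` of `Aᵉ` into `Q`. -/
def ofEnv : Env K A →ₐ[K] QEnv K A :=
  AlgHom.ofLinearMap ((mk K).flip 1) rfl (fun b c => (mk_mul_mk_one b c 1).symm)

@[simp] lemma ofEnv_apply (b : Env K A) : ofEnv K A b = mk K b 1 := rfl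

/-- The element `1 # x` of `Q`. -/
def ofLie : A →ₗ[K] QEnv K A := (mk K 1) ∘ₗ uι K

lemma ofLie_apply (x : A) : ofLie (K := K) x = mk K 1 (uι K x) := rfl

lemma ofLie_bracket (x y : A) :
    ofLie (K := K) (ad K x y) = ofLie x * ofLie y - ofLie y * ofLie x := by
  simp [ofLie_apply, lie_mul, uι_bracket]

lemma ofLie_mul_ofEnv (x : A) (b : Env K A) :
    ofLie x * ofEnv K A b = ofEnv K A (envLie K x b) + ofEnv K A b * ofLie x := by
  simp [ofLie_apply, lie_mul, mk_mul_mk_one]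

end QEnv

open QEnv MulOpposite in
/-- The two-sided ideal `J` of `Q` generated by the elements
`(1 ⊗ 1') # ab - (a ⊗ 1') # b - (1 ⊗ b') # a`. -/
def relJ : TwoSidedIdeal (QEnv K A) :=
  TwoSidedIdeal.span {q | ∃ a b : A, q = mk K 1 (uι K (a * b)) - mk K (a ⊗ₜ 1) (uι K b)
    - mk K (1 ⊗ₜ op b) (uι K a)}

/-- The Poisson enveloping algebra `P = Q / J`. -/
def PEnv : Type u := (relJ K A).ringCon.Quotient

instance : Ring (PEnv K A) := inferInstanceAs (Ring (relJ K A).ringCon.Quotient)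
instance : Algebra K (PEnv K A) := inferInstanceAs (Algebra K (relJ K A).ringCon.Quotient)

/-- The quotient map `Q → P`. -/
def toP : QEnv K A →ₐ[K] PEnv K A :=
  { (relJ K A).ringCon.mk' with commutes' := fun _ => rfl }

variable {K A}

lemma toP_eq_zero {q : QEnv K A} (h : q ∈ relJ K A) : toP K A q = 0 := by
  have h' : (relJ K A).ringCon q 0 := h
  exact (RingCon.eq _).2 h'

/-- The map `Aᵉ → P`. -/
def envToP : Env K A →ₐ[K] PEnv K A := (toP K A).comp (QEnv.ofEnv K A)

/-- The map `A → P`, `x ↦ 1 # x`. -/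
def lieToP : A →ₗ[K] PEnv K A := (toP K A).toLinearMap ∘ₗ QEnv.ofLie

lemma lieToP_bracket (x y : A) :
    lieToP (K := K) (ad K x y) = lieToP x * lieToP y - lieToP y * lieToP x := by
  simp [lieToP, QEnv.ofLie_bracket]

lemma lieToP_mul_envToP (x : A) (b : Env K A) :
    lieToP x * envToP (K := K) b = envToP (envLie K x b) + envToP b * lieToP x := by
  simp only [lieToP, envToP, LinearMap.comp_apply, AlgHom.comp_apply, AlgHom.toLinearMap_apply,
    ← map_mul, QEnv.ofLie_mul_ofEnv, map_add]

open MulOpposite in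
lemma lieToP_mul (a b : A) : lieToP (K := K) (a * b) =
    envToP (a ⊗ₜ 1) * lieToP b + envToP (1 ⊗ₜ op b) * lieToP a := by
  have h := toP_eq_zero (K := K) (A := A) (TwoSidedIdeal.subset_span ⟨a, b, rfl⟩)
  simp only [map_sub] at h
  rw [sub_sub, sub_eq_zero] at h
  simp only [lieToP, envToP, LinearMap.comp_apply, AlgHom.comp_apply, AlgHom.toLinearMap_apply,
    QEnv.ofLie_apply, QEnv.ofEnv_apply, h, ← map_mul, QEnv.mk_mul_mk_one, mul_one]

end Smash

section Modules

variable (K A : Type u) [Field K] [Ring A] [Algebra K A] [PoissonAlgebra K A]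

/-- A Lie module over `(A, {-,-})`. -/
structure LieRep (W : Type u) [AddCommGroup W] [Module K W] where
  /-- the action of `x ∈ A` -/
  act : A →ₗ[K] Module.End K W
  act_bracket : ∀ x y, act (ad K x y) = act x * act y - act y * act x

/-- A quasi-Poisson module over `A`: an `A`-`A`-bimodule, that is, a module over
`Aᵉ`, which is also a Lie module over `(A, {-,-})`, with
`{x, bm} = {x, b}m + b{x, m}` for `x ∈ A`, `b ∈ Aᵉ`. -/
structure QRep (V : Type u) [AddCommGroup V] [Module K V] where
  /-- the action of `Aᵉ` -/
  env : Env K A →ₐ[K] Module.End K V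
  /-- the Lie action of `x ∈ A` -/
  lie : A →ₗ[K] Module.End K V
  lie_bracket : ∀ x y, lie (ad K x y) = lie x * lie y - lie y * lie x
  lie_env : ∀ x b, lie x * env b = env (envLie K x b) + env b * lie x

variable {K A}

namespace QRep

variable {V V' W W' : Type u} [AddCommGroup V] [Module K V] [AddCommGroup V'] [Module K V']
  [AddCommGroup W] [Module K W] [AddCommGroup W'] [Module K W']

/-- The action `(b # u) m = b(u(m))` of `Q` on a quasi-Poisson module, as a linear map. -/
def actLin (r : QRep K A V) : QEnv K A →ₗ[K] Module.End K V :=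
  QEnv.liftLin (((LinearMap.mul K (Module.End K V)).compl₂
    (uLift K r.lie r.lie_bracket).toLinearMap) ∘ₗ r.env.toLinearMap)

@[simp] lemma actLin_mk (r : QRep K A V) (b : Env K A) (u : UEnv K A) :
    r.actLin (QEnv.mk K b u) = r.env b * uLift K r.lie r.lie_bracket u := by
  simp [actLin]

lemma actLin_lmulEnv (r : QRep K A V) (b : Env K A) (t : QEnv K A) :
    r.actLin (QEnv.lmulEnv K b t) = r.env b * r.actLin t := by
  induction t using QEnv.ind with
  | h0 => simp
  | ha s s' h h' => simp only [map_add, h, h', mul_add]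
  | ht c v => simp [mul_assoc]

lemma actLin_diag (r : QRep K A V) (u : UEnv K A) (t : QEnv K A) :
    r.actLin (QEnv.diag K u t) = uLift K r.lie r.lie_bracket u * r.actLin t := by
  induction u using UEnv.induction K generalizing t with
  | hs c => simp [Algebra.algebraMap_eq_smul_one]
  | hι x =>
    rw [QEnv.diag_uι]
    induction t using QEnv.ind with
    | h0 => simp
    | ha s s' h h' => simp only [map_add, h, h', mul_add]
    | ht c v =>
      simp only [QEnv.diagLie_mk, map_add, actLin_mk, map_mul, uLift_uι, ← mul_assoc, r.lie_env,
        add_mul]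
  | ha u u' h h' => simp [h, h', add_mul]
  | hm u u' h h' => simp [h, h', mul_assoc]

/-- The algebra map `Q → End(V)` given by a quasi-Poisson module. -/
def toAlgHom (r : QRep K A V) : QEnv K A →ₐ[K] Module.End K V :=
  AlgHom.ofLinearMap r.actLin (by simp [QEnv.one_def]) (fun s t => by
    induction s using QEnv.ind with
    | h0 => simp
    | ha s s' h h' => simp only [add_mul, map_add, h, h']
    | ht b u => simp [QEnv.mul_def, actLin_lmulEnv, actLin_diag, mul_assoc])

/-- The left `Q`-module given by a quasi-Poisson module. -/
def obj (r : QRep K A V) : ModuleCat.{u} (QEnv K A) :=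
  @ModuleCat.of (QEnv K A) _ V _ (Module.compHom V r.toAlgHom.toRingHom)

/-- The morphism of `Q`-modules given by a linear map commuting with both actions. -/
def hom (r : QRep K A V) (r' : QRep K A V') (f : V →ₗ[K] V')
    (hb : ∀ b m, f (r.env b m) = r'.env b (f m)) (hl : ∀ x m, f (r.lie x m) = r'.lie x (f m)) :
    r.obj ⟶ r'.obj :=
  @ModuleCat.ofHom (QEnv K A) _ V V' _ (Module.compHom V r.toAlgHom.toRingHom) _
    (Module.compHom V' r'.toAlgHom.toRingHom)
    (@LinearMap.mk _ _ _ _ (RingHom.id _) V V' _ _ (Module.compHom V r.toAlgHom.toRingHom)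
      (Module.compHom V' r'.toAlgHom.toRingHom) f.toAddHom (by
        intro q m
        change f (r.actLin q m) = r'.actLin q (f m)
        induction q using QEnv.ind with
        | h0 => simp
        | ha s s' h h' => simp only [map_add, LinearMap.add_apply, h, h']
        | ht b u =>
          simp only [actLin_mk, Module.End.mul_apply, hb]
          congr 1
          induction u using UEnv.induction K generalizing m with
          | hs c => simp [Algebra.algebraMap_eq_smul_one]
          | hι x => simp [hl]
          | ha u u' h h' => simp [h, h']
          | hm u u' h h' => simp [h, h']))

lemma hom_apply (r : QRep K A V) (r' : QRep K A V') (f : V →ₗ[K] V') (hb hl) (m : V) :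
    (r.hom r' f hb hl).hom m = f m := rfl

/-- The tensor product `V ⊗ W` of a quasi-Poisson module `V` and a Lie module `W`: here `Aᵉ` acts
on `V`, and `x ∈ A` acts by `{x, v ⊗ w} = {x, v} ⊗ w + v ⊗ {x, w}`. -/
def tensor (r : QRep K A V) (l : LieRep K A W) : QRep K A (V ⊗[K] W) where
  env := AlgHom.ofLinearMap (LinearMap.rTensorHom W ∘ₗ r.env.toLinearMap)
    (by ext; simp) (fun b c => by ext; simp)
  lie := LinearMap.rTensorHom W ∘ₗ r.lie + LinearMap.lTensorHom V ∘ₗ l.act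
  lie_bracket x y := by
    ext v w
    simp [r.lie_bracket, l.act_bracket, TensorProduct.sub_tmul, TensorProduct.tmul_sub]
    abel
  lie_env x b := by
    ext v w
    have h := LinearMap.congr_fun (r.lie_env x b) v
    simp only [Module.End.mul_apply, LinearMap.add_apply] at h
    simp [h, TensorProduct.add_tmul]
    abel

@[simp] lemma tensor_env (r : QRep K A V) (l : LieRep K A W) (b : Env K A) (v : V) (w : W) :
    (r.tensor l).env b (v ⊗ₜ w) = r.env b v ⊗ₜ w := rfl

@[simp] lemma tensor_lie (r : QRep K A V) (l : LieRep K A W) (x : A) (v : V) (w : W) :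
    (r.tensor l).lie x (v ⊗ₜ w) = r.lie x v ⊗ₜ w + v ⊗ₜ l.act x w := rfl

/-- The morphism `f ⊗ id`. -/
def homR (r : QRep K A V) (r' : QRep K A V') (l : LieRep K A W) (f : V →ₗ[K] V')
    (hb : ∀ b m, f (r.env b m) = r'.env b (f m)) (hl : ∀ x m, f (r.lie x m) = r'.lie x (f m)) :
    (r.tensor l).obj ⟶ (r'.tensor l).obj :=
  (r.tensor l).hom (r'.tensor l) (f.rTensor W)
    (fun b m => by
      induction m using TensorProduct.induction_on with
      | zero => simp
      | add m m' h h' => simp only [map_add, h, h']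
      | tmul v w => simp [hb])
    (fun x m => by
      induction m using TensorProduct.induction_on with
      | zero => simp
      | add m m' h h' => simp only [map_add, h, h']
      | tmul v w => simp [hl])

/-- The morphism `id ⊗ f`. -/
def homL (r : QRep K A V) (l : LieRep K A W) (l' : LieRep K A W') (f : W →ₗ[K] W')
    (hl : ∀ x m, f (l.act x m) = l'.act x (f m)) :
    (r.tensor l).obj ⟶ (r.tensor l').obj :=
  (r.tensor l).hom (r.tensor l') (f.lTensor V)
    (fun b m => by
      induction m using TensorProduct.induction_on with
      | zero => simp
      | add m m' h h' => simp only [map_add, h, h']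
      | tmul v w => simp)
    (fun x m => by
      induction m using TensorProduct.induction_on with
      | zero => simp
      | add m m' h h' => simp only [map_add, h, h']
      | tmul v w => simp [hl])

variable (K A) in
/-- The quasi-Poisson module `A² = A ⊗ A`, with the outer bimodule structure `b(a ⊗ c)d = ba ⊗ cd`
and `{x, a ⊗ c} = {x, a} ⊗ c + a ⊗ {x, c}`; its underlying space is `Aᵉ = A ⊗ Aᵒᵖ`. -/
def regular : QRep K A (Env K A) where
  env := Algebra.lmul K (Env K A)
  lie := envLie K
  lie_bracket := envLie_bracket K
  lie_env x b := by
    apply LinearMap.ext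
    intro c
    exact envLie_mul K x b c

end QRep

end Modules

section ScalarExtension

variable {R S : Type u} [Ring R] [Ring S] (φ : R →+* S)

/-- The submodule of `S ⊗ M` spanned by the elements `sφ(r) ⊗ m - s ⊗ rm`. -/
def balanced (M : Type u) [AddCommGroup M] [Module R M] : Submodule S (S ⊗[ℤ] M) :=
  Submodule.span S {z | ∃ (s : S) (r : R) (m : M), z = (s * φ r) ⊗ₜ[ℤ] m - s ⊗ₜ[ℤ] (r • m)}

/-- The tensor product `S ⊗_R M` over a noncommutative ring `R`, where `S` is a right `R`-module
through `φ : R → S`. It is a left `S`-module. -/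
abbrev Bal (M : Type u) [AddCommGroup M] [Module R M] : Type u := (S ⊗[ℤ] M) ⧸ balanced φ M

/-- The element `s ⊗ m` of `S ⊗_R M`. -/
def Bal.tmul {M : Type u} [AddCommGroup M] [Module R M] (s : S) (m : M) : Bal φ M :=
  (balanced φ M).mkQ (s ⊗ₜ[ℤ] m)

/-- The map `id ⊗ f : S ⊗_R M → S ⊗_R N`. -/
def Bal.map {M N : Type u} [AddCommGroup M] [Module R M] [AddCommGroup N] [Module R N]
    (f : M →ₗ[R] N) : Bal φ M →ₗ[S] Bal φ N :=
  (balanced φ M).mapQ (balanced φ N)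
    (TensorProduct.AlgebraTensorModule.map (LinearMap.id : S →ₗ[S] S) f.toAddMonoidHom.toIntLinearMap)
    (Submodule.span_le.2 (by
      rintro _ ⟨s, r, m, rfl⟩
      exact Submodule.subset_span ⟨s, r, f m, by simp⟩))

@[simp] lemma Bal.map_tmul {M N : Type u} [AddCommGroup M] [Module R M] [AddCommGroup N]
    [Module R N] (f : M →ₗ[R] N) (s : S) (m : M) :
    Bal.map φ f (Bal.tmul φ s m) = Bal.tmul φ s (f m) := rfl

lemma Bal.hom_ext {M : Type u} [AddCommGroup M] [Module R M] {N : Type u} [AddCommGroup N]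
    [Module S N] {f g : Bal φ M →ₗ[S] N}
    (h : ∀ s m, f (Bal.tmul φ s m) = g (Bal.tmul φ s m)) : f = g := by
  apply Submodule.linearMap_qext
  ext m
  exact h 1 m

/-- The functor `S ⊗_R - ` from left `R`-modules to left `S`-modules. -/
def scalarExt : ModuleCat.{u} R ⥤ ModuleCat.{u} S where
  obj M := ModuleCat.of S (Bal φ M)
  map f := ModuleCat.ofHom (Bal.map φ f.hom)
  map_id M := by
    apply ModuleCat.hom_ext
    exact Bal.hom_ext φ fun s m => rfl
  map_comp f g := by
    apply ModuleCat.hom_ext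
    exact Bal.hom_ext φ fun s m => rfl

instance : (scalarExt φ).Additive where
  map_add {M N f g} := by
    apply ModuleCat.hom_ext
    refine Bal.hom_ext φ fun s m => ?_
    change Bal.tmul φ s (f.hom m + g.hom m) = Bal.tmul φ s (f.hom m) + Bal.tmul φ s (g.hom m)
    simp [Bal.tmul, TensorProduct.tmul_add]

end ScalarExtension

section ChevalleyEilenberg

variable (K : Type u) {A : Type u} [Field K] [Ring A] [Algebra K A] [PoissonAlgebra K A]

/-- The map `(x₁, …, xⱼ) ↦ y ∧ x₁ ∧ ⋯ ∧ xⱼ`, as a linear function of `y`. -/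
def wedgeAlt (j : ℕ) : A →ₗ[K] A [⋀^Fin j]→ₗ[K] ⋀[K]^(j + 1) A :=
  AlternatingMap.curryLeft (exteriorPower.ιMulti K (j + 1))

/-- The Lie action of `x` on exterior powers,
`x₁ ∧ ⋯ ∧ xⱼ ↦ ∑ₜ x₁ ∧ ⋯ ∧ {x, xₜ} ∧ ⋯ ∧ xⱼ`, written as
`∑ₜ (-1)ᵗ⁻¹ {x, xₜ} ∧ x₁ ∧ ⋯ x̂ₜ ⋯ ∧ xⱼ`. -/
def lieAlt : ∀ j : ℕ, A →ₗ[K] A [⋀^Fin j]→ₗ[K] ⋀[K]^j A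
  | 0 => 0
  | j + 1 => AlternatingMap.alternatizeUncurryFinLM ∘ₗ
      (LinearMap.llcomp K A A _ (wedgeAlt K j)) ∘ₗ ad K

variable {N : Type u} [AddCommGroup N] [Module K N] (ρ : A →ₗ[K] Module.End K N)

/-- The trilinear expression `ρ(x)n ⊗ ω - ½ n ⊗ {x, ω}`. -/
def ceTerm (j : ℕ) : N →ₗ[K] A →ₗ[K] A [⋀^Fin j]→ₗ[K] N ⊗[K] ⋀[K]^j A :=
  LinearMap.mk₂ K
    (fun n x => (TensorProduct.mk K N _ (ρ x n)).compAlternatingMap (exteriorPower.ιMulti K j)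
      - (2⁻¹ : K) • (TensorProduct.mk K N _ n).compAlternatingMap (lieAlt K j x))
    (fun n n' x => by ext; simp [TensorProduct.add_tmul]; abel)
    (fun c n x => by ext; simp [TensorProduct.smul_tmul', smul_sub, smul_comm c])
    (fun n x x' => by ext; simp [TensorProduct.add_tmul, TensorProduct.tmul_add]; abel)
    (fun c n x => by ext; simp [TensorProduct.smul_tmul', smul_sub, smul_comm c])

/-- The Chevalley-Eilenberg (Koszul) differential `N ⊗ ∧ʲ⁺¹ → N ⊗ ∧ʲ` with coefficients in a
right Lie module `N`, where `x` acts on `N` from the right by `ρ(x)`. Explicitly, see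
`ceD_apply`, it sends `n ⊗ x₀ ∧ ⋯ ∧ xⱼ` to
`∑ₖ (-1)ᵏ n·xₖ ⊗ x₀ ∧ ⋯ x̂ₖ ⋯ ∧ xⱼ
  + ∑_{p < q} (-1)ᵖ⁺ᑫ n ⊗ {xₚ, x_q} ∧ x₀ ∧ ⋯ x̂ₚ ⋯ x̂_q ⋯ ∧ xⱼ`. -/
def ceD (j : ℕ) : N ⊗[K] ⋀[K]^(j + 1) A →ₗ[K] N ⊗[K] ⋀[K]^j A :=
  TensorProduct.lift (exteriorPower.alternatingMapLinearEquiv.toLinearMap ∘ₗ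
    AlternatingMap.alternatizeUncurryFinLM ∘ₗ ceTerm K ρ j)

lemma ceD_tmul (j : ℕ) (n : N) (v : Fin (j + 1) → A) :
    ceD K ρ j (n ⊗ₜ exteriorPower.ιMulti K (j + 1) v) =
      ∑ k : Fin (j + 1), (-1 : ℤ) ^ (k : ℕ) •
        (ρ (v k) n ⊗ₜ exteriorPower.ιMulti K j (k.removeNth v)
          - (2⁻¹ : K) • n ⊗ₜ lieAlt K j (v k) (k.removeNth v)) := by
  simp [ceD, AlternatingMap.alternatizeUncurryFin_apply, ceTerm]

lemma lieAlt_succ (j : ℕ) (x : A) (v : Fin (j + 1) → A) :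
    lieAlt K (j + 1) x v = ∑ k : Fin (j + 1), (-1 : ℤ) ^ (k : ℕ) •
      exteriorPower.ιMulti K (j + 1) (Fin.cons (ad K x (v k)) (k.removeNth v)) := by
  simp [lieAlt, AlternatingMap.alternatizeUncurryFin_apply, wedgeAlt, Matrix.vecCons]

lemma ceD_apply_one (n : N) (x : A) :
    ceD K ρ 0 (n ⊗ₜ exteriorPower.ιMulti K 1 ![x]) =
      ρ x n ⊗ₜ exteriorPower.ιMulti K 0 ![] := by
  simp [ceD_tmul, lieAlt, Subsingleton.elim _ (![] : Fin 0 → A)]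

/-- The explicit formula for the differential. The pairs `p < q` of indices are written as
`p = i.castSucc`, `q = j.succ` with `i ≤ j`. -/
lemma ceD_apply [CharZero K] (m : ℕ) (n : N) (v : Fin (m + 2) → A) :
    ceD K ρ (m + 1) (n ⊗ₜ exteriorPower.ιMulti K (m + 2) v) =
      ∑ k : Fin (m + 2), (-1 : ℤ) ^ (k : ℕ) •
        ρ (v k) n ⊗ₜ[K] exteriorPower.ιMulti K (m + 1) (k.removeNth v)
      + ∑ i : Fin (m + 1), ∑ j ≥ i, (-1 : ℤ) ^ ((i.castSucc : ℕ) + (j.succ : ℕ)) •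
        n ⊗ₜ[K] exteriorPower.ιMulti K (m + 1)
          (Fin.cons (ad K (v i.castSucc) (v j.succ)) (j.removeNth (i.castSucc.removeNth v))) := by
  rw [ceD_tmul]
  simp only [smul_sub, Finset.sum_sub_distrib]
  rw [sub_eq_add_neg]
  congr 1
  have h := AlternatingMap.alternatizeUncurryFin_alternatizeUncurryFinLM_comp_apply
    ((LinearMap.llcomp K A A _ (wedgeAlt K m)) ∘ₗ ad K) v
  have h1 : ∑ k : Fin (m + 2), (-1 : ℤ) ^ (k : ℕ) • lieAlt K (m + 1) (v k) (k.removeNth v) =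
      (2 : K) • ∑ i : Fin (m + 1), ∑ j ≥ i, (-1 : ℤ) ^ (i + j : ℕ) •
        exteriorPower.ιMulti K (m + 1)
          (Fin.cons (ad K (v i.castSucc) (v j.succ)) (j.removeNth (i.castSucc.removeNth v))) := by
    rw [AlternatingMap.alternatizeUncurryFin_apply] at h
    refine h.trans ?_
    simp only [Finset.smul_sum]
    refine Finset.sum_congr rfl fun i _ => Finset.sum_congr rfl fun j _ => ?_
    rw [smul_comm (2 : K)]
    congr 1
    simp only [LinearMap.comp_apply, LinearMap.llcomp_apply]
    rw [ad_skew K (v j.succ) (v i.castSucc), map_neg, AlternatingMap.neg_apply, sub_neg_eq_add,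
      two_smul]
    rfl
  have h2 : ∑ k : Fin (m + 2), (-1 : ℤ) ^ (k : ℕ) • (2⁻¹ : K) • n ⊗ₜ[K]
      lieAlt K (m + 1) (v k) (k.removeNth v) = (2⁻¹ : K) • n ⊗ₜ[K]
      ∑ k : Fin (m + 2), (-1 : ℤ) ^ (k : ℕ) • lieAlt K (m + 1) (v k) (k.removeNth v) := by
    simp only [TensorProduct.tmul_sum, Finset.smul_sum, TensorProduct.tmul_smul]
    exact Finset.sum_congr rfl fun k _ => smul_comm _ _ _
  rw [h2, h1, TensorProduct.tmul_smul, inv_smul_smul₀ two_ne_zero]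
  simp only [TensorProduct.tmul_sum, ← Finset.sum_neg_distrib, TensorProduct.tmul_smul]
  refine Finset.sum_congr rfl fun i _ => Finset.sum_congr rfl fun j _ => ?_
  simp only [Fin.val_castSucc, Fin.val_succ]
  rw [← add_assoc, pow_succ, mul_neg_one, neg_smul]

/-- Exterior multiplication `n ⊗ ω ↦ n ⊗ x ∧ ω`. -/
def ext1 (j : ℕ) (x : A) : N ⊗[K] ⋀[K]^j A →ₗ[K] N ⊗[K] ⋀[K]^(j + 1) A :=
  (exteriorPower.alternatingMapLinearEquiv (wedgeAlt K j x)).lTensor N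

/-- The operator `n ⊗ ω ↦ n ⊗ {x, ω} - ρ(x)n ⊗ ω`. -/
def theta (j : ℕ) (x : A) : N ⊗[K] ⋀[K]^j A →ₗ[K] N ⊗[K] ⋀[K]^j A :=
  (exteriorPower.alternatingMapLinearEquiv (lieAlt K j x)).lTensor N - (ρ x).rTensor _

lemma ext1_tmul (j : ℕ) (x : A) (n : N) (v : Fin j → A) :
    ext1 K j x (n ⊗ₜ exteriorPower.ιMulti K j v) =
      n ⊗ₜ exteriorPower.ιMulti K (j + 1) (Fin.cons x v) := by
  simp [ext1, wedgeAlt, Matrix.vecCons]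

lemma theta_tmul (j : ℕ) (x : A) (n : N) (v : Fin j → A) :
    theta K ρ j x (n ⊗ₜ exteriorPower.ιMulti K j v) =
      n ⊗ₜ lieAlt K j x v - ρ x n ⊗ₜ exteriorPower.ιMulti K j v := by
  simp [theta]

variable {K} in
lemma ext_tmul {j : ℕ} {X : Type u} [AddCommGroup X] [Module K X]
    {f g : N ⊗[K] ⋀[K]^j A →ₗ[K] X}
    (h : ∀ n v, f (n ⊗ₜ exteriorPower.ιMulti K j v) = g (n ⊗ₜ exteriorPower.ιMulti K j v)) :
    f = g := by
  apply TensorProduct.ext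
  ext n : 1
  apply exteriorPower.linearMap_ext
  ext v
  exact h n v

variable {K} in
lemma ext_ext1 {j : ℕ} {X : Type u} [AddCommGroup X] [Module K X]
    {f g : N ⊗[K] ⋀[K]^(j + 1) A →ₗ[K] X} (h : ∀ x z, f (ext1 K j x z) = g (ext1 K j x z)) :
    f = g := by
  refine ext_tmul fun n v => ?_
  have := h (v 0) (n ⊗ₜ exteriorPower.ιMulti K j (Fin.tail v))
  rwa [ext1_tmul, Fin.cons_self_tail] at this

lemma removeNth_succ_cons {j : ℕ} (k : Fin (j + 1)) (x : A) (v : Fin (j + 1) → A) :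
    k.succ.removeNth (Fin.cons x v : Fin (j + 2) → A) = Fin.cons x (k.removeNth v) := by
  ext i
  cases i using Fin.cases <;> simp [Fin.removeNth]

lemma removeNth_zero_cons {j : ℕ} (x : A) (v : Fin j → A) :
    (0 : Fin (j + 1)).removeNth (Fin.cons x v : Fin (j + 1) → A) = v := by
  ext i
  simp [Fin.removeNth]

/-- swapping two factors -/
lemma ιMulti_swap (j : ℕ) (x y : A) (v : Fin j → A) :
    exteriorPower.ιMulti K (j + 2) (Fin.cons x (Fin.cons y v : Fin (j + 1) → A)) =
      - exteriorPower.ιMulti K (j + 2) (Fin.cons y (Fin.cons x v : Fin (j + 1) → A)) := by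
  rw [← AlternatingMap.map_swap _ _ (show (0 : Fin (j + 2)) ≠ 1 by simp)]
  congr 1
  ext i
  cases i using Fin.cases with
  | zero => simp
  | succ i =>
    cases i using Fin.cases with
    | zero => simp
    | succ i =>
      have h1 : (i.succ.succ : Fin (j + 2)) ≠ 0 := Fin.succ_ne_zero _
      have h2 : (i.succ.succ : Fin (j + 2)) ≠ 1 := fun h =>
        Fin.succ_ne_zero i (Fin.succ_injective _ h)
      simp [Equiv.swap_apply_of_ne_of_ne h1 h2]

lemma lieAlt_cons (j : ℕ) (y x : A) (v : Fin j → A) :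
    lieAlt K (j + 1) y (Fin.cons x v) =
      exteriorPower.ιMulti K (j + 1) (Fin.cons (ad K y x) v) +
      exteriorPower.alternatingMapLinearEquiv (wedgeAlt K j x) (lieAlt K j y v) := by
  rw [lieAlt_succ, Fin.sum_univ_succ]
  congr 1
  · simp [removeNth_zero_cons]
  · cases j with
    | zero => simp [lieAlt]
    | succ j =>
      rw [lieAlt_succ, map_sum]
      refine Finset.sum_congr rfl fun k _ => ?_
      rw [removeNth_succ_cons, ιMulti_swap, Fin.cons_succ, map_zsmul,
        exteriorPower.alternatingMapLinearEquiv_apply_ιMulti, Fin.val_succ, pow_succ]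
      simp [wedgeAlt, Matrix.vecCons]

lemma theta_ext1 (j : ℕ) (y x : A) (z : N ⊗[K] ⋀[K]^j A) :
    theta K ρ (j + 1) y (ext1 K j x z) = ext1 K j (ad K y x) z + ext1 K j x (theta K ρ j y z) := by
  have : theta K ρ (j + 1) y ∘ₗ ext1 K j x = ext1 K j (ad K y x) + ext1 K j x ∘ₗ theta K ρ j y := by
    refine ext_tmul fun n v => ?_
    simp only [LinearMap.comp_apply, LinearMap.add_apply, ext1_tmul, theta_tmul, lieAlt_cons,
      map_sub, TensorProduct.tmul_add]
    simp only [ext1, LinearMap.lTensor_tmul]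
    abel
  exact LinearMap.congr_fun this z

lemma ceD_ext1_zero (x : A) (z : N ⊗[K] ⋀[K]^0 A) :
    ceD K ρ 0 (ext1 K 0 x z) = - theta K ρ 0 x z := by
  have : ceD K ρ 0 ∘ₗ ext1 K 0 x = - theta K ρ 0 x := by
    refine ext_tmul fun n v => ?_
    simp only [LinearMap.comp_apply, LinearMap.neg_apply, ext1_tmul, theta_tmul, ceD_tmul]
    simp [lieAlt, removeNth_zero_cons]
  exact LinearMap.congr_fun this z

lemma ceD_ext1 [CharZero K] (j : ℕ) (x : A) (z : N ⊗[K] ⋀[K]^(j + 1) A) :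
    ceD K ρ (j + 1) (ext1 K (j + 1) x z) =
      - theta K ρ (j + 1) x z - ext1 K j x (ceD K ρ j z) := by
  have : ceD K ρ (j + 1) ∘ₗ ext1 K (j + 1) x =
      - theta K ρ (j + 1) x - ext1 K j x ∘ₗ ceD K ρ j := by
    refine ext_tmul fun n v => ?_
    simp only [LinearMap.comp_apply, LinearMap.neg_apply, LinearMap.sub_apply, ext1_tmul,
      theta_tmul, ceD_tmul]
    rw [Fin.sum_univ_succ]
    have key : ∀ k : Fin (j + 1), (-1 : ℤ) ^ (k.succ : ℕ) •
        (ρ ((Fin.cons x v : Fin (j + 2) → A) k.succ) n ⊗ₜ[K] exteriorPower.ιMulti K (j + 1)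
            (k.succ.removeNth (Fin.cons x v : Fin (j + 2) → A)) -
          (2⁻¹ : K) • n ⊗ₜ[K] lieAlt K (j + 1) ((Fin.cons x v : Fin (j + 2) → A) k.succ)
            (k.succ.removeNth (Fin.cons x v : Fin (j + 2) → A))) =
        - (2⁻¹ : K) • n ⊗ₜ[K] ((-1 : ℤ) ^ (k : ℕ) • exteriorPower.ιMulti K (j + 1)
          (Fin.cons (ad K x (v k)) (k.removeNth v)))
        - ext1 K j x ((-1 : ℤ) ^ (k : ℕ) • (ρ (v k) n ⊗ₜ exteriorPower.ιMulti K j (k.removeNth v)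
          - (2⁻¹ : K) • n ⊗ₜ lieAlt K j (v k) (k.removeNth v))) := by
      intro k
      rw [removeNth_succ_cons, Fin.cons_succ, lieAlt_cons, map_zsmul, map_sub, ext1_tmul, map_smul,
        Fin.val_succ, pow_succ, mul_neg_one, neg_smul, ad_skew K x (v k)]
      have h : exteriorPower.ιMulti K (j + 1) (Fin.cons (-ad K (v k) x) (k.removeNth v)) =
          - exteriorPower.ιMulti K (j + 1) (Fin.cons (ad K (v k) x) (k.removeNth v)) := by
        have := map_neg (wedgeAlt K j) (ad K (v k) x)
        exact DFunLike.congr_fun this (k.removeNth v)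
      rw [h]
      simp only [ext1, LinearMap.lTensor_tmul, TensorProduct.tmul_add, TensorProduct.tmul_smul,
        smul_sub, smul_add, smul_neg, TensorProduct.tmul_neg, neg_smul]
      rw [smul_comm (2⁻¹ : K)]
      abel
    rw [Finset.sum_congr rfl fun k _ => key k, Finset.sum_sub_distrib, ← map_sum,
      ← Finset.smul_sum, ← TensorProduct.tmul_sum, ← lieAlt_succ]
    simp only [Fin.val_zero, pow_zero, one_smul, Fin.cons_zero, removeNth_zero_cons]
    have h2 : n ⊗ₜ[K] lieAlt K (j + 1) x v = (2⁻¹ : K) • n ⊗ₜ[K] lieAlt K (j + 1) x v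
        + (2⁻¹ : K) • n ⊗ₜ[K] lieAlt K (j + 1) x v := by
      rw [← add_smul, ← two_mul, mul_inv_cancel₀ two_ne_zero, one_smul]
    rw [neg_smul]
    generalize (2⁻¹ : K) • n ⊗ₜ[K] lieAlt K (j + 1) x v = H at h2 ⊢
    rw [h2]
    abel
  exact LinearMap.congr_fun this z

lemma theta_bracket (hρ : ∀ x y, ρ (ad K x y) = ρ y * ρ x - ρ x * ρ y)
    (j : ℕ) (y x : A) (z : N ⊗[K] ⋀[K]^j A) :
    theta K ρ j (ad K y x) z = theta K ρ j y (theta K ρ j x z) - theta K ρ j x (theta K ρ j y z) := by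
  induction j with
  | zero =>
    suffices h : theta K ρ 0 (ad K y x) = theta K ρ 0 y ∘ₗ theta K ρ 0 x
      - theta K ρ 0 x ∘ₗ theta K ρ 0 y from LinearMap.congr_fun h z
    refine ext_tmul fun n v => ?_
    simp only [LinearMap.comp_apply, LinearMap.sub_apply, theta_tmul, lieAlt, hρ, map_sub]
    simp [theta_tmul, lieAlt, TensorProduct.sub_tmul]
  | succ j ih =>
    suffices h : theta K ρ (j + 1) (ad K y x) = theta K ρ (j + 1) y ∘ₗ theta K ρ (j + 1) x
      - theta K ρ (j + 1) x ∘ₗ theta K ρ (j + 1) y from LinearMap.congr_fun h z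
    refine ext_ext1 fun w z => ?_
    simp only [LinearMap.comp_apply, LinearMap.sub_apply, theta_ext1, map_add, ih, ad_ad, map_sub]
    have h : ext1 K j (ad K y (ad K x w) - ad K x (ad K y w)) z =
        ext1 K j (ad K y (ad K x w)) z - ext1 K j (ad K x (ad K y w)) z := by
      have : ∀ a b : A, ext1 K (N := N) j (a - b) = ext1 K j a - ext1 K j b := fun a b => by
        simp [ext1]
      rw [this]; rfl
    rw [h]
    abel

lemma theta_ceD [CharZero K] (hρ : ∀ x y, ρ (ad K x y) = ρ y * ρ x - ρ x * ρ y)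
    (j : ℕ) (y : A) (z : N ⊗[K] ⋀[K]^(j + 1) A) :
    theta K ρ j y (ceD K ρ j z) = ceD K ρ j (theta K ρ (j + 1) y z) := by
  suffices h : theta K ρ j y ∘ₗ ceD K ρ j = ceD K ρ j ∘ₗ theta K ρ (j + 1) y from
    LinearMap.congr_fun h z
  clear z
  induction j with
  | zero =>
    refine ext_ext1 fun x z => ?_
    simp only [LinearMap.comp_apply, theta_ext1, map_add, ceD_ext1_zero, map_neg,
      theta_bracket K ρ hρ]
    abel
  | succ j ih =>
    refine ext_ext1 fun x z => ?_
    have ih' := LinearMap.congr_fun ih z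
    simp only [LinearMap.comp_apply] at ih'
    simp only [LinearMap.comp_apply, theta_ext1, map_add, ceD_ext1, map_neg, map_sub,
      theta_bracket K ρ hρ, ih']
    abel

lemma ceD_ceD [CharZero K] (hρ : ∀ x y, ρ (ad K x y) = ρ y * ρ x - ρ x * ρ y)
    (j : ℕ) (z : N ⊗[K] ⋀[K]^(j + 2) A) :
    ceD K ρ j (ceD K ρ (j + 1) z) = 0 := by
  suffices h : ceD K ρ j ∘ₗ ceD K ρ (j + 1) = 0 from LinearMap.congr_fun h z
  clear z
  induction j with
  | zero =>
    refine ext_ext1 fun x z => ?_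
    simp [ceD_ext1, ceD_ext1_zero, theta_ceD K ρ hρ]
  | succ j ih =>
    refine ext_ext1 fun x z => ?_
    have ih' := LinearMap.congr_fun ih z
    simp only [LinearMap.comp_apply, LinearMap.zero_apply] at ih'
    simp [ceD_ext1, theta_ceD K ρ hρ, ih']

/-- Naturality of the differential in the coefficients. -/
lemma ceD_natural {N' : Type u} [AddCommGroup N'] [Module K N'] (ρ' : A →ₗ[K] Module.End K N')
    (f : N →ₗ[K] N') (hf : ∀ x n, f (ρ x n) = ρ' x (f n)) (j : ℕ) (z : N ⊗[K] ⋀[K]^(j + 1) A) :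
    f.rTensor _ (ceD K ρ j z) = ceD K ρ' j (f.rTensor _ z) := by
  suffices h : f.rTensor _ ∘ₗ ceD K ρ j = ceD K ρ' j ∘ₗ f.rTensor _ from LinearMap.congr_fun h z
  refine ext_tmul fun n v => ?_
  simp only [LinearMap.comp_apply, ceD_tmul, map_sum, LinearMap.rTensor_tmul, map_zsmul, map_sub,
    map_smul, hf]

end ChevalleyEilenberg

section TensorPowers

variable (K A : Type u) [Field K] [Ring A] [Algebra K A] [PoissonAlgebra K A]

/-- The tensor power `Aᵐ = A ⊗ ⋯ ⊗ A` with the Lie action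
`{x, a₁ ⊗ ⋯ ⊗ aₘ} = ∑ₜ a₁ ⊗ ⋯ ⊗ {x, aₜ} ⊗ ⋯ ⊗ aₘ`. -/
def tpow (m : ℕ) : LieRep K A (⨂[K]^m A) where
  act := ∑ t : Fin m, (PiTensorProduct.mapMultilinear K (fun _ : Fin m => A)
    (fun _ : Fin m => A)).toLinearMap 1 t ∘ₗ ad K
  act_bracket x y := by
    have hc : ∀ (s t : Fin m) (f g : A →ₗ[K] A),
        PiTensorProduct.map (Pi.mulSingle (M := fun _ : Fin m => Module.End K A) s f) *
          PiTensorProduct.map (Pi.mulSingle (M := fun _ : Fin m => Module.End K A) t g) =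
        PiTensorProduct.map (Pi.mulSingle (M := fun _ : Fin m => Module.End K A) s f *
          Pi.mulSingle (M := fun _ : Fin m => Module.End K A) t g) :=
      fun s t f g => (PiTensorProduct.map_mul _ _).symm
    have hl : ∀ (t : Fin m) (z : A), ((PiTensorProduct.mapMultilinear K (fun _ : Fin m => A)
        (fun _ : Fin m => A)).toLinearMap 1 t ∘ₗ ad K) z =
        PiTensorProduct.map (Pi.mulSingle (M := fun _ : Fin m => Module.End K A) t (ad K z)) :=
      fun t z => rfl
    simp only [LinearMap.sum_apply, Finset.sum_mul_sum]
    rw [Finset.sum_comm (f := fun i j => ((PiTensorProduct.mapMultilinear K (fun _ : Fin m => A)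
        (fun _ : Fin m => A)).toLinearMap 1 i ∘ₗ ad K) y *
        ((PiTensorProduct.mapMultilinear K (fun _ : Fin m => A)
        (fun _ : Fin m => A)).toLinearMap 1 j ∘ₗ ad K) x), ← Finset.sum_sub_distrib]
    refine Finset.sum_congr rfl fun t _ => ?_
    rw [← Finset.sum_sub_distrib, Finset.sum_eq_single t]
    · simp only [hl, hc, ← Pi.mulSingle_mul]
      have h := map_sub ((PiTensorProduct.mapMultilinear K (fun _ : Fin m => A)
        (fun _ : Fin m => A)).toLinearMap 1 t) (ad K x * ad K y) (ad K y * ad K x)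
      have h2 : ad K (ad K x y) = ad K x * ad K y - ad K y * ad K x := by
        ext z; exact ad_ad K x y z
      rw [h2]
      exact h
    · intro s _ hs
      simp only [hl, hc]
      rw [(Pi.mulSingle_commute (f := fun _ : Fin m => Module.End K A) hs.symm _ _).eq, sub_self]
    · simp

variable {K A}

lemma tpow_act (m : ℕ) (x : A) (v : Fin m → A) :
    (tpow K A m).act x (PiTensorProduct.tprod K v) =
      ∑ t, PiTensorProduct.tprod K (Function.update v t (ad K x (v t))) := by
  simp only [tpow, LinearMap.sum_apply, LinearMap.comp_apply]
  refine Finset.sum_congr rfl fun t _ => ?_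
  rw [MultilinearMap.toLinearMap_apply, PiTensorProduct.mapMultilinear_apply,
    PiTensorProduct.map_tprod]
  congr 1
  ext i
  by_cases h : i = t
  · subst h; simp
  · simp [h]

end TensorPowers

section Hochschild

variable {K A : Type u} [Field K] [Ring A] [Algebra K A]

/-- The `S`-linear map `S ⊗ V → N`, `s ⊗ v ↦ sφ(v)`. -/
def freeLift {S : Type u} [Ring S] [Algebra K S] {V N : Type u} [AddCommGroup V] [Module K V]
    [AddCommGroup N] [Module K N] [Module S N] [IsScalarTower K S N]
    (φ : V →ₗ[K] N) : S ⊗[K] V →ₗ[S] N :=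
  TensorProduct.AlgebraTensorModule.lift
    { toFun := fun s => (Algebra.lsmul K K N s).comp φ
      map_add' := fun s t => by ext; simp [add_smul]
      map_smul' := fun s t => by ext; simp [mul_smul] }

@[simp] lemma freeLift_tmul {S : Type u} [Ring S] [Algebra K S] {V N : Type u} [AddCommGroup V]
    [Module K V] [AddCommGroup N] [Module K N] [Module S N] [IsScalarTower K S N]
    (φ : V →ₗ[K] N) (s : S) (v : V) : freeLift φ (s ⊗ₜ[K] v) = s • φ v := rfl

variable (K A) in
/-- The map `a₀ ⊗ ⋯ ⊗ aₘ ↦ a₀ ⊗ ⋯ ⊗ aₖaₖ₊₁ ⊗ ⋯ ⊗ aₘ`. -/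
def mulFace {m : ℕ} (k : Fin m) : MultilinearMap K (fun _ : Fin (m + 1) => A) (⨂[K]^m A) :=
  LinearMap.uncurryMid (M := fun _ : Fin (m + 1) => A) k.succ
    { toFun := fun c => ((PiTensorProduct.mapMultilinear K (fun _ : Fin m => A)
        (fun _ : Fin m => A)).toLinearMap 1 k (LinearMap.mulRight K c)).compMultilinearMap
        (PiTensorProduct.tprod K)
      map_add' := fun c d => by
        have h : LinearMap.mulRight K (c + d) = LinearMap.mulRight K c + LinearMap.mulRight K d := by
          ext; simp [mul_add]
        ext v
        rw [h, map_add]; rfl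
      map_smul' := fun c d => by
        have h : LinearMap.mulRight K (c • d) = c • LinearMap.mulRight K d := by
          ext; simp
        ext v
        rw [h, map_smul]; rfl }

lemma mulFace_apply {m : ℕ} (k : Fin m) (v : Fin (m + 1) → A) :
    mulFace K A k v = PiTensorProduct.tprod K (Fin.contractNth k.castSucc (· * ·) v) := by
  have h1 : mulFace K A k v = PiTensorProduct.map (Pi.mulSingle
      (M := fun _ : Fin m => Module.End K A) k (LinearMap.mulRight K (v k.succ)))
      (PiTensorProduct.tprod K (k.succ.removeNth v)) := rfl
  rw [h1, PiTensorProduct.map_tprod]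
  congr 1
  ext i
  rcases lt_trichotomy (i : ℕ) k with h | h | h
  · have hik : i ≠ k := by rintro rfl; omega
    rw [Fin.contractNth_apply_of_lt _ _ _ _ (by simpa using h)]
    have h2 : k.succ.succAbove i = i.castSucc := Fin.succAbove_of_castSucc_lt _ _ (by
      simp only [Fin.lt_def, Fin.val_castSucc, Fin.val_succ]; omega)
    simp [hik, Fin.removeNth, h2]
  · have hik : i = k := Fin.ext h
    subst hik
    rw [Fin.contractNth_apply_of_eq _ _ _ _ (by simp)]
    have h2 : i.succ.succAbove i = i.castSucc := Fin.succAbove_of_castSucc_lt _ _ (by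
      simp only [Fin.lt_def, Fin.val_castSucc, Fin.val_succ]; omega)
    simp [Fin.removeNth, h2]
  · have hik : i ≠ k := by rintro rfl; omega
    rw [Fin.contractNth_apply_of_gt _ _ _ _ (by simpa using h)]
    have h2 : k.succ.succAbove i = i.succ := Fin.succAbove_of_le_castSucc _ _ (by
      simp only [Fin.le_def, Fin.val_castSucc, Fin.val_succ]; omega)
    simp [hik, Fin.removeNth, h2]

variable {S : Type u} [Ring S] [Algebra K S] (ι : Env K A →ₐ[K] S)

/-- The map `A → S`, `a ↦ ι(a ⊗ 1')`. -/
def inL : A →ₗ[K] S := ι.toLinearMap ∘ₗ (TensorProduct.mk K A Aᵐᵒᵖ).flip 1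

/-- The map `A → S`, `a ↦ ι(1 ⊗ a')`. -/
def inR : A →ₗ[K] S := ι.toLinearMap ∘ₗ TensorProduct.mk K A Aᵐᵒᵖ 1 ∘ₗ
  (MulOpposite.opLinearEquiv K).toLinearMap

lemma inL_apply (a : A) : inL ι a = ι (a ⊗ₜ 1) := rfl
lemma inR_apply (a : A) : inR ι a = ι (1 ⊗ₜ MulOpposite.op a) := rfl

lemma inL_mul (a b : A) : inL ι (a * b) = inL ι a * inL ι b := by
  simp [inL_apply, ← map_mul]

lemma inR_mul (a b : A) : inR ι (a * b) = inR ι b * inR ι a := by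
  simp [inR_apply, ← map_mul]

lemma inL_inR (a b : A) : inL ι a * inR ι b = inR ι b * inL ι a := by
  simp [inL_apply, inR_apply, ← map_mul]

/-- The map `(a₀, …, aₘ) ↦ τ(aₚ) ⊗ a₀ ⊗ ⋯ âₚ ⋯ ⊗ aₘ`. -/
def endFace {m : ℕ} (p : Fin (m + 1)) (τ : A →ₗ[K] S) :
    MultilinearMap K (fun _ : Fin (m + 1) => A) (S ⊗[K] ⨂[K]^m A) :=
  LinearMap.uncurryMid (M := fun _ : Fin (m + 1) => A) p
    { toFun := fun a => (TensorProduct.mk K S (⨂[K]^m A) (τ a)).compMultilinearMap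
        (PiTensorProduct.tprod K)
      map_add' := fun a b => by ext; simp [TensorProduct.add_tmul]
      map_smul' := fun a b => by ext; simp [TensorProduct.smul_tmul'] }

/-- The value of the differential `hb` on generators:
`a₀ ⊗ ⋯ ⊗ aₘ ↦ ι(a₀ ⊗ 1') ⊗ a₁ ⊗ ⋯ ⊗ aₘ
  + ∑ₖ (-1)ᵏ⁺¹ 1 ⊗ a₀ ⊗ ⋯ ⊗ aₖaₖ₊₁ ⊗ ⋯ ⊗ aₘ + (-1)ᵐ⁺¹ ι(1 ⊗ aₘ') ⊗ a₀ ⊗ ⋯ ⊗ aₘ₋₁`. -/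
def hbGen (m : ℕ) : ⨂[K]^(m + 1) A →ₗ[K] S ⊗[K] ⨂[K]^m A :=
  PiTensorProduct.lift
    (endFace 0 (inL ι)
    + ∑ k : Fin m, (-1 : ℤ) ^ ((k : ℕ) + 1) • (TensorProduct.mk K S _ 1).compMultilinearMap
        (mulFace K A k)
    + (-1 : ℤ) ^ (m + 1) • endFace (Fin.last m) (inR ι))

/-- The Hochschild (bar) differential `S ⊗ Aᵐ⁺¹ → S ⊗ Aᵐ` with coefficients in an algebra
`S` over `Aᵉ`; see `hb_tmul` for the explicit formula. -/
def hb (m : ℕ) : S ⊗[K] ⨂[K]^(m + 1) A →ₗ[S] S ⊗[K] ⨂[K]^m A := freeLift (hbGen ι m)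

open PiTensorProduct in
lemma hb_tmul (m : ℕ) (s : S) (v : Fin (m + 1) → A) :
    hb ι m (s ⊗ₜ tprod K v) =
      (s * inL ι (v 0)) ⊗ₜ[K] tprod K (Fin.tail v)
      + ∑ k : Fin m, (-1 : ℤ) ^ ((k : ℕ) + 1) •
          s ⊗ₜ[K] tprod K (Fin.contractNth k.castSucc (· * ·) v)
      + (-1 : ℤ) ^ (m + 1) • (s * inR ι (v (Fin.last m))) ⊗ₜ[K] tprod K (Fin.init v) := by
  have h0 : (Fin.removeNth 0 v : Fin m → A) = Fin.tail v := by
    ext i; simp [Fin.removeNth, Fin.tail]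
  have h1 : (Fin.removeNth (Fin.last m) v : Fin m → A) = Fin.init v := by
    ext i; simp [Fin.removeNth, Fin.init]
  have e : ∀ (p : Fin (m + 1)) (τ : A →ₗ[K] S), endFace p τ v =
      τ (v p) ⊗ₜ[K] tprod K (Fin.removeNth p v) := fun p τ => rfl
  have hz : ∀ (c : ℤ) (f : MultilinearMap K (fun _ : Fin (m + 1) => A) (S ⊗[K] ⨂[K]^m A)),
    (c • f) v = c • f v := fun c f => rfl
  rw [hb, freeLift_tmul, hbGen, lift.tprod]
  simp only [MultilinearMap.add_apply, MultilinearMap.sum_apply, hz, e,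
    LinearMap.compMultilinearMap_apply, TensorProduct.mk_apply, mulFace_apply, h0, h1, smul_add,
    Finset.smul_sum, smul_comm s, TensorProduct.smul_tmul' s, smul_eq_mul, mul_one]

/-- The faces of a tuple. -/
def faceT {m : ℕ} (k : Fin (m + 2)) (v : Fin (m + 1) → A) : Fin m → A :=
  Fin.cases (motive := fun _ => Fin m → A) (Fin.tail v) (fun k => Fin.contractNth k (· * ·) v) k

/-- The coefficients of the faces. -/
def faceS {m : ℕ} (k : Fin (m + 2)) (s : S) (v : Fin (m + 1) → A) : S :=
  if k = 0 then s * inL ι (v 0) else if k = Fin.last _ then s * inR ι (v (Fin.last m)) else s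

lemma faceT_zero {m : ℕ} (v : Fin (m + 1) → A) : faceT 0 v = Fin.tail v := rfl

lemma faceT_succ {m : ℕ} (k : Fin (m + 1)) (v : Fin (m + 1) → A) :
    faceT k.succ v = Fin.contractNth k (· * ·) v := rfl

open PiTensorProduct in
lemma hb_faces (m : ℕ) (s : S) (v : Fin (m + 1) → A) :
    hb ι m (s ⊗ₜ tprod K v) =
      ∑ k : Fin (m + 2), (-1 : ℤ) ^ (k : ℕ) • faceS ι k s v ⊗ₜ[K] tprod K (faceT k v) := by
  rw [hb_tmul, Fin.sum_univ_succ, Fin.sum_univ_castSucc, ← add_assoc]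
  congr 1
  · congr 1
    · simp [faceS, faceT]
    · refine Finset.sum_congr rfl fun k _ => ?_
      have h : (k.castSucc.succ : Fin (m + 2)) ≠ Fin.last _ := by
        simp only [ne_eq, Fin.ext_iff, Fin.val_succ, Fin.val_castSucc, Fin.val_last]; omega
      simp [faceS, faceT, h]
  · have h : Fin.contractNth (Fin.last m) (· * ·) v = Fin.init v := by
      ext i
      rw [Fin.contractNth_apply_of_lt _ _ _ _ (by simp)]; rfl
    have h' : faceS ι (Fin.last m).succ s v = s * inR ι (v (Fin.last m)) := by
      simp [faceS]
    rw [h', faceT_succ, h, Fin.val_succ, Fin.val_last]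

lemma faceT_faceT {m : ℕ} (v : Fin (m + 2) → A) (i j : Fin (m + 2)) (h : i ≤ j) :
    faceT i (faceT j.succ v) = faceT j (faceT i.castSucc v) := by
  cases i using Fin.cases with
  | zero =>
    cases j using Fin.cases with
    | zero =>
      ext l
      rw [faceT_succ]
      simp [faceT_zero, Fin.tail, Fin.contractNth]
    | succ j =>
      ext l
      simp [faceT, Fin.tail, Fin.contractNth]
  | succ i =>
    cases j using Fin.cases with
    | zero => simp at h
    | succ j =>
      ext l
      rw [Fin.succ_le_succ_iff] at h
      simp only [Fin.le_def] at h
      simp only [faceT, Fin.cases_succ, Fin.castSucc_succ, Fin.contractNth, Fin.val_succ,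
        Fin.val_castSucc]
      split_ifs <;> first | omega | rfl | simp [mul_assoc] | skip

lemma faceS_faceS {m : ℕ} (s : S) (v : Fin (m + 2) → A) (i j : Fin (m + 2)) (h : i ≤ j) :
    faceS ι i (faceS ι j.succ s v) (faceT j.succ v) =
      faceS ι j (faceS ι i.castSucc s v) (faceT i.castSucc v) := by
  have e0 : (0 : Fin (m + 1)).castSucc = 0 := rfl
  cases i using Fin.cases with
  | zero =>
    cases j using Fin.cases with
    | zero =>
      have h1 : (0 : Fin (m + 2)).succ ≠ Fin.last (m + 2) := by
        simp [Fin.ext_iff]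
      rw [faceT_succ, Fin.castSucc_zero, faceT_zero]
      simp only [faceS, h1, Fin.succ_ne_zero, if_true, if_false, Fin.contractNth, Fin.tail]
      simp [inL_mul, mul_assoc]
    | succ j =>
      by_cases hj : j = Fin.last m
      · subst hj
        rw [faceT_succ, Fin.castSucc_zero, faceT_zero]
        simp only [faceS, Fin.succ_ne_zero, if_true, if_false, Fin.contractNth, Fin.tail,
          Fin.succ_last]
        simp [mul_assoc, inL_inR]
      · have h1 : (j.succ : Fin (m + 2)) ≠ Fin.last _ := by
          simpa [Fin.ext_iff] using hj
        have h2 : (j.succ.succ : Fin (m + 3)) ≠ Fin.last _ := by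
          simpa [Fin.ext_iff] using hj
        simp [faceS, faceT, Fin.contractNth, h1, h2]
  | succ i =>
    cases j using Fin.cases with
    | zero => simp at h
    | succ j =>
      rw [Fin.succ_le_succ_iff] at h
      have h3 : i.succ.castSucc ≠ (0 : Fin (m + 3)) := fun h' => by
        have := congrArg Fin.val h'
        simp at this
      have h4 : i.succ.castSucc ≠ Fin.last (m + 2) := (Fin.castSucc_lt_last _).ne
      by_cases hj : j = Fin.last m
      · subst hj
        by_cases hi : i = Fin.last m
        · subst hi
          rw [faceT_succ, Fin.castSucc_succ, faceT_succ]
          simp only [faceS, Fin.succ_ne_zero, if_true, if_false, Fin.contractNth, ← Fin.castSucc_succ,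
            h4, Fin.succ_last]
          simp [inR_mul, mul_assoc]
        · have h5 : (i.succ : Fin (m + 2)) ≠ Fin.last _ := by
            simpa [Fin.ext_iff] using hi
          have h6 : (i : ℕ) < m := by
            have := Fin.val_lt_last hi; simpa using this
          have h7 : ¬ m < (i : ℕ) := by omega
          have h8 : ¬ m = (i : ℕ) := by omega
          rw [Fin.castSucc_succ i, faceT_succ, faceT_succ]
          simp only [faceS, Fin.succ_ne_zero, if_true, if_false, Fin.contractNth, ← Fin.castSucc_succ,
            h4, h5, Fin.succ_last]
          simp [h7, h8]
      · have hi : i ≠ Fin.last m := by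
          rintro rfl; exact hj (le_antisymm (Fin.le_last _) h)
        have h1 : (j.succ : Fin (m + 2)) ≠ Fin.last _ := by
          simpa [Fin.ext_iff] using hj
        have h2 : (j.succ.succ : Fin (m + 3)) ≠ Fin.last _ := by
          simpa [Fin.ext_iff] using hj
        have h5 : (i.succ : Fin (m + 2)) ≠ Fin.last _ := by
          simpa [Fin.ext_iff] using hi
        simp [faceS, h1, h2, h3, h4, h5]

lemma alternating_sum_zero {M : Type u} [AddCommGroup M] {n : ℕ} (f : Fin (n + 2) → Fin (n + 1) → M)
    (hf : ∀ i j : Fin (n + 1), i ≤ j → f j.succ i = f i.castSucc j) :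
    ∑ k : Fin (n + 2), ∑ l : Fin (n + 1), (-1 : ℤ) ^ (k + l : ℕ) • f k l = 0 := by
  rw [Fin.sum_sum_eq_sum_triangle_add]
  refine Finset.sum_eq_zero fun i _ => Finset.sum_eq_zero fun j hj => ?_
  rw [hf i j (Finset.mem_Ici.1 hj), ← add_smul, Fin.val_castSucc, Fin.val_succ]
  have : (-1 : ℤ) ^ ((i : ℕ) + j) + (-1) ^ ((j : ℕ) + 1 + i) = 0 := by ring
  rw [this, zero_smul]

variable {ι} in
lemma hb_ext {m : ℕ} {X : Type u} [AddCommGroup X] [Module K X] {f g : S ⊗[K] ⨂[K]^m A →ₗ[K] X}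
    (h : ∀ s v, f (s ⊗ₜ PiTensorProduct.tprod K v) = g (s ⊗ₜ PiTensorProduct.tprod K v)) :
    f = g := by
  apply TensorProduct.ext
  ext s v
  exact h s v

lemma hb_hb (m : ℕ) (z : S ⊗[K] ⨂[K]^(m + 2) A) : hb ι m (hb ι (m + 1) z) = 0 := by
  suffices h : (hb ι m).restrictScalars K ∘ₗ (hb ι (m + 1)).restrictScalars K = 0 from
    LinearMap.congr_fun h z
  refine hb_ext fun s v => ?_
  simp only [LinearMap.comp_apply, LinearMap.restrictScalars_apply, LinearMap.zero_apply, hb_faces,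
    map_sum, map_zsmul, Finset.smul_sum, smul_smul, ← pow_add]
  exact alternating_sum_zero (fun k l => faceS ι l (faceS ι k s v) (faceT k v) ⊗ₜ[K]
    PiTensorProduct.tprod K (faceT l (faceT k v))) fun i j h => by
      simp only [faceT_faceT v i j h, faceS_faceS ι s v i j h]

/-- Naturality of the differential in the coefficients. -/
lemma hb_natural {S' : Type u} [Ring S'] [Algebra K S'] (ι' : Env K A →ₐ[K] S')
    (f : S →ₗ[K] S') (hf : ∀ s b, f (s * ι b) = f s * ι' b) (m : ℕ) (z : S ⊗[K] ⨂[K]^(m + 1) A) :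
    f.rTensor _ (hb ι m z) = hb ι' m (f.rTensor _ z) := by
  suffices h : f.rTensor _ ∘ₗ (hb ι m).restrictScalars K =
      (hb ι' m).restrictScalars K ∘ₗ f.rTensor _ from LinearMap.congr_fun h z
  refine hb_ext fun s v => ?_
  simp only [LinearMap.comp_apply, LinearMap.restrictScalars_apply, hb_tmul, map_add, map_sum,
    map_zsmul, LinearMap.rTensor_tmul, inL_apply, inR_apply, hf]

variable [PoissonAlgebra K A]

lemma tail_update {m : ℕ} (v : Fin (m + 1) → A) (t : Fin m) (c : A) :
    Fin.tail (Function.update v t.succ c) = Function.update (Fin.tail v) t c := by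
  ext i
  by_cases h : i = t
  · subst h; simp [Fin.tail]
  · simp [Fin.tail, h]

lemma init_update {m : ℕ} (v : Fin (m + 1) → A) (t : Fin m) (c : A) :
    Fin.init (Function.update v t.castSucc c) = Function.update (Fin.init v) t c := by
  ext i
  by_cases h : i = t
  · subst h; simp [Fin.init]
  · simp [Fin.init, h]

/-- Multiplication of adjacent factors is compatible with the Lie action. -/
lemma tpow_act_contract {m : ℕ} (k : Fin m) (x : A) (v : Fin (m + 1) → A) :
    (tpow K A m).act x (PiTensorProduct.tprod K (Fin.contractNth k.castSucc (· * ·) v)) =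
      ∑ t, PiTensorProduct.tprod K
        (Fin.contractNth k.castSucc (· * ·) (Function.update v t (ad K x (v t)))) := by
  have hm : ∀ w : Fin (m + 1) → A, PiTensorProduct.tprod K
      (Fin.contractNth k.castSucc (· * ·) w) = PiTensorProduct.tprod K (Function.update
        (k.succ.removeNth w) k (w k.castSucc * w k.succ)) := fun w => by
    rw [← mulFace_apply]
    have h2 : k.succ.succAbove k = k.castSucc := Fin.succAbove_of_castSucc_lt _ _ (by
      simp only [Fin.lt_def, Fin.val_castSucc, Fin.val_succ]; omega)
    have h1 : mulFace K A k w = PiTensorProduct.map (Pi.mulSingle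
        (M := fun _ : Fin m => Module.End K A) k (LinearMap.mulRight K (w k.succ)))
        (PiTensorProduct.tprod K (k.succ.removeNth w)) := rfl
    rw [h1, PiTensorProduct.map_tprod]
    congr 1
    ext i
    by_cases h : i = k
    · subst h; simp [Fin.removeNth, h2]
    · simp [h]
  have h2 : k.succ.succAbove k = k.castSucc := Fin.succAbove_of_castSucc_lt _ _ (by
    simp only [Fin.lt_def, Fin.val_castSucc, Fin.val_succ]; omega)
  simp only [hm]
  rw [tpow_act, Fin.sum_univ_succAbove _ k.succ, ← Finset.add_sum_erase _ _ (Finset.mem_univ k),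
    ← Finset.add_sum_erase _ (fun i => PiTensorProduct.tprod K (Function.update
      (k.succ.removeNth (Function.update v (k.succ.succAbove i) _)) k _)) (Finset.mem_univ k),
    ← add_assoc]
  have hne : k.castSucc ≠ k.succ := by simp [Fin.ext_iff]
  congr 1
  · simp only [Function.update_self, Function.update_idem, ad_mul]
    rw [MultilinearMap.map_update_add, add_comm]
    congr 1
    · congr 1
      ext i
      by_cases h : i = k
      · subst h; simp [hne]
      · simp [h, Fin.removeNth]
    · congr 1
      ext i
      by_cases h : i = k
      · subst h; simp [h2, hne.symm]
      · have h5 : k.succ.succAbove i ≠ k.castSucc := by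
          rw [← h2]; exact fun h' => h (Fin.succAbove_right_injective h')
        simp [h, h5, Fin.removeNth]
  · refine Finset.sum_congr rfl fun t ht => ?_
    have htk : t ≠ k := (Finset.mem_erase.1 ht).1
    have h3 : k.succ.succAbove t ≠ k.succ := Fin.succAbove_ne _ _
    have h4 : k.succ.succAbove t ≠ k.castSucc := by
      rw [← h2]; exact fun h => htk (Fin.succAbove_right_injective h)
    congr 1
    ext i
    by_cases h : i = k
    · subst h; simp [htk.symm, h3.symm, h4.symm]
    · by_cases hit : i = t
      · subst hit; simp [h, Fin.removeNth]
      · simp [h, hit, Fin.removeNth]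

/-- Compatibility of the differential with a Lie action on the coefficients. -/
lemma hb_lie (x : A) (δ : S →ₗ[K] S) (hδ : ∀ s b, δ (s * ι b) = δ s * ι b + s * ι (envLie K x b))
    (m : ℕ) (z : S ⊗[K] ⨂[K]^(m + 1) A) :
    hb ι m (δ.rTensor _ z + ((tpow K A (m + 1)).act x).lTensor S z) =
      δ.rTensor _ (hb ι m z) + ((tpow K A m).act x).lTensor S (hb ι m z) := by
  suffices h : (hb ι m).restrictScalars K ∘ₗ
      (δ.rTensor _ + ((tpow K A (m + 1)).act x).lTensor S) =
      (δ.rTensor _ + ((tpow K A m).act x).lTensor S) ∘ₗ (hb ι m).restrictScalars K from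
    LinearMap.congr_fun h z
  refine hb_ext fun s v => ?_
  have hL : ∀ s a, δ (s * inL ι a) = δ s * inL ι a + s * inL ι (ad K x a) := fun s a => by
    have : envLie K x (a ⊗ₜ[K] (1 : Aᵐᵒᵖ)) = ad K x a ⊗ₜ 1 := by
      rw [envLie_tmul, ← MulOpposite.op_one, adOp_op, ad_one]; simp
    rw [inL_apply, hδ, this]; rfl
  have hR : ∀ s a, δ (s * inR ι a) = δ s * inR ι a + s * inR ι (ad K x a) := fun s a => by
    have : envLie K x ((1 : A) ⊗ₜ[K] MulOpposite.op a) = 1 ⊗ₜ MulOpposite.op (ad K x a) := by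
      rw [envLie_tmul, adOp_op, ad_one]; simp
    rw [inR_apply, hδ, this]; rfl
  simp only [LinearMap.comp_apply, LinearMap.add_apply, LinearMap.restrictScalars_apply,
    LinearMap.rTensor_tmul, LinearMap.lTensor_tmul, map_add, tpow_act, TensorProduct.tmul_sum,
    map_sum, hb_tmul, map_zsmul, hL, hR, Finset.sum_add_distrib,
    TensorProduct.add_tmul, smul_add]
  rw [Fin.sum_univ_succ (f := fun t => (s * inL ι (Function.update v t (ad K x (v t)) 0)) ⊗ₜ[K]
      PiTensorProduct.tprod K (Fin.tail (Function.update v t (ad K x (v t))))),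
    ← Finset.smul_sum (r := (-1 : ℤ) ^ (m + 1)),
    Fin.sum_univ_castSucc (f := fun t => (s * inR ι (Function.update v t (ad K x (v t))
      (Fin.last m))) ⊗ₜ[K] PiTensorProduct.tprod K (Fin.init (Function.update v t (ad K x (v t))))),
    Finset.sum_comm (s := (Finset.univ : Finset (Fin (m + 1))))]
  have t0 : Fin.tail (Function.update v 0 (ad K x (v 0))) = Fin.tail v := by
    ext i; simp [Fin.tail]
  have i0 : Fin.init (Function.update v (Fin.last m) (ad K x (v (Fin.last m)))) = Fin.init v := by
    ext i
    have : i.castSucc ≠ Fin.last m := (Fin.castSucc_lt_last i).ne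
    simp [Fin.init, this]
  have n0 : ∀ t : Fin m, (0 : Fin (m + 1)) ≠ t.succ := fun t => (Fin.succ_ne_zero t).symm
  have n1 : ∀ t : Fin m, Fin.last m ≠ t.castSucc := fun t => (Fin.castSucc_lt_last t).ne'
  simp only [Function.update_self, t0, i0, Function.update_of_ne (n0 _),
    Function.update_of_ne (n1 _), tail_update, init_update, ← Finset.smul_sum, smul_add,
    Fin.tail, Fin.init]
  have hc : ∀ k : Fin m, _ := fun k => (tpow_act (K := K) m x _).symm.trans
    (tpow_act_contract k x v)
  simp only [← TensorProduct.tmul_sum, hc]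
  abel

end Hochschild

section Bicomplexes

/-- A first-quadrant bicomplex of left `R`-modules, with anticommuting differentials
`X i (j + 1) → X i j` and `X (i + 1) j → X i j`. -/
structure Bicomplex (R : Type u) [Ring R] where
  /-- the object in row `i` and column `j` -/
  X : ℕ → ℕ → ModuleCat.{u} R
  /-- the horizontal differential -/
  dH : ∀ i j, X i (j + 1) ⟶ X i j
  /-- the vertical differential -/
  dV : ∀ i j, X (i + 1) j ⟶ X i j
  dH_dH : ∀ i j, dH i (j + 1) ≫ dH i j = 0
  dV_dV : ∀ i j, dV (i + 1) j ≫ dV i j = 0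
  anti : ∀ i j, dH (i + 1) j ≫ dV i j + dV i (j + 1) ≫ dH i j = 0

namespace Bicomplex

variable {R : Type u} [Ring R] (B : Bicomplex R)

/-- The degree `n` part `⨁_{i + j = n} X i j` of the total complex. -/
def totX (n : ℕ) : ModuleCat.{u} R :=
  ModuleCat.of R (DirectSum {p : ℕ × ℕ // p.1 + p.2 = n} fun p => B.X p.1.1 p.1.2)

/-- The inclusion of `X i j` into the total complex. -/
def incl (i j n : ℕ) (h : i + j = n) : B.X i j →ₗ[R] B.totX n :=
  DirectSum.lof R {p : ℕ × ℕ // p.1 + p.2 = n} (fun p => B.X p.1.1 p.1.2) ⟨(i, j), h⟩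

/-- The horizontal part of the total differential on `X i j`. -/
def totH (n : ℕ) : ∀ i j : ℕ, i + j = n + 1 → (B.X i j →ₗ[R] B.totX n)
  | _, 0, _ => 0
  | i, j + 1, h => B.incl i j n (by omega) ∘ₗ (B.dH i j).hom

/-- The vertical part of the total differential on `X i j`. -/
def totV (n : ℕ) : ∀ i j : ℕ, i + j = n + 1 → (B.X i j →ₗ[R] B.totX n)
  | 0, _, _ => 0
  | i + 1, j, h => B.incl i j n (by omega) ∘ₗ (B.dV i j).hom

/-- The total differential. -/
def totD (n : ℕ) : B.totX (n + 1) →ₗ[R] B.totX n :=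
  DirectSum.toModule R {p : ℕ × ℕ // p.1 + p.2 = n + 1} _
    fun p => B.totH n p.1.1 p.1.2 p.2 + B.totV n p.1.1 p.1.2 p.2

lemma totD_incl (i j n : ℕ) (h : i + j = n + 1) (x : B.X i j) :
    B.totD n (B.incl i j (n + 1) h x) = B.totH n i j h x + B.totV n i j h x := by
  have := DirectSum.toModule_lof (R := R) (ι := {p : ℕ × ℕ // p.1 + p.2 = n + 1})
    (M := fun p => B.X p.1.1 p.1.2) (N := B.totX n)
    (φ := fun p => B.totH n p.1.1 p.1.2 p.2 + B.totV n p.1.1 p.1.2 p.2) ⟨(i, j), h⟩ x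
  exact this

lemma totX_hom_ext {n : ℕ} {M : Type u} [AddCommGroup M] [Module R M] {f g : B.totX n →ₗ[R] M}
    (h : ∀ i j (hij : i + j = n) x, f (B.incl i j n hij x) = g (B.incl i j n hij x)) : f = g := by
  refine DirectSum.linearMap_ext R fun p => ?_
  obtain ⟨⟨i, j⟩, hij⟩ := p
  exact LinearMap.ext fun x => h i j hij x

lemma hh (i j : ℕ) (x : B.X i (j + 2)) : (B.dH i j).hom ((B.dH i (j + 1)).hom x) = 0 :=
  LinearMap.congr_fun (congrArg ModuleCat.Hom.hom (B.dH_dH i j)) x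

lemma vv (i j : ℕ) (x : B.X (i + 2) j) : (B.dV i j).hom ((B.dV (i + 1) j).hom x) = 0 :=
  LinearMap.congr_fun (congrArg ModuleCat.Hom.hom (B.dV_dV i j)) x

lemma vh (i j : ℕ) (x : B.X (i + 1) (j + 1)) :
    (B.dV i j).hom ((B.dH (i + 1) j).hom x) + (B.dH i j).hom ((B.dV i (j + 1)).hom x) = 0 :=
  LinearMap.congr_fun (congrArg ModuleCat.Hom.hom (B.anti i j)) x

lemma totD_totD (n : ℕ) : B.totD n ∘ₗ B.totD (n + 1) = 0 := by
  refine B.totX_hom_ext fun i j hij x => ?_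
  simp only [LinearMap.comp_apply, totD_incl, map_add, LinearMap.zero_apply]
  match i, j, hij, x with
  | 0, 0, hij, _ => omega
  | 0, 1, hij, _ => omega
  | 1, 0, hij, _ => omega
  | 0, j + 2, hij, x => simp [totH, totV, totD_incl, hh]
  | i + 2, 0, hij, x => simp [totH, totV, totD_incl, vv]
  | 1, 1, hij, x =>
    simp only [totH, totV, totD_incl, LinearMap.comp_apply, LinearMap.zero_apply, add_zero,
      zero_add, ← map_add, vh, map_zero]
  | i + 2, 1, hij, x =>
    simp only [totH, totV, totD_incl, LinearMap.comp_apply, LinearMap.zero_apply, add_zero,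
      zero_add, vv, map_zero]
    rw [← map_add, vh, map_zero]
  | 1, j + 2, hij, x =>
    simp only [totH, totV, totD_incl, LinearMap.comp_apply, LinearMap.zero_apply, add_zero,
      zero_add, hh, map_zero]
    rw [← map_add, vh, map_zero]
  | i + 2, j + 2, hij, x =>
    simp only [totH, totV, totD_incl, LinearMap.comp_apply, hh, vv, map_zero, add_zero, zero_add]
    rw [← map_add, vh, map_zero]

/-- The extension by zero of a linear map on `X 0 0` to all `X i j`. -/
def augComp {M : Type u} [AddCommGroup M] [Module R M] (f : B.X 0 0 →ₗ[R] M) :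
    ∀ i j : ℕ, B.X i j →ₗ[R] M
  | 0, 0 => f
  | _ + 1, _ => 0
  | 0, _ + 1 => 0

/-- The linear map on the degree `0` part of the total complex given by a linear map on `X 0 0`. -/
def augZero {M : Type u} [AddCommGroup M] [Module R M] (f : B.X 0 0 →ₗ[R] M) : B.totX 0 →ₗ[R] M :=
  DirectSum.toModule R {p : ℕ × ℕ // p.1 + p.2 = 0} _ fun p => B.augComp f p.1.1 p.1.2

lemma augZero_incl {M : Type u} [AddCommGroup M] [Module R M] (f : B.X 0 0 →ₗ[R] M)
    (x : B.X 0 0) : B.augZero f (B.incl 0 0 0 rfl x) = f x :=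
  DirectSum.toModule_lof (R := R) (ι := {p : ℕ × ℕ // p.1 + p.2 = 0})
    (M := fun p => B.X p.1.1 p.1.2) (N := M) (φ := fun p => B.augComp f p.1.1 p.1.2) ⟨(0, 0), rfl⟩ x

/-- The total complex. -/
def tot : ChainComplex (ModuleCat.{u} R) ℕ :=
  ChainComplex.of B.totX (fun n => ModuleCat.ofHom (B.totD n)) fun n =>
    ModuleCat.hom_ext (B.totD_totD n)

lemma tot_d (n : ℕ) : B.tot.d (n + 1) n = ModuleCat.ofHom (B.totD n) :=
  ChainComplex.of_d B.totX (fun n => ModuleCat.ofHom (B.totD n)) n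

end Bicomplex

end Bicomplexes

section Koszul

variable (K A : Type u) [Field K] [Ring A] [Algebra K A] [PoissonAlgebra K A]

/-- The Lie module `U(A) ⊗ ∧ʲ`, with `A` acting by left multiplication on `U(A)`. -/
def kosz (j : ℕ) : LieRep K A (UEnv K A ⊗[K] ⋀[K]^j A) where
  act := LinearMap.rTensorHom _ ∘ₗ LinearMap.mul K (UEnv K A) ∘ₗ uι K
  act_bracket x y := by
    apply ext_tmul
    intro u v
    simp [uι_bracket, sub_mul, TensorProduct.sub_tmul, mul_assoc]

/-- Right multiplication of `A` on `U(A)`. -/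
def uRight : A →ₗ[K] Module.End K (UEnv K A) := (LinearMap.mul K (UEnv K A)).flip ∘ₗ uι K

@[simp] lemma uRight_apply (x : A) (u : UEnv K A) : uRight K A x u = u * uι K x := rfl

variable {K A} in
lemma uRight_bracket (x y : A) : uRight K A (ad K x y) =
    uRight K A y * uRight K A x - uRight K A x * uRight K A y := by
  ext u
  simp [uι_bracket, mul_sub, mul_assoc]

/-- The differential `U(A) ⊗ ∧ʲ⁺¹ → U(A) ⊗ ∧ʲ` of the Koszul resolution of `K`. -/
def koszD (j : ℕ) : UEnv K A ⊗[K] ⋀[K]^(j + 1) A →ₗ[K] UEnv K A ⊗[K] ⋀[K]^j A :=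
  ceD K (uRight K A) j

variable {K A}

lemma koszD_act (j : ℕ) (x : A) (z : UEnv K A ⊗[K] ⋀[K]^(j + 1) A) :
    koszD K A j ((kosz K A (j + 1)).act x z) = (kosz K A j).act x (koszD K A j z) :=
  (ceD_natural K (uRight K A) (uRight K A) (LinearMap.mul K (UEnv K A) (uι K x))
    (fun y u => (mul_assoc _ _ _).symm) j z).symm

lemma koszD_koszD [CharZero K] (j : ℕ) (z : UEnv K A ⊗[K] ⋀[K]^(j + 2) A) :
    koszD K A j (koszD K A (j + 1) z) = 0 := ceD_ceD K _ uRight_bracket j z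

variable (K A) in
/-- The augmentation `U(A) ⊗ ∧⁰ → K`. -/
def koszAug : UEnv K A ⊗[K] ⋀[K]^0 A →ₗ[K] K :=
  LinearMap.mul' K K ∘ₗ TensorProduct.map (uε K).toLinearMap
    (exteriorPower.zeroEquiv K A).toLinearMap

lemma koszAug_act (x : A) (z : UEnv K A ⊗[K] ⋀[K]^0 A) :
    koszAug K A ((kosz K A 0).act x z) = 0 := by
  suffices h : koszAug K A ∘ₗ (kosz K A 0).act x = 0 from LinearMap.congr_fun h z
  refine ext_tmul fun u v => ?_
  simp [koszAug, kosz]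

lemma koszAug_koszD (z : UEnv K A ⊗[K] ⋀[K]^1 A) : koszAug K A (koszD K A 0 z) = 0 := by
  suffices h : koszAug K A ∘ₗ koszD K A 0 = 0 from LinearMap.congr_fun h z
  refine ext_tmul fun u v => ?_
  simp [koszAug, koszD, ceD_tmul, lieAlt]

lemma lTensor_koszD_koszD [CharZero K] (V : Type u) [AddCommGroup V] [Module K V] (j : ℕ)
    (z : V ⊗[K] (UEnv K A ⊗[K] ⋀[K]^(j + 2) A)) :
    (koszD K A j).lTensor V ((koszD K A (j + 1)).lTensor V z) = 0 := by
  rw [← LinearMap.comp_apply, ← LinearMap.lTensor_comp]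
  have : koszD K A j ∘ₗ koszD K A (j + 1) = 0 := LinearMap.ext (koszD_koszD j)
  rw [this, LinearMap.lTensor_zero, LinearMap.zero_apply]

lemma lTensor_koszAug_koszD (V : Type u) [AddCommGroup V] [Module K V]
    (z : V ⊗[K] (UEnv K A ⊗[K] ⋀[K]^1 A)) :
    TensorProduct.rid K V ((koszAug K A).lTensor V ((koszD K A 0).lTensor V z)) = 0 := by
  rw [← LinearMap.comp_apply (f := LinearMap.lTensor _ _), ← LinearMap.lTensor_comp]
  have : koszAug K A ∘ₗ koszD K A 0 = 0 := LinearMap.ext koszAug_koszD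
  rw [this, LinearMap.lTensor_zero, LinearMap.zero_apply, map_zero]

/-- The map `M ⊗ U(A) ⊗ ∧⁰ → M` induced by the augmentation `U(A) → K`. -/
def QRep.aug {V : Type u} [AddCommGroup V] [Module K V] (r : QRep K A V) :
    (r.tensor (kosz K A 0)).obj ⟶ r.obj :=
  (r.tensor (kosz K A 0)).hom r
    ((TensorProduct.rid K V).toLinearMap ∘ₗ (koszAug K A).lTensor V)
    (fun b m => by
      induction m using TensorProduct.induction_on with
      | zero => simp
      | add m m' h h' => simp only [map_add, h, h']
      | tmul v w => simp)
    (fun x m => by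
      induction m using TensorProduct.induction_on with
      | zero => simp
      | add m m' h h' => simp only [map_add, h, h']
      | tmul v w => simp [koszAug_act])

variable (K A)

/-- The free resolution `T''` of the `Q`-module `A²`: its term in degree `n` is
`A² ⊗ U(A) ⊗ ∧ⁿ`, and its differential is the one of the Koszul resolution. -/
def T2 [CharZero K] : ChainComplex (ModuleCat.{u} (QEnv K A)) ℕ :=
  ChainComplex.of (fun n => ((QRep.regular K A).tensor (kosz K A n)).obj)
    (fun n => (QRep.regular K A).homL (kosz K A (n + 1)) (kosz K A n) (koszD K A n) (koszD_act n))
    (fun n => by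
      apply ModuleCat.hom_ext
      apply LinearMap.ext
      intro z
      exact lTensor_koszD_koszD (Env K A) n z)

lemma T2_d [CharZero K] (n : ℕ) : (T2 K A).d (n + 1) n =
    (QRep.regular K A).homL (kosz K A (n + 1)) (kosz K A n) (koszD K A n) (koszD_act n) :=
  ChainComplex.of_d (fun n => ((QRep.regular K A).tensor (kosz K A n)).obj)
    (fun n => (QRep.regular K A).homL (kosz K A (n + 1)) (kosz K A n) (koszD K A n) (koszD_act n)) n

/-- The augmentation `T'' → A²`. -/
def T2aug [CharZero K] : T2 K A ⟶ (ChainComplex.single₀ _).obj (QRep.regular K A).obj :=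
  (ChainComplex.toSingle₀Equiv _ _).symm ⟨(QRep.regular K A).aug, by
    rw [T2_d]
    apply ModuleCat.hom_ext
    apply LinearMap.ext
    intro z
    exact lTensor_koszAug_koszD (Env K A) z⟩

end Koszul

section Syzygy

variable (K A : Type u) [Field K] [Ring A] [Algebra K A] [PoissonAlgebra K A]

/-- The quasi-Poisson module `Aᵐ⁺² = A ⊗ Aᵐ ⊗ A`: the bimodule structure is the outer one, and the
Lie action is the diagonal one. The underlying space is written as `Aᵉ ⊗ Aᵐ`, where
`(a ⊗ b') ⊗ θ` stands for `a ⊗ θ ⊗ b`. -/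
def barRep (m : ℕ) : QRep K A (Env K A ⊗[K] ⨂[K]^m A) := (QRep.regular K A).tensor (tpow K A m)

/-- The differential `Aᵐ⁺³ → Aᵐ⁺²` of the bar resolution. -/
def barD (m : ℕ) : Env K A ⊗[K] ⨂[K]^(m + 1) A →ₗ[K] Env K A ⊗[K] ⨂[K]^m A :=
  (hb (AlgHom.id K (Env K A)) m).restrictScalars K

variable {K A}

lemma barRep_env (m : ℕ) (b : Env K A) (z : Env K A ⊗[K] ⨂[K]^m A) :
    (barRep K A m).env b z = b • z := by
  induction z using TensorProduct.induction_on with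
  | zero => simp
  | add z z' h h' => simp only [map_add, smul_add, h, h']
  | tmul c v => rfl

lemma barD_env (m : ℕ) (b : Env K A) (z : Env K A ⊗[K] ⨂[K]^(m + 1) A) :
    barD K A m ((barRep K A (m + 1)).env b z) = (barRep K A m).env b (barD K A m z) := by
  rw [barRep_env, barRep_env]
  exact map_smul (hb (AlgHom.id K (Env K A)) m) b z

lemma barD_lie (m : ℕ) (x : A) (z : Env K A ⊗[K] ⨂[K]^(m + 1) A) :
    barD K A m ((barRep K A (m + 1)).lie x z) = (barRep K A m).lie x (barD K A m z) :=
  hb_lie (AlgHom.id K (Env K A)) x (envLie K x) (fun s b => envLie_mul K x s b) m z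

lemma barD_barD (m : ℕ) (z : Env K A ⊗[K] ⨂[K]^(m + 2) A) :
    barD K A m (barD K A (m + 1) z) = 0 := hb_hb _ m z

lemma rTensor_barD_barD (W : Type u) [AddCommGroup W] [Module K W] (m : ℕ)
    (z : (Env K A ⊗[K] ⨂[K]^(m + 2) A) ⊗[K] W) :
    (barD K A m).rTensor W ((barD K A (m + 1)).rTensor W z) = 0 := by
  rw [← LinearMap.comp_apply, ← LinearMap.rTensor_comp]
  have : barD K A m ∘ₗ barD K A (m + 1) = 0 := LinearMap.ext (barD_barD m)
  rw [this, LinearMap.rTensor_zero, LinearMap.zero_apply]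

lemma rTensor_lTensor_comm {V V' W W' : Type u} [AddCommGroup V] [Module K V] [AddCommGroup V']
    [Module K V'] [AddCommGroup W] [Module K W] [AddCommGroup W'] [Module K W']
    (f : V →ₗ[K] V') (g : W →ₗ[K] W') (z : V ⊗[K] W) :
    f.rTensor W' (g.lTensor V z) = g.lTensor V' (f.rTensor W z) := by
  rw [← LinearMap.comp_apply, ← LinearMap.comp_apply, LinearMap.rTensor_comp_lTensor,
    LinearMap.lTensor_comp_rTensor]

lemma rid_lTensor_rTensor {V V' W : Type u} [AddCommGroup V] [Module K V] [AddCommGroup V']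
    [Module K V'] [AddCommGroup W] [Module K W] (f : V →ₗ[K] V') (g : W →ₗ[K] K) (z : V ⊗[K] W) :
    TensorProduct.rid K V' (g.lTensor V' (f.rTensor W z)) =
      f (TensorProduct.rid K V (g.lTensor V z)) := by
  induction z using TensorProduct.induction_on with
  | zero => simp only [map_zero]
  | add z z' h h' => simp only [map_add, h, h']
  | tmul v w => simp only [LinearMap.lTensor_tmul, LinearMap.rTensor_tmul, TensorProduct.rid_tmul,
      map_smul]

variable (K A)

open PiTensorProduct MulOpposite in
/-- The `Aᵉ`-submodule of `A⁴` generated by the elements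
`a ⊗ b ⊗ c ⊗ 1 - 1 ⊗ ab ⊗ c ⊗ 1 + 1 ⊗ a ⊗ bc ⊗ 1 - 1 ⊗ a ⊗ b ⊗ c`. -/
def syzRel : Submodule (Env K A) (Env K A ⊗[K] ⨂[K]^2 A) :=
  Submodule.span (Env K A) {z | ∃ a b c : A, z =
    ((a ⊗ₜ[K] op (1 : A)) ⊗ₜ[K] tprod K ![b, c] - (1 ⊗ₜ[K] op (1 : A)) ⊗ₜ[K] tprod K ![a * b, c]
    + (1 ⊗ₜ[K] op (1 : A)) ⊗ₜ[K] tprod K ![a, b * c] - (1 ⊗ₜ[K] op c) ⊗ₜ[K] tprod K ![a, b])}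

open PiTensorProduct in
lemma barD_three (s : Env K A) (a b c : A) : barD K A 2 (s ⊗ₜ tprod K ![a, b, c]) =
    s • ((a ⊗ₜ[K] MulOpposite.op (1 : A)) ⊗ₜ[K] tprod K ![b, c]
    - (1 ⊗ₜ[K] MulOpposite.op (1 : A)) ⊗ₜ[K] tprod K ![a * b, c]
    + (1 ⊗ₜ[K] MulOpposite.op (1 : A)) ⊗ₜ[K] tprod K ![a, b * c]
    - (1 ⊗ₜ[K] MulOpposite.op c) ⊗ₜ[K] tprod K ![a, b]) := by
  have h1 : Fin.tail ![a, b, c] = ![b, c] := rfl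
  have h2 : Fin.init ![a, b, c] = ![a, b] := by ext i; fin_cases i <;> rfl
  have h3 : Fin.contractNth (0 : Fin 3) (· * ·) ![a, b, c] = ![a * b, c] := by
    ext i; fin_cases i <;> rfl
  have h4 : Fin.contractNth (1 : Fin 3) (· * ·) ![a, b, c] = ![a, b * c] := by
    ext i; fin_cases i <;> rfl
  have h5 : (1 : A) ⊗ₜ[K] MulOpposite.op (1 : A) = (1 : Env K A) := rfl
  have h6 : (Fin.castSucc (0 : Fin 2)) = 0 := rfl
  have h7 : (Fin.castSucc (1 : Fin 2)) = 1 := rfl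
  have h8 : ![a, b, c] (Fin.last 2) = c := rfl
  change hb (AlgHom.id K (Env K A)) 2 _ = _
  rw [hb_tmul, h1, h2, Fin.sum_univ_two, h6, h7, h3, h4, h5, h8]
  simp only [smul_sub, smul_add, TensorProduct.smul_tmul', smul_eq_mul, mul_one, inL_apply,
    inR_apply, AlgHom.id_apply, Matrix.cons_val_zero, Fin.val_zero, Fin.val_one, zero_add, pow_one,
    neg_smul, one_smul]
  rw [show (-1 : ℤ) ^ (1 + 1) = 1 by norm_num, show (-1 : ℤ) ^ (2 + 1) = -1 by norm_num,
    one_smul, neg_smul, one_smul, MulOpposite.op_one, TensorProduct.neg_tmul]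
  abel

lemma mem_syzRel (z : Env K A ⊗[K] ⨂[K]^2 A) : z ∈ syzRel K A ↔ ∃ y, barD K A 2 y = z := by
  constructor
  · intro h
    induction h using Submodule.span_induction with
    | mem z h =>
      obtain ⟨a, b, c, rfl⟩ := h
      exact ⟨1 ⊗ₜ PiTensorProduct.tprod K ![a, b, c], by rw [barD_three, one_smul]⟩
    | zero => exact ⟨0, map_zero _⟩
    | add z z' _ _ h h' =>
      obtain ⟨y, rfl⟩ := h
      obtain ⟨y', rfl⟩ := h'
      exact ⟨y + y', map_add _ _ _⟩
    | smul s z _ h =>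
      obtain ⟨y, rfl⟩ := h
      exact ⟨s • y, map_smul (hb (AlgHom.id K (Env K A)) 2) s y⟩
  · rintro ⟨y, rfl⟩
    induction y using TensorProduct.induction_on with
    | zero => simp
    | add y y' h h' => rw [map_add]; exact add_mem h h'
    | tmul s v =>
      induction v using PiTensorProduct.induction_on with
      | smul_tprod k v =>
        rw [TensorProduct.tmul_smul, map_smul]
        refine Submodule.smul_of_tower_mem (S := K) (R := Env K A) _ k ?_
        have hv : v = ![v 0, v 1, v 2] := by ext i; fin_cases i <;> rfl
        rw [hv, barD_three]
        exact Submodule.smul_mem _ _ (Submodule.subset_span ⟨_, _, _, rfl⟩)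
      | add v v' h h' => rw [TensorProduct.tmul_add, map_add]; exact add_mem h h'

/-- The submodule `syzRel`, as a `Q`-submodule of `A⁴`. -/
def syzRelQ : Submodule (QEnv K A) (barRep K A 2).obj where
  carrier := (syzRel K A : Set (Env K A ⊗[K] ⨂[K]^2 A))
  add_mem' h h' := Submodule.add_mem (syzRel K A) h h'
  zero_mem' := Submodule.zero_mem (syzRel K A)
  smul_mem' q z h := by
    obtain ⟨y, hy⟩ := (mem_syzRel K A _).1 h
    refine (mem_syzRel K A _).2 ⟨(barRep K A 3).toAlgHom q y, ?_⟩
    have := (((barRep K A 3).hom (barRep K A 2) (barD K A 2) (barD_env 2) (barD_lie 2)).hom).map_smul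
      q (show (barRep K A 3).obj from y)
    exact this.trans (congrArg ((barRep K A 2).toAlgHom q) hy)

/-- The second syzygy `Ω²(A)`, the quotient of `A⁴` by the submodule `syzRel`, as a `Q`-module. -/
def Omega2 : ModuleCat.{u} (QEnv K A) := ModuleCat.of _ ((barRep K A 2).obj ⧸ syzRelQ K A)

/-- The projection `A⁴ → Ω²(A)`. -/
def toOmega2 : (barRep K A 2).obj ⟶ Omega2 K A := 
  (ModuleCat.ofHom (syzRelQ K A).mkQ : ModuleCat.of _ ↑(barRep K A 2).obj ⟶ Omega2 K A)

variable {K A} in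
lemma toOmega2_eq_zero {z : Env K A ⊗[K] ⨂[K]^2 A} (h : z ∈ syzRel K A) :
    (toOmega2 K A).hom (show (barRep K A 2).obj from z) = 0 :=
  (Submodule.Quotient.mk_eq_zero (syzRelQ K A)).2 h

/-- The bicomplex of `Q`-modules `Aⁱ⁺⁴ ⊗ U(A) ⊗ ∧ʲ`, the tensor product of the bar resolution of
`Ω²(A)` and the Koszul resolution of `K`. -/
def T1bi [CharZero K] : Bicomplex (QEnv K A) where
  X i j := ((barRep K A (i + 2)).tensor (kosz K A j)).obj
  dH i j := (barRep K A (i + 2)).homL (kosz K A (j + 1)) (kosz K A j) (koszD K A j) (koszD_act j)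
  dV i j := (-1 : ℤ) ^ j • (barRep K A (i + 3)).homR (barRep K A (i + 2)) (kosz K A j)
    (barD K A (i + 2)) (barD_env (i + 2)) (barD_lie (i + 2))
  dH_dH i j := by
    apply ModuleCat.hom_ext
    apply LinearMap.ext
    intro z
    exact lTensor_koszD_koszD (Env K A ⊗[K] ⨂[K]^(i + 2) A) j z
  dV_dV i j := by
    rw [Preadditive.zsmul_comp, Preadditive.comp_zsmul]
    have : (barRep K A (i + 4)).homR (barRep K A (i + 3)) (kosz K A j)
        (barD K A (i + 3)) (barD_env (i + 3)) (barD_lie (i + 3)) ≫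
        (barRep K A (i + 3)).homR (barRep K A (i + 2)) (kosz K A j)
        (barD K A (i + 2)) (barD_env (i + 2)) (barD_lie (i + 2)) = 0 := by
      apply ModuleCat.hom_ext
      apply LinearMap.ext
      intro z
      exact rTensor_barD_barD (UEnv K A ⊗[K] ⋀[K]^j A) (i + 2) z
    rw [this, smul_zero, smul_zero]
  anti i j := by
    have : (barRep K A (i + 3)).homL (kosz K A (j + 1)) (kosz K A j) (koszD K A j) (koszD_act j) ≫
        (barRep K A (i + 3)).homR (barRep K A (i + 2)) (kosz K A j)
          (barD K A (i + 2)) (barD_env (i + 2)) (barD_lie (i + 2)) =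
        (barRep K A (i + 3)).homR (barRep K A (i + 2)) (kosz K A (j + 1))
          (barD K A (i + 2)) (barD_env (i + 2)) (barD_lie (i + 2)) ≫
        (barRep K A (i + 2)).homL (kosz K A (j + 1)) (kosz K A j) (koszD K A j) (koszD_act j) := by
      apply ModuleCat.hom_ext
      apply LinearMap.ext
      intro z
      exact rTensor_lTensor_comm (barD K A (i + 2)) (koszD K A j) z
    rw [Preadditive.comp_zsmul, Preadditive.zsmul_comp, this, ← add_smul, pow_succ]
    simp

/-- The free resolution `T'` of the `Q`-module `Ω²(A)`, the total complex of the bicomplex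
`Aⁱ⁺⁴ ⊗ U(A) ⊗ ∧ʲ`. -/
def T1 [CharZero K] : ChainComplex (ModuleCat.{u} (QEnv K A)) ℕ := (T1bi K A).tot

lemma aug_barD_mem (z : (Env K A ⊗[K] ⨂[K]^3 A) ⊗[K] (UEnv K A ⊗[K] ⋀[K]^0 A)) :
    TensorProduct.rid K _ ((koszAug K A).lTensor (Env K A ⊗[K] ⨂[K]^2 A)
      ((barD K A 2).rTensor _ z)) ∈ syzRel K A := by
  refine (mem_syzRel K A _).2 ⟨TensorProduct.rid K _ ((koszAug K A).lTensor _ z), ?_⟩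
  exact (rid_lTensor_rTensor (barD K A 2) (koszAug K A) z).symm

/-- The map `⨁_{i + j = 0} Aⁱ⁺⁴ ⊗ U(A) ⊗ ∧ʲ → Ω²(A)` induced by the augmentation of `U(A)` and the
projection of `A⁴`. -/
def T1augZero [CharZero K] : (T1bi K A).totX 0 →ₗ[QEnv K A] Omega2 K A :=
  (T1bi K A).augZero ((barRep K A 2).aug ≫ toOmega2 K A).hom

lemma T1augZero_incl [CharZero K] (z : (T1bi K A).X 0 0) :
    T1augZero K A ((T1bi K A).incl 0 0 0 rfl z) = (toOmega2 K A).hom ((barRep K A 2).aug.hom z) :=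
  (T1bi K A).augZero_incl _ z

/-- The augmentation `T' → Ω²(A)`. -/
def T1aug [CharZero K] : T1 K A ⟶ (ChainComplex.single₀ _).obj (Omega2 K A) :=
  (ChainComplex.toSingle₀Equiv _ _).symm ⟨ModuleCat.ofHom (T1augZero K A), by
    rw [show (T1 K A).d 1 0 = _ from (T1bi K A).tot_d 0]
    apply ModuleCat.hom_ext
    refine (T1bi K A).totX_hom_ext fun i j hij z => ?_
    change T1augZero K A ((T1bi K A).totD 0 ((T1bi K A).incl i j 1 hij z)) = 0
    rw [Bicomplex.totD_incl]
    match i, j, hij, z with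
    | 0, 0, hij, _ => omega
    | 0, 1, hij, z =>
      simp only [Bicomplex.totH, Bicomplex.totV, LinearMap.zero_apply, add_zero,
        LinearMap.comp_apply]
      rw [T1augZero_incl]
      have : (barRep K A 2).aug.hom (((T1bi K A).dH 0 0).hom z) = 0 := by
        exact lTensor_koszAug_koszD (Env K A ⊗[K] ⨂[K]^2 A) z
      rw [this, map_zero]
    | 1, 0, hij, z =>
      simp only [Bicomplex.totH, Bicomplex.totV, LinearMap.zero_apply, zero_add,
        LinearMap.comp_apply]
      rw [T1augZero_incl]
      have h2 : ((T1bi K A).dV 0 0).hom z = (barD K A 2).rTensor (UEnv K A ⊗[K] ⋀[K]^0 A) z := by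
        change ((-1 : ℤ) ^ 0 • (barRep K A 3).homR (barRep K A 2) (kosz K A 0)
          (barD K A 2) (barD_env 2) (barD_lie 2)).hom z = _
        rw [pow_zero, one_smul]; rfl
      rw [h2]
      exact toOmega2_eq_zero (aug_barD_mem K A z)
    | i + 2, j, hij, _ => omega
    | 1, j + 1, hij, _ => omega
    | 0, j + 2, hij, _ => omega⟩

end Syzygy

section Characteristic

variable (K A : Type u) [Field K] [Ring A] [Algebra K A] [PoissonAlgebra K A]

section Linear

variable {K A} {S : Type u} [Ring S] [Algebra K S] {N : Type u} [AddCommGroup N] [Module K N]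
  [Module S N] [IsScalarTower K S N]

lemma lsmul_rTensor (W : Type u) [AddCommGroup W] [Module K W] (s : S) (z : N ⊗[K] W) :
    (Algebra.lsmul K K N s).rTensor W z = s • z := by
  induction z using TensorProduct.induction_on with
  | zero => simp only [map_zero, smul_zero]
  | add z z' h h' => simp only [map_add, smul_add, h, h']
  | tmul v w => rfl

/-- The Chevalley-Eilenberg differential `ceD` as an `S`-linear map, where the right action `ρ` of
`A` on `N` commutes with the left action of `S`. -/
def ceDLin (ρ : A →ₗ[K] Module.End K N) (hρ : ∀ x (s : S) n, ρ x (s • n) = s • ρ x n) (j : ℕ) :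
    N ⊗[K] ⋀[K]^(j + 1) A →ₗ[S] N ⊗[K] ⋀[K]^j A :=
  { ceD K ρ j with
    map_smul' := fun s z => by
      have h := ceD_natural K ρ ρ (Algebra.lsmul K K N s) (fun x n => (hρ x s n).symm) j z
      rw [lsmul_rTensor, lsmul_rTensor] at h
      exact h.symm }

lemma ceDLin_apply (ρ : A →ₗ[K] Module.End K N) (hρ : ∀ x (s : S) n, ρ x (s • n) = s • ρ x n)
    (j : ℕ) (z : N ⊗[K] ⋀[K]^(j + 1) A) : ceDLin ρ hρ j z = ceD K ρ j z := rfl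

end Linear

/-- Right multiplication of `A` on `P`. -/
def pRight : A →ₗ[K] Module.End K (PEnv K A) :=
  (LinearMap.mul K (PEnv K A)).flip ∘ₗ lieToP

/-- The right action of `x ∈ A` on `P ⊗ Aᵐ` given by `(p ⊗ θ)x = px ⊗ θ - p ⊗ {x, θ}`. -/
def rowAct (m : ℕ) : A →ₗ[K] Module.End K (PEnv K A ⊗[K] ⨂[K]^m A) :=
  LinearMap.rTensorHom _ ∘ₗ pRight K A - LinearMap.lTensorHom _ ∘ₗ (tpow K A m).act

variable {K A}

lemma pRight_apply (x : A) (p : PEnv K A) : pRight K A x p = p * lieToP x := rfl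

lemma rowAct_eq (m : ℕ) (x : A) : rowAct K A m x =
    (pRight K A x).rTensor _ - ((tpow K A m).act x).lTensor (PEnv K A) := rfl

@[simp] lemma rowAct_tmul (m : ℕ) (x : A) (p : PEnv K A) (θ : ⨂[K]^m A) :
    rowAct K A m x (p ⊗ₜ θ) = (p * lieToP x) ⊗ₜ θ - p ⊗ₜ (tpow K A m).act x θ := rfl

lemma pRight_smul (x : A) (s p : PEnv K A) : pRight K A x (s • p) = s • pRight K A x p :=
  mul_assoc _ _ _

lemma pRight_bracket (x y : A) : pRight K A (ad K x y) =
    pRight K A y * pRight K A x - pRight K A x * pRight K A y := by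
  refine LinearMap.ext fun p => ?_
  simp only [pRight_apply, LinearMap.sub_apply, Module.End.mul_apply, lieToP_bracket, mul_sub,
    mul_assoc]

lemma rowAct_smul (m : ℕ) (x : A) (s : PEnv K A) (z : PEnv K A ⊗[K] ⨂[K]^m A) :
    rowAct K A m x (s • z) = s • rowAct K A m x z := by
  induction z using TensorProduct.induction_on with
  | zero => simp only [map_zero, smul_zero]
  | add z z' h h' => simp only [map_add, smul_add, h, h']
  | tmul p θ =>
    simp only [TensorProduct.smul_tmul', smul_sub, rowAct_tmul, smul_eq_mul, mul_assoc]

lemma rowAct_bracket (m : ℕ) (x y : A) : rowAct K A m (ad K x y) =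
    rowAct K A m y * rowAct K A m x - rowAct K A m x * rowAct K A m y := by
  refine TensorProduct.ext' fun p θ => ?_
  simp only [rowAct_tmul, LinearMap.sub_apply, Module.End.mul_apply, map_sub, lieToP_bracket,
    (tpow K A m).act_bracket, mul_sub, TensorProduct.sub_tmul, TensorProduct.tmul_sub, mul_assoc]
  abel

variable (K A)

/-- The horizontal differential `P ⊗ ∧ʲ⁺¹ → P ⊗ ∧ʲ` in row `0`. -/
def chiH0 (j : ℕ) : PEnv K A ⊗[K] ⋀[K]^(j + 1) A →ₗ[PEnv K A] PEnv K A ⊗[K] ⋀[K]^j A :=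
  ceDLin (pRight K A) pRight_smul j

/-- The horizontal differential `P ⊗ Aᵐ ⊗ ∧ʲ⁺¹ → P ⊗ Aᵐ ⊗ ∧ʲ`. -/
def chiH (m j : ℕ) : (PEnv K A ⊗[K] ⨂[K]^m A) ⊗[K] ⋀[K]^(j + 1) A →ₗ[PEnv K A]
    (PEnv K A ⊗[K] ⨂[K]^m A) ⊗[K] ⋀[K]^j A :=
  ceDLin (rowAct K A m) (rowAct_smul m) j

/-- The Hochschild differential `P ⊗ Aᵐ⁺¹ ⊗ ∧ʲ → P ⊗ Aᵐ ⊗ ∧ʲ`, without sign. -/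
def chiB (m j : ℕ) : (PEnv K A ⊗[K] ⨂[K]^(m + 1) A) ⊗[K] ⋀[K]^j A →ₗ[PEnv K A]
    (PEnv K A ⊗[K] ⨂[K]^m A) ⊗[K] ⋀[K]^j A :=
  TensorProduct.AlgebraTensorModule.map (hb envToP m) LinearMap.id

/-- The wedge product `A ⊗ ∧ʲ → ∧ʲ⁺¹`. -/
def wedgeMap (j : ℕ) : ⨂[K]^1 A ⊗[K] ⋀[K]^j A →ₗ[K] ⋀[K]^(j + 1) A :=
  TensorProduct.lift (exteriorPower.alternatingMapLinearEquiv.toLinearMap ∘ₗ wedgeAlt K j ∘ₗ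
    (PiTensorProduct.subsingletonEquiv (R := K) (0 : Fin 1)).toLinearMap)

/-- The map `φ : P ⊗ A ⊗ ∧ʲ → P ⊗ ∧ʲ⁺¹`, `p ⊗ a ⊗ ω ↦ p ⊗ a ∧ ω`. -/
def chiPhi (j : ℕ) : (PEnv K A ⊗[K] ⨂[K]^1 A) ⊗[K] ⋀[K]^j A →ₗ[PEnv K A]
    PEnv K A ⊗[K] ⋀[K]^(j + 1) A :=
  TensorProduct.AlgebraTensorModule.map (LinearMap.id : PEnv K A →ₗ[PEnv K A] PEnv K A)
    (wedgeMap K A j) ∘ₗ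
  (TensorProduct.AlgebraTensorModule.assoc K K (PEnv K A) (PEnv K A) (⨂[K]^1 A)
    (⋀[K]^j A)).toLinearMap

variable {K A}

lemma chiPhi_tmul (j : ℕ) (p : PEnv K A) (v : Fin 1 → A) (ω : ⋀[K]^j A) :
    chiPhi K A j ((p ⊗ₜ PiTensorProduct.tprod K v) ⊗ₜ ω) = ext1 K j (v 0) (p ⊗ₜ ω) := by
  simp [chiPhi, wedgeMap, ext1]

lemma chiB_eq (m j : ℕ) (z : (PEnv K A ⊗[K] ⨂[K]^(m + 1) A) ⊗[K] ⋀[K]^j A) :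
    chiB K A m j z = ((hb envToP m).restrictScalars K).rTensor _ z := rfl

lemma chiB_chiB (m j : ℕ) (z : (PEnv K A ⊗[K] ⨂[K]^(m + 2) A) ⊗[K] ⋀[K]^j A) :
    chiB K A m j (chiB K A (m + 1) j z) = 0 := by
  induction z using TensorProduct.induction_on with
  | zero => simp only [map_zero]
  | add z z' h h' => simp only [map_add, h, h', add_zero]
  | tmul v w =>
    change hb envToP m (hb envToP (m + 1) v) ⊗ₜ w = 0
    rw [hb_hb, TensorProduct.zero_tmul]

lemma hb_rowAct (m : ℕ) (x : A) (z : PEnv K A ⊗[K] ⨂[K]^(m + 1) A) :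
    hb envToP m (rowAct K A (m + 1) x z) = rowAct K A m x (hb envToP m z) := by
  have h := hb_lie (K := K) (A := A) envToP x (-pRight K A x) (fun s b => by
    simp only [LinearMap.neg_apply, pRight_apply, mul_assoc, lieToP_mul_envToP, mul_add, neg_mul]
    abel) m z
  rw [LinearMap.rTensor_neg, LinearMap.rTensor_neg, LinearMap.neg_apply, LinearMap.neg_apply] at h
  rw [rowAct_eq, rowAct_eq, LinearMap.sub_apply, LinearMap.sub_apply, ← neg_inj, ← map_neg, neg_sub,
    sub_eq_neg_add, h]
  abel

lemma chiB_chiH (m j : ℕ) (z : (PEnv K A ⊗[K] ⨂[K]^(m + 1) A) ⊗[K] ⋀[K]^(j + 1) A) :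
    chiB K A m j (chiH K A (m + 1) j z) = chiH K A m j (chiB K A m (j + 1) z) :=
  ceD_natural K (rowAct K A (m + 1)) (rowAct K A m) ((hb envToP m).restrictScalars K)
    (fun x n => hb_rowAct m x n) j z

/-- The map `P ⊗ A → P`, `p ⊗ a ↦ pa`. -/
def psi : PEnv K A ⊗[K] ⨂[K]^1 A →ₗ[K] PEnv K A :=
  TensorProduct.lift ((pRight K A).flip.compl₂
    (PiTensorProduct.subsingletonEquiv (R := K) (0 : Fin 1)).toLinearMap)

lemma psi_tmul (p : PEnv K A) (v : Fin 1 → A) :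
    psi (p ⊗ₜ PiTensorProduct.tprod K v) = p * lieToP (v 0) := by
  simp [psi, pRight_apply]

lemma psi_hb (z : PEnv K A ⊗[K] ⨂[K]^2 A) : psi (hb envToP 1 z) = 0 := by
  suffices h : psi ∘ₗ (hb envToP 1).restrictScalars K = 0 from LinearMap.congr_fun h z
  refine hb_ext fun s v => ?_
  rw [LinearMap.comp_apply, LinearMap.restrictScalars_apply, hb_tmul, Fin.sum_univ_one]
  have h0 : Fin.contractNth (Fin.castSucc (0 : Fin 1)) (· * ·) v 0 = v 0 * v 1 := rfl
  have h1 : Fin.tail v 0 = v 1 := rfl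
  have h2 : Fin.init v 0 = v 0 := rfl
  rw [map_add, map_add, map_zsmul, map_zsmul, psi_tmul, psi_tmul,
    psi_tmul, h0, h1, h2, lieToP_mul, inL_apply, inR_apply]
  have h3 : v (Fin.last 1) = v 1 := rfl
  simp only [h3, Fin.val_zero, zero_add, pow_one, neg_smul, one_smul, even_two, Even.neg_pow,
    one_pow, LinearMap.zero_apply, mul_add, ← mul_assoc, Nat.reduceAdd]
  abel

lemma chiPhi_chiH [CharZero K] (j : ℕ) (z : (PEnv K A ⊗[K] ⨂[K]^1 A) ⊗[K] ⋀[K]^(j + 1) A) :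
    chiPhi K A j (chiH K A 1 j z) + chiH0 K A (j + 1) (chiPhi K A (j + 1) z) =
      psi.rTensor _ z := by
  suffices h : ((chiPhi K A j).restrictScalars K) ∘ₗ ((chiH K A 1 j).restrictScalars K) +
      ((chiH0 K A (j + 1)).restrictScalars K) ∘ₗ ((chiPhi K A (j + 1)).restrictScalars K) =
      psi.rTensor _ from LinearMap.congr_fun h z
  refine ext_tmul fun n v => ?_
  have key : ∀ p (w : Fin 1 → A), chiPhi K A j (chiH K A 1 j
      ((p ⊗ₜ PiTensorProduct.tprod K w) ⊗ₜ exteriorPower.ιMulti K (j + 1) v)) =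
      ext1 K j (w 0) (ceD K (pRight K A) j (p ⊗ₜ exteriorPower.ιMulti K (j + 1) v)) +
      p ⊗ₜ lieAlt K (j + 1) (w 0) v := by
    intro p w
    have hw : ∀ x, (tpow K A 1).act x (PiTensorProduct.tprod K w) =
        PiTensorProduct.tprod K ![ad K x (w 0)] := fun x => by
      rw [tpow_act, Fin.sum_univ_one]
      congr 1
      ext i
      rw [Subsingleton.elim i 0]
      simp
    change chiPhi K A j (ceD K (rowAct K A 1) j _) = _
    rw [ceD_tmul, ceD_tmul, lieAlt_succ, map_sum, map_sum, TensorProduct.tmul_sum,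
      ← Finset.sum_add_distrib]
    refine Finset.sum_congr rfl fun k _ => ?_
    have hs : ∀ (c : K) y, chiPhi K A j (c • y) = c • chiPhi K A j y := fun c y =>
      ((chiPhi K A j).restrictScalars K).map_smul c y
    rw [rowAct_tmul, hw, TensorProduct.sub_tmul, map_zsmul, map_zsmul, map_sub, map_sub, map_sub,
      hs, chiPhi_tmul, chiPhi_tmul, chiPhi_tmul, pRight_apply, ext1_tmul, ext1_tmul,
      TensorProduct.tmul_smul, ← smul_add, map_smul, ad_skew K (w 0)]
    have h : exteriorPower.ιMulti K (j + 1) (Fin.cons (-ad K (v k) (w 0)) (k.removeNth v)) =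
        - exteriorPower.ιMulti K (j + 1) (Fin.cons (ad K (v k) (w 0)) (k.removeNth v)) := by
      have := map_neg (wedgeAlt K j) (ad K (v k) (w 0))
      exact DFunLike.congr_fun this (k.removeNth v)
    rw [h, TensorProduct.tmul_neg]
    congr 1
    simp only [Matrix.cons_val_zero]
    abel
  have key2 : ∀ p (w : Fin 1 → A), chiH0 K A (j + 1) (chiPhi K A (j + 1)
      ((p ⊗ₜ PiTensorProduct.tprod K w) ⊗ₜ exteriorPower.ιMulti K (j + 1) v)) =
      - theta K (pRight K A) (j + 1) (w 0) (p ⊗ₜ exteriorPower.ιMulti K (j + 1) v)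
      - ext1 K j (w 0) (ceD K (pRight K A) j (p ⊗ₜ exteriorPower.ιMulti K (j + 1) v)) := by
    intro p w
    rw [chiPhi_tmul]
    exact ceD_ext1 K (pRight K A) j (w 0) _
  suffices h : ((chiPhi K A j).restrictScalars K) ∘ₗ ((chiH K A 1 j).restrictScalars K) ∘ₗ
      (TensorProduct.mk K _ _).flip (exteriorPower.ιMulti K (j + 1) v) +
      ((chiH0 K A (j + 1)).restrictScalars K) ∘ₗ ((chiPhi K A (j + 1)).restrictScalars K) ∘ₗ
      (TensorProduct.mk K _ _).flip (exteriorPower.ιMulti K (j + 1) v) =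
      psi.rTensor _ ∘ₗ (TensorProduct.mk K _ _).flip (exteriorPower.ιMulti K (j + 1) v) from
    LinearMap.congr_fun h n
  refine hb_ext fun p w => ?_
  refine (congrArg₂ (· + ·) (key p w) (key2 p w)).trans ?_
  change _ = psi (p ⊗ₜ PiTensorProduct.tprod K w) ⊗ₜ exteriorPower.ιMulti K (j + 1) v
  rw [theta_tmul, psi_tmul, pRight_apply]
  abel

lemma chiPhi_zero (z : (PEnv K A ⊗[K] ⨂[K]^1 A) ⊗[K] ⋀[K]^0 A) :
    chiH0 K A 0 (chiPhi K A 0 z) = psi.rTensor _ z := by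
  suffices h : ((chiH0 K A 0).restrictScalars K) ∘ₗ ((chiPhi K A 0).restrictScalars K) =
      psi.rTensor _ from LinearMap.congr_fun h z
  refine TensorProduct.ext' fun n ω => ?_
  suffices h : ((chiH0 K A 0).restrictScalars K) ∘ₗ ((chiPhi K A 0).restrictScalars K) ∘ₗ
      (TensorProduct.mk K _ _).flip ω = psi.rTensor _ ∘ₗ (TensorProduct.mk K _ _).flip ω from
    LinearMap.congr_fun h n
  refine hb_ext fun p w => ?_
  change chiH0 K A 0 (chiPhi K A 0 ((p ⊗ₜ PiTensorProduct.tprod K w) ⊗ₜ ω)) =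
    psi (p ⊗ₜ PiTensorProduct.tprod K w) ⊗ₜ ω
  rw [chiPhi_tmul, psi_tmul]
  refine (ceD_ext1_zero K (pRight K A) (w 0) _).trans ?_
  have h : exteriorPower.alternatingMapLinearEquiv (lieAlt K 0 (w 0)) = 0 := by
    simp [lieAlt]
  rw [theta, h, LinearMap.lTensor_zero, zero_sub, LinearMap.neg_apply, neg_neg]
  rfl

lemma psi_chiB (j : ℕ) (z : (PEnv K A ⊗[K] ⨂[K]^2 A) ⊗[K] ⋀[K]^j A) :
    psi.rTensor _ (chiB K A 1 j z) = 0 := by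
  rw [chiB_eq, ← LinearMap.comp_apply, ← LinearMap.rTensor_comp]
  have : psi ∘ₗ (hb envToP 1).restrictScalars K = 0 := LinearMap.ext (psi_hb (K := K) (A := A))
  rw [this, LinearMap.rTensor_zero, LinearMap.zero_apply]

lemma zsmul_lin_apply {R M N : Type u} [Ring R] [AddCommGroup M] [Module R M] [AddCommGroup N]
    [Module R N] (c : ℤ) (f : M →ₗ[R] N) (x : M) : (c • f) x = c • f x := rfl

lemma chi_vv (m j : ℕ) (z : (PEnv K A ⊗[K] ⨂[K]^(m + 2) A) ⊗[K] ⋀[K]^j A) :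
    ((-1 : ℤ) ^ j • chiB K A m j) (((-1 : ℤ) ^ j • chiB K A (m + 1) j) z) = 0 := by
  rw [zsmul_lin_apply, zsmul_lin_apply, map_zsmul, chiB_chiB, zsmul_zero, zsmul_zero]

lemma chi_vv_zero (j : ℕ) (z : (PEnv K A ⊗[K] ⨂[K]^3 A) ⊗[K] ⋀[K]^j A) :
    chiPhi K A j (chiB K A 1 j (((-1 : ℤ) ^ j • chiB K A 2 j) z)) = 0 := by
  rw [zsmul_lin_apply, map_zsmul, chiB_chiB, zsmul_zero, map_zero]

lemma chi_anti_zero (z : (PEnv K A ⊗[K] ⨂[K]^2 A) ⊗[K] ⋀[K]^0 A) :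
    0 + chiH0 K A 0 (chiPhi K A 0 (chiB K A 1 0 z)) = 0 := by
  rw [zero_add, chiPhi_zero, psi_chiB]

lemma chi_anti_one [CharZero K] (j : ℕ)
    (z : (PEnv K A ⊗[K] ⨂[K]^2 A) ⊗[K] ⋀[K]^(j + 1) A) :
    chiPhi K A j (chiB K A 1 j (chiH K A 2 j z)) +
      chiH0 K A (j + 1) (chiPhi K A (j + 1) (chiB K A 1 (j + 1) z)) = 0 := by
  rw [chiB_chiH, chiPhi_chiH, psi_chiB]

lemma chi_anti (m j : ℕ) (z : (PEnv K A ⊗[K] ⨂[K]^(m + 1) A) ⊗[K] ⋀[K]^(j + 1) A) :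
    ((-1 : ℤ) ^ j • chiB K A m j) (chiH K A (m + 1) j z) +
      chiH K A m j (((-1 : ℤ) ^ (j + 1) • chiB K A m (j + 1)) z) = 0 := by
  rw [zsmul_lin_apply, zsmul_lin_apply, map_zsmul, chiB_chiH, ← add_smul, pow_succ,
    mul_neg_one, add_neg_cancel, zero_smul]

variable (K A)

/-- The terms `C i j` of the characteristic bicomplex. -/
def chiX : ℕ → ℕ → ModuleCat.{u} (PEnv K A)
  | 0, j => ModuleCat.of _ (PEnv K A ⊗[K] ⋀[K]^j A)
  | _ + 1, 0 => ModuleCat.of _ PUnit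
  | i + 1, j + 1 => ModuleCat.of _ ((PEnv K A ⊗[K] ⨂[K]^(i + 2) A) ⊗[K] ⋀[K]^j A)

/-- The horizontal differentials `C i (j + 1) → C i j` of the characteristic bicomplex. -/
def chiDH : ∀ i j, chiX K A i (j + 1) ⟶ chiX K A i j
  | 0, j => ModuleCat.ofHom (chiH0 K A j)
  | _ + 1, 0 => 0
  | i + 1, j + 1 => ModuleCat.ofHom (chiH K A (i + 2) j)

/-- The vertical differentials `C (i + 1) j → C i j` of the characteristic bicomplex. -/
def chiDV : ∀ i j, chiX K A (i + 1) j ⟶ chiX K A i j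
  | 0, 0 => 0
  | 0, j + 1 => ModuleCat.ofHom (chiPhi K A j ∘ₗ chiB K A 1 j)
  | _ + 1, 0 => 0
  | i + 1, j + 1 => ModuleCat.ofHom ((-1 : ℤ) ^ j • chiB K A (i + 2) j)

/-- The characteristic bicomplex of `A`: its row `0` is `P ⊗ ∧ʲ`, and its row `i ≥ 1` is
`P ⊗ Aⁱ⁺¹ ⊗ ∧ʲ⁻¹`, placed in the columns `j ≥ 1`. -/
def chiBi [CharZero K] : Bicomplex (PEnv K A) where
  X := chiX K A
  dH := chiDH K A
  dV := chiDV K A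
  dH_dH
    | 0, j => by
      apply ModuleCat.hom_ext
      apply LinearMap.ext
      intro z
      exact ceD_ceD K (pRight K A) pRight_bracket j z
    | i + 1, 0 => Limits.comp_zero
    | i + 1, j + 1 => by
      apply ModuleCat.hom_ext
      apply LinearMap.ext
      intro z
      exact ceD_ceD K (rowAct K A (i + 2)) (rowAct_bracket (i + 2)) j z
  dV_dV
    | 0, 0 => Limits.comp_zero
    | i + 1, 0 => Limits.comp_zero
    | 0, j + 1 => by
      apply ModuleCat.hom_ext
      apply LinearMap.ext
      intro z
      exact chi_vv_zero j z
    | i + 1, j + 1 => by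
      apply ModuleCat.hom_ext
      apply LinearMap.ext
      intro z
      exact chi_vv (i + 2) j z
  anti
    | 0, 0 => by
      apply ModuleCat.hom_ext
      apply LinearMap.ext
      intro z
      exact chi_anti_zero z
    | 0, j + 1 => by
      apply ModuleCat.hom_ext
      apply LinearMap.ext
      intro z
      exact chi_anti_one j z
    | i + 1, 0 => by
      rw [show chiDH K A (i + 1) 0 = 0 from rfl, show chiDV K A (i + 1) 0 = 0 from rfl,
        Limits.comp_zero, Limits.comp_zero, add_zero]
    | i + 1, j + 1 => by
      apply ModuleCat.hom_ext
      apply LinearMap.ext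
      intro z
      exact chi_anti (i + 2) j z

/-- The characteristic complex of `A`, the total complex of the characteristic bicomplex. -/
def chi [CharZero K] : ChainComplex (ModuleCat.{u} (PEnv K A)) ℕ := (chiBi K A).tot

end Characteristic

section Torsion

variable (K A : Type u) [Field K] [Ring A] [Algebra K A] [PoissonAlgebra K A]

/-- The functor `P ⊗_Q -`. -/
abbrev extP : ModuleCat.{u} (QEnv K A) ⥤ ModuleCat.{u} (PEnv K A) :=
  scalarExt (toP K A).toRingHom

/-- The left `P`-module `Tor_n^Q(P, M)`, the `n`-th left derived functor of `P ⊗_Q -` at `M`. -/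
abbrev torP (n : ℕ) (M : ModuleCat.{u} (QEnv K A)) : ModuleCat.{u} (PEnv K A) :=
  ((extP K A).leftDerived n).obj M

/-- The `Q`-module `A²`. -/
abbrev A2 : ModuleCat.{u} (QEnv K A) := (QRep.regular K A).obj

/-- The complex `P ⊗_Q T` of `P`-modules. -/
abbrev extPC (T : ChainComplex (ModuleCat.{u} (QEnv K A)) ℕ) :
    ChainComplex (ModuleCat.{u} (PEnv K A)) ℕ :=
  ((extP K A).mapHomologicalComplex (ComplexShape.down ℕ)).obj T

/-- The map `n ↦ n + 2` of indices of chain complexes. -/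
def plusTwo : ComplexShape.Embedding (ComplexShape.down ℕ) (ComplexShape.down ℕ) where
  f n := n + 2
  injective_f := add_left_injective 2
  rel {i j} h := by
    have h' : j + 1 = i := h
    exact (show j + 2 + 1 = i + 2 by omega)

instance : plusTwo.IsRelIff where
  rel' i j h := by
    have h' : j + 2 + 1 = i + 2 := h
    exact (show j + 1 = i by omega)

/-- The complex `C[2]`, whose term in degree `n + 2` is `C n`, and whose terms in degrees `0` and
`1` vanish. -/
abbrev shiftTwo {R : Type u} [Ring R] (C : ChainComplex (ModuleCat.{u} R) ℕ) :
    ChainComplex (ModuleCat.{u} R) ℕ := C.extend plusTwo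

variable {K A}

/-- A complex of free modules with a quasi-isomorphism to a module, as a projective resolution. -/
def resolution {R : Type u} [Ring R] {X : ModuleCat.{u} R} {T : ChainComplex (ModuleCat.{u} R) ℕ}
    (π : T ⟶ (ChainComplex.single₀ _).obj X) (hT : ∀ n, Module.Free R (T.X n))
    (hπ : QuasiIso π) : ProjectiveResolution X where
  complex := T
  projective n :=
    have := hT n
    (IsProjective.iff_projective (T.X n)).1 inferInstance
  π := π
  quasiIso := hπ

variable {X'' X' : ModuleCat.{u} (QEnv K A)} {T'' T' : ChainComplex (ModuleCat.{u} (QEnv K A)) ℕ}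
  {C : ChainComplex (ModuleCat.{u} (PEnv K A)) ℕ}

/-- The map `Tor_n^Q(P, X'') → H_n(C)` induced by a map `f : P ⊗_Q T'' → C`, where `T''` is a free
resolution of `X''`. -/
def torToH (π : T'' ⟶ (ChainComplex.single₀ _).obj X'')
    (hT : ∀ n, Module.Free (QEnv K A) (T''.X n)) (hπ : QuasiIso π) (f : extPC K A T'' ⟶ C) (n : ℕ) :
    torP K A n X'' ⟶ C.homology n :=
  ((resolution π hT hπ).isoLeftDerivedObj (extP K A) n).hom ≫ HomologicalComplex.homologyMap f n

/-- The map `H_{n+2}(C) → Tor_n^Q(P, X')` induced by a map `g : C → (P ⊗_Q T')[2]`, where `T'` is a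
free resolution of `X'`. -/
def hToTor (π : T' ⟶ (ChainComplex.single₀ _).obj X')
    (hT : ∀ n, Module.Free (QEnv K A) (T'.X n)) (hπ : QuasiIso π)
    (g : C ⟶ shiftTwo (extPC K A T')) (n : ℕ) :
    C.homology (n + 2) ⟶ torP K A n X' :=
  HomologicalComplex.homologyMap g (n + 2) ≫
    ((extPC K A T').extendHomologyIso plusTwo (show plusTwo.f n = n + 2 from rfl)).hom ≫
    ((resolution π hT hπ).isoLeftDerivedObj (extP K A) n).inv

/-- The map `Tor_n^Q(P, X') → Tor_{n+1}^Q(P, X'')` given by the connecting homomorphism of a short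
exact sequence `0 → P ⊗_Q T'' → C → (P ⊗_Q T')[2] → 0`, where `T''` and `T'` are free resolutions
of `X''` and `X'`. -/
def torToTor (π'' : T'' ⟶ (ChainComplex.single₀ _).obj X'')
    (hT'' : ∀ n, Module.Free (QEnv K A) (T''.X n)) (hπ'' : QuasiIso π'')
    (π' : T' ⟶ (ChainComplex.single₀ _).obj X')
    (hT' : ∀ n, Module.Free (QEnv K A) (T'.X n)) (hπ' : QuasiIso π')
    {f : extPC K A T'' ⟶ C} {g : C ⟶ shiftTwo (extPC K A T')} {w : f ≫ g = 0}
    (hS : (ShortComplex.mk f g w).ShortExact) (n : ℕ) :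
    torP K A n X' ⟶ torP K A (n + 1) X'' :=
  ((resolution π' hT' hπ').isoLeftDerivedObj (extP K A) n).hom ≫
    ((extPC K A T').extendHomologyIso plusTwo (show plusTwo.f n = n + 2 from rfl)).inv ≫
    hS.δ (n + 2) (n + 1) rfl ≫
    ((resolution π'' hT'' hπ'').isoLeftDerivedObj (extP K A) (n + 1)).inv

variable [CharZero K]

/-- The identity of `A² ⊗ U(A) ⊗ ∧ⁿ`, as a map to the term in degree `n` of `T''`. -/
def inT2 (n : ℕ) (z : Env K A ⊗[K] (UEnv K A ⊗[K] ⋀[K]^n A)) : (T2 K A).X n := z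

/-- The inclusion of `Aⁱ⁺⁴ ⊗ U(A) ⊗ ∧ʲ` into the term in degree `i + j` of `T'`. -/
def inT1 (i j : ℕ) (z : (Env K A ⊗[K] ⨂[K]^(i + 2) A) ⊗[K] (UEnv K A ⊗[K] ⋀[K]^j A)) :
    (T1 K A).X (i + j) := (T1bi K A).incl i j (i + j) rfl z

/-- The inclusion of row `0` of the bicomplex into the characteristic complex. -/
def inChi0 (n : ℕ) (z : PEnv K A ⊗[K] ⋀[K]^n A) : (chi K A).X n :=
  (chiBi K A).incl 0 n n (zero_add n) z

/-- The inclusion of `P ⊗ Aⁱ⁺² ⊗ ∧ʲ`, which stands in row `i + 1` and column `j + 1` of the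
bicomplex, into the characteristic complex. -/
def inChi (i j : ℕ) (z : (PEnv K A ⊗[K] ⨂[K]^(i + 2) A) ⊗[K] ⋀[K]^j A) :
    (chi K A).X (i + j + 2) :=
  (chiBi K A).incl (i + 1) (j + 1) (i + j + 2) (by omega) z

/-- The element `p ⊗ m` of `P ⊗_Q M`. -/
def ptmul {M : ModuleCat.{u} (QEnv K A)} (p : PEnv K A) (m : M) : (extP K A).obj M :=
  Bal.tmul _ p m

/-- The term in degree `n` of `C`, as the term in degree `n + 2` of `C[2]`. -/
def toShift {R : Type u} [Ring R] (C : ChainComplex (ModuleCat.{u} R) ℕ) (n : ℕ) (z : C.X n) :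
    (shiftTwo C).X (n + 2) := (C.extendXIso plusTwo (show plusTwo.f n = n + 2 from rfl)).inv.hom z

end Torsion

end Poisson

end

open Poisson

/-! The characteristic bicomplex splits along its rows. Row `0` is a subcomplex isomorphic to `P ⊗_Q
T''`, since vertical differentials enter it and never leave it. The quotient consists of the rows `i
≥ 1`, which form `P ⊗_Q T'` raised by two degrees, one for the row and one for the column. The short
exact sequence is therefore a matter of identifying terms and differentials. It yields the long
exact sequence once `T''` and `T'` are known to be free resolutions.

Exactness. Vector spaces are flat, so everything reduces to the Koszul complex resolving `K` and to
the exactness of the bar complex. For the Koszul complex, PBW enters only through a linear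
retraction `e : U(A) → A` of the canonical map with `e 1 = 0` (`exists_retraction_enveloping`),
obtained by letting the Lie algebra act on its symmetric algebra. With the comultiplication of
`U(A)`, it defines the homotopy `h : u ⊗ ω ↦ ∑ u₁ ⊗ (e(u₂) ∧ ω)`. On products of at most `n` letters
tensored with `∧ʲ`, the operator `dh + hd` is multiplication by `n + j` modulo products of fewer
letters (`kL_mem`). In characteristic zero this integer is invertible unless `n = j = 0`, so cycles
are boundaries by induction on the filtration. The bar complex has its usual contraction
(`barD_barS`), and `Bicomplex.totD_exact` combines the two for `T'`.

Freeness. The term `A² ⊗ U(A) ⊗ ∧ⁿ` is `Q ⊗ ∧ⁿ` up to associativity. On `Aᵐ⁺² ⊗ U(A) ⊗ ∧ʲ` the Lie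
algebra acts diagonally, and the tensor identity `U(A) ⊗ W ≅ W ⊗ U(A)` (`tiEquiv`) untwists the
action, so the module is free on `Aᵐ ⊗ ∧ʲ`.

Differentials. After applying `P ⊗_Q -`, the terms become `P ⊗ ∧ⁿ` and `P ⊗ Aᵐ ⊗ ∧ʲ`. Moving `x ∈ A`
across `⊗_Q` from the diagonal action leaves the correction `-p ⊗ {x, θ}`, which is the right action
used in the rows `i ≥ 1` (`barSlot_eq`). Both differentials are natural in their coefficients
(`ceD_natural`, `hb_natural`), so they are compared along the orbit maps `u ↦ p(b # u)`, `u ↦ (p ⊗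
θ)u` and `b ↦ pb`.

Low degrees. The shifted complex vanishes in degrees `0` and `1`, which gives the end of the
sequence. The functor `P ⊗_Q -` is a left adjoint, hence right exact, so `Tor₀` is `P ⊗_Q -` itself.
-/

noncomputable section

namespace Poisson

/-! ### A Poincaré–Birkhoff–Witt retraction of the enveloping algebra -/

section PBW

variable {K L X : Type*} [Field K] [LieRing L] [LieAlgebra K L] [LinearOrder X]
  (b : Module.Basis X K L)

/-- The bilinear map `L → K[Multiset X] → K[Multiset X]` with given values on the bases. -/
def pbwExt (F : X → Multiset X → (Multiset X →₀ K)) :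
    L →ₗ[K] (Multiset X →₀ K) →ₗ[K] (Multiset X →₀ K) :=
  b.constr K fun i => Finsupp.linearCombination K (F i)

lemma pbwExt_basis (F : X → Multiset X → (Multiset X →₀ K)) (i : X) (M : Multiset X) :
    pbwExt b F (b i) (Finsupp.single M 1) = F i M := by
  simp [pbwExt]

/-- The span of the monomials of degree at most `n`. -/
def pbwFil (K : Type*) [Field K] (X : Type*) (n : ℕ) : Submodule K (Multiset X →₀ K) :=
  Submodule.span K {s | ∃ M : Multiset X, M.card ≤ n ∧ s = Finsupp.single M 1}

lemma single_mem_pbwFil {M : Multiset X} {n : ℕ} (h : M.card ≤ n) :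
    Finsupp.single M (1 : K) ∈ pbwFil K X n :=
  Submodule.subset_span ⟨M, h, rfl⟩

lemma pbwFil_mono {m n : ℕ} (h : m ≤ n) : pbwFil K X m ≤ pbwFil K X n :=
  Submodule.span_mono fun _ ⟨M, hM, hs⟩ => ⟨M, hM.trans h, hs⟩

-- Stability of the approximations is proved on monomials; this carries it over to arbitrary
-- elements of bounded degree.
variable {b} in
lemma pbwExt_ext {F G : X → Multiset X → (Multiset X →₀ K)} {n : ℕ}
    (h : ∀ i M, M.card ≤ n → F i M = G i M) (x : L) {s : Multiset X →₀ K}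
    (hs : s ∈ pbwFil K X n) : pbwExt b F x s = pbwExt b G x s := by
  induction hs using Submodule.span_induction with
  | mem s hs =>
    obtain ⟨M, hM, rfl⟩ := hs
    suffices h' : (pbwExt b F).flip (Finsupp.single M 1) =
        (pbwExt b G).flip (Finsupp.single M 1) from LinearMap.congr_fun h' x
    refine b.ext fun i => ?_
    simp only [LinearMap.flip_apply, pbwExt_basis, h i M hM]
  | zero => simp
  | add s t _ _ hs ht => simp [hs, ht]
  | smul c s _ hs => simp [hs]

variable {b} in
lemma pbwExt_mem {F : X → Multiset X → (Multiset X →₀ K)}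
    (h : ∀ i M, F i M - Finsupp.single (i ::ₘ M) 1 ∈ pbwFil K X M.card) (x : L) {n : ℕ}
    {s : Multiset X →₀ K} (hs : s ∈ pbwFil K X n) : pbwExt b F x s ∈ pbwFil K X (n + 1) := by
  induction hs using Submodule.span_induction with
  | mem s hs =>
    obtain ⟨M, hM, rfl⟩ := hs
    suffices h' : (⊤ : Submodule K L) ≤ (pbwFil K X (n + 1)).comap
        ((pbwExt b F).flip (Finsupp.single M 1)) from h' (Submodule.mem_top (x := x))
    rw [← b.span_eq, Submodule.span_le]
    rintro _ ⟨i, rfl⟩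
    change pbwExt b F (b i) (Finsupp.single M 1) ∈ pbwFil K X (n + 1)
    rw [pbwExt_basis, ← sub_add_cancel (F i M) (Finsupp.single (i ::ₘ M) 1)]
    exact add_mem (pbwFil_mono (by omega) (h i M)) (single_mem_pbwFil (by simpa using hM))
  | zero => simp
  | add s t _ _ hs ht => rw [map_add]; exact add_mem hs ht
  | smul c s _ hs => rw [map_smul]; exact Submodule.smul_mem _ _ hs

/-- The letter split off is the least one of `M`; the recursion below runs on this decomposition. -/
lemma Multiset.exists_cons_le {M : Multiset X} {i : X} (h : ¬ ∀ k ∈ M, i ≤ k) :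
    ∃ j M', M = j ::ₘ M' ∧ j < i ∧ ∀ k ∈ M', j ≤ k := by
  push Not at h
  obtain ⟨k, hk, hki⟩ := h
  obtain ⟨j, hj, hm⟩ := M.toFinset.exists_min_image id ⟨k, by simpa using hk⟩
  simp only [Multiset.mem_toFinset, id] at hj hm
  exact ⟨j, M.erase j, (Multiset.cons_erase hj).symm, (hm k hk).trans_lt hki,
    fun l hl => hm l (Multiset.mem_of_mem_erase hl)⟩

/-- A least letter is unique, so the decomposition chosen in `pbwApprox` is immaterial. -/
lemma Multiset.cons_inj_of_le {j j' : X} {M M' : Multiset X} (h : j ::ₘ M = j' ::ₘ M')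
    (hj : ∀ k ∈ M, j ≤ k) (hj' : ∀ k ∈ M', j' ≤ k) : j = j' ∧ M = M' := by
  have h1 : j = j' := by
    apply le_antisymm
    · have : j' ∈ j ::ₘ M := h ▸ Multiset.mem_cons_self _ _
      rcases Multiset.mem_cons.1 this with h | h
      · exact h.ge
      · exact hj _ h
    · have : j ∈ j' ::ₘ M' := h ▸ Multiset.mem_cons_self _ _
      rcases Multiset.mem_cons.1 this with h | h
      · exact h.ge
      · exact hj' _ h
  subst h1
  exact ⟨rfl, (Multiset.cons_inj_right _).1 h⟩

open Classical in
/-- Approximations of the action of `L` on the symmetric algebra: the `n`-th one is correct on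
monomials of degree at most `n`. -/
def pbwApprox : ℕ → X → Multiset X → (Multiset X →₀ K)
  | 0, i, M => Finsupp.single (i ::ₘ M) 1
  | n + 1, i, M =>
    if h : ∃ p : X × Multiset X, M = p.1 ::ₘ p.2 ∧ p.1 < i ∧ ∀ k ∈ p.2, p.1 ≤ k then
      -- With `M = j ::ₘ M'`, the value is forced by `b i · (b j · M') = b j · (b i · M') + ⁅b i, b
      -- j⁆ · M'`. Here `b j · M'` is `j ::ₘ M'`, and `b j` sends the leading term `i ::ₘ M'` of `b
      -- i · M'` to `i ::ₘ M`. Only the lower terms need the previous approximation.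
      Finsupp.single (i ::ₘ M) 1
        + pbwExt b (pbwApprox n) (b h.choose.1) (pbwExt b (pbwApprox n) (b i)
          (Finsupp.single h.choose.2 1) - Finsupp.single (i ::ₘ h.choose.2) 1)
        + pbwExt b (pbwApprox n) ⁅b i, b h.choose.1⁆ (Finsupp.single h.choose.2 1)
    else Finsupp.single (i ::ₘ M) 1

lemma pbwApprox_of_le (n : ℕ) {i : X} {M : Multiset X} (h : ∀ k ∈ M, i ≤ k) :
    pbwApprox b n i M = Finsupp.single (i ::ₘ M) 1 := by
  cases n with
  | zero => rfl
  | succ n =>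
    rw [pbwApprox, dif_neg]
    rintro ⟨⟨j, M'⟩, rfl, h1, -⟩
    exact (h j (Multiset.mem_cons_self _ _)).not_gt h1

lemma pbwApprox_cons (n : ℕ) {i j : X} {M : Multiset X} (hji : j < i) (h : ∀ k ∈ M, j ≤ k) :
    pbwApprox b (n + 1) i (j ::ₘ M) = Finsupp.single (i ::ₘ j ::ₘ M) 1
        + pbwExt b (pbwApprox b n) (b j) (pbwExt b (pbwApprox b n) (b i)
          (Finsupp.single M 1) - Finsupp.single (i ::ₘ M) 1)
        + pbwExt b (pbwApprox b n) ⁅b i, b j⁆ (Finsupp.single M 1) := by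
  have hex : ∃ p : X × Multiset X, j ::ₘ M = p.1 ::ₘ p.2 ∧ p.1 < i ∧ ∀ k ∈ p.2, p.1 ≤ k :=
    ⟨(j, M), rfl, hji, h⟩
  rw [pbwApprox, dif_pos hex]
  obtain ⟨h1, h2⟩ := Multiset.cons_inj_of_le hex.choose_spec.1 h hex.choose_spec.2.2
  rw [← h1, ← h2]

/-- The corrections apply operators to `M'` and to `b i · M' - i ::ₘ M'`, both of degree below that
of `M`, and an operator raises the degree by at most one. -/
lemma pbwApprox_sub_mem (n : ℕ) (i : X) (M : Multiset X) :
    pbwApprox b n i M - Finsupp.single (i ::ₘ M) 1 ∈ pbwFil K X M.card := by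
  induction n generalizing i M with
  | zero => simp [pbwApprox]
  | succ n ih =>
    by_cases h : ∀ k ∈ M, i ≤ k
    · simp [pbwApprox_of_le b _ h]
    · obtain ⟨j, M', rfl, h1, h2⟩ := Multiset.exists_cons_le h
      rw [pbwApprox_cons b n h1 h2, add_assoc, add_sub_cancel_left, Multiset.card_cons]
      refine add_mem (pbwExt_mem ih _ ?_) (pbwExt_mem ih _ (single_mem_pbwFil le_rfl))
      rw [pbwExt_basis]
      exact ih i M'

/-- The recursion at `M` consults only degrees below that of `M`, where consecutive approximations
already agree. -/
lemma pbwApprox_succ (n : ℕ) (i : X) (M : Multiset X) (hM : M.card ≤ n) :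
    pbwApprox b (n + 1) i M = pbwApprox b n i M := by
  induction n generalizing i M with
  | zero =>
    obtain rfl : M = 0 := by simpa using hM
    rw [pbwApprox_of_le _ _ (by simp), pbwApprox_of_le _ _ (by simp)]
  | succ n ih =>
    by_cases h : ∀ k ∈ M, i ≤ k
    · simp [pbwApprox_of_le b _ h]
    · obtain ⟨j, M', rfl, h1, h2⟩ := Multiset.exists_cons_le h
      have hc : M'.card ≤ n := by simpa using hM
      have hz : Finsupp.single M' (1 : K) ∈ pbwFil K X n := single_mem_pbwFil hc
      rw [pbwApprox_cons b (n + 1) h1 h2, pbwApprox_cons b n h1 h2, pbwExt_ext ih _ hz,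
        pbwExt_ext ih _ hz, pbwExt_ext ih]
      rw [pbwExt_basis]
      exact pbwFil_mono hc (pbwApprox_sub_mem b n i M')

/-- The action of `L` on the symmetric algebra. -/
def pbwAct : L →ₗ[K] (Multiset X →₀ K) →ₗ[K] (Multiset X →₀ K) :=
  pbwExt b fun i M => pbwApprox b M.card i M

lemma pbwAct_eq (n : ℕ) (x : L) {s : Multiset X →₀ K} (hs : s ∈ pbwFil K X n) :
    pbwAct b x s = pbwExt b (pbwApprox b n) x s := by
  refine pbwExt_ext (fun i M hM => ?_) x hs
  clear hs
  induction n, hM using Nat.le_induction with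
  | base => rfl
  | succ n hn ih => rw [ih, pbwApprox_succ b n i M hn]

lemma pbwAct_of_le {i : X} {M : Multiset X} (h : ∀ k ∈ M, i ≤ k) :
    pbwAct b (b i) (Finsupp.single M 1) = Finsupp.single (i ::ₘ M) 1 := by
  rw [pbwAct, pbwExt_basis, pbwApprox_of_le b _ h]

lemma pbwAct_sub_mem (i : X) (M : Multiset X) :
    pbwAct b (b i) (Finsupp.single M 1) - Finsupp.single (i ::ₘ M) 1 ∈ pbwFil K X M.card := by
  rw [pbwAct, pbwExt_basis]
  exact pbwApprox_sub_mem b _ i M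

/-- True by construction: it is the recursion at `j ::ₘ M` read backwards. -/
lemma pbwAct_pbwAct {i j : X} {M : Multiset X} (hji : j < i) (h : ∀ k ∈ M, j ≤ k) :
    pbwAct b (b i) (pbwAct b (b j) (Finsupp.single M 1)) =
      pbwAct b (b j) (pbwAct b (b i) (Finsupp.single M 1)) +
      pbwAct b ⁅b i, b j⁆ (Finsupp.single M 1) := by
  have hz : Finsupp.single M (1 : K) ∈ pbwFil K X M.card := single_mem_pbwFil le_rfl
  have h1 : pbwAct b (b j) (Finsupp.single (i ::ₘ M) 1) = Finsupp.single (j ::ₘ i ::ₘ M) 1 :=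
    pbwAct_of_le b fun k hk => (Multiset.mem_cons.1 hk).elim (fun e => e ▸ hji.le) (h k)
  rw [pbwAct_of_le b h, ← sub_add_cancel (pbwAct b (b i) (Finsupp.single M 1))
    (Finsupp.single (i ::ₘ M) 1), map_add, h1, pbwAct_eq b _ _ (pbwAct_sub_mem b i M),
    pbwAct_eq b _ _ hz, pbwAct_eq b _ _ hz, Multiset.cons_swap j i, pbwAct, pbwExt_basis,
    Multiset.card_cons, pbwApprox_cons b _ hji h]
  abel

/-- Induction on the degree of a monomial `M`. By bilinearity and skew-symmetry it suffices to treat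
basis elements with `j < i`. If `j` is at most every letter of `M`, `pbwAct_pbwAct` applies.
Otherwise the least letter `k` of `M` is pulled out as the operator `b k`, and the relations for
`(i, k)` and `(j, k)`, the induction hypothesis and the Jacobi identity give the one for `(i, j)`.
-/
lemma pbwAct_bracket (x y : L) (s : Multiset X →₀ K) :
    pbwAct b ⁅x, y⁆ s = pbwAct b x (pbwAct b y s) - pbwAct b y (pbwAct b x s) := by
  suffices h : ∀ (n : ℕ) (M : Multiset X), M.card < n → ∀ x y,
      pbwAct b ⁅x, y⁆ (Finsupp.single M 1) = pbwAct b x (pbwAct b y (Finsupp.single M 1)) -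
        pbwAct b y (pbwAct b x (Finsupp.single M 1)) by
    induction s using Finsupp.induction_linear with
    | zero => simp
    | add s t hs ht => simp only [map_add, hs, ht]; abel
    | single M c =>
      rw [← mul_one c, ← smul_eq_mul, ← Finsupp.smul_single]
      simp only [map_smul, h _ M (Nat.lt_succ_self _), smul_sub]
  intro n
  induction n with
  | zero => intro M hM; omega
  | succ n ih =>
    intro M hM
    -- The guard `0 < n` is needed because `n - 1` is truncated: for `n = 0` the filtration step
    -- would contain the constants.
    have ih' : ∀ s ∈ pbwFil K X (n - 1), 0 < n → ∀ x y, pbwAct b ⁅x, y⁆ s =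
        pbwAct b x (pbwAct b y s) - pbwAct b y (pbwAct b x s) := by
      intro s hs hn x y
      induction hs using Submodule.span_induction with
      | mem s hs =>
        obtain ⟨M, hM, rfl⟩ := hs
        exact ih M (by omega) x y
      | zero => simp
      | add s t _ _ hs ht => simp only [map_add, hs, ht]; abel
      | smul c s _ hs => simp only [map_smul, hs, smul_sub]
    suffices h : ∀ i j, pbwAct b ⁅b i, b j⁆ (Finsupp.single M 1) =
        pbwAct b (b i) (pbwAct b (b j) (Finsupp.single M 1)) -
        pbwAct b (b j) (pbwAct b (b i) (Finsupp.single M 1)) by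
      intro x y
      induction b.mem_span x using Submodule.span_induction with
      | mem x hx =>
        obtain ⟨i, rfl⟩ := hx
        induction b.mem_span y using Submodule.span_induction with
        | mem y hy => obtain ⟨j, rfl⟩ := hy; exact h i j
        | zero => simp
        | add s t _ _ hs ht => simp only [lie_add, map_add, LinearMap.add_apply, hs, ht]; abel
        | smul c s _ hs => simp only [lie_smul, map_smul, LinearMap.smul_apply, hs, smul_sub]
      | zero => simp
      | add s t _ _ hs ht => simp only [add_lie, map_add, LinearMap.add_apply, hs, ht]; abel
      | smul c s _ hs => simp only [smul_lie, map_smul, LinearMap.smul_apply, hs, smul_sub]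
    have step : ∀ i j, j < i → (∀ k ∈ M, j ≤ k) → pbwAct b ⁅b i, b j⁆ (Finsupp.single M 1) =
        pbwAct b (b i) (pbwAct b (b j) (Finsupp.single M 1)) -
        pbwAct b (b j) (pbwAct b (b i) (Finsupp.single M 1)) := fun i j hji hj =>
      eq_sub_of_add_eq' (pbwAct_pbwAct b hji hj).symm
    have main : ∀ i j, j < i → pbwAct b ⁅b i, b j⁆ (Finsupp.single M 1) =
        pbwAct b (b i) (pbwAct b (b j) (Finsupp.single M 1)) -
        pbwAct b (b j) (pbwAct b (b i) (Finsupp.single M 1)) := by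
      intro i j hji
      by_cases hj : ∀ k ∈ M, j ≤ k
      · exact step i j hji hj
      obtain ⟨k, N, rfl, hkj, hk⟩ := Multiset.exists_cons_le hj
      rw [Multiset.card_cons] at hM
      have hN := ih N (by omega)
      -- The relation for `(i, k)` on `b j · N`: on the leading term `j ::ₘ N` the letter `k` is
      -- still least, and on the lower terms the induction hypothesis applies.
      have key : ∀ i j, k < i → k < j →
          pbwAct b (b i) (pbwAct b (b k) (pbwAct b (b j) (Finsupp.single N 1))) =
          pbwAct b (b k) (pbwAct b (b i) (pbwAct b (b j) (Finsupp.single N 1))) +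
          pbwAct b ⁅b i, b k⁆ (pbwAct b (b j) (Finsupp.single N 1)) := by
        intro i j hi hj
        have h1 := pbwAct_pbwAct b (M := j ::ₘ N) hi fun l hl =>
          (Multiset.mem_cons.1 hl).elim (fun e => e ▸ hj.le) (hk l)
        have h2 := ih' _ (pbwFil_mono (by omega) (pbwAct_sub_mem b j N)) (by omega) (b i) (b k)
        rw [← sub_add_cancel (pbwAct b (b j) (Finsupp.single N 1)) (Finsupp.single (j ::ₘ N) 1)]
        simp only [map_add] at h1 ⊢
        rw [h1, h2]
        abel
      -- Here `b k` is moved to the left end. Antisymmetrizing in `i` and `j` cancels the two mixed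
      -- terms and leaves the double brackets of the Jacobi identity.
      have key2 : ∀ i j, k < i → k < j →
          pbwAct b (b i) (pbwAct b (b j) (Finsupp.single (k ::ₘ N) 1)) =
          pbwAct b (b k) (pbwAct b (b i) (pbwAct b (b j) (Finsupp.single N 1))) +
          pbwAct b ⁅b i, b k⁆ (pbwAct b (b j) (Finsupp.single N 1)) +
          pbwAct b ⁅b j, b k⁆ (pbwAct b (b i) (Finsupp.single N 1)) +
          pbwAct b ⁅b i, ⁅b j, b k⁆⁆ (Finsupp.single N 1) := by
        intro i j hi hj
        rw [← pbwAct_of_le b hk, pbwAct_pbwAct b hj hk, map_add, key i j hi hj, hN (b i)]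
        abel
      rw [key2 i j (hkj.trans hji) hkj, key2 j i hkj (hkj.trans hji), ← pbwAct_of_le b hk]
      have h3 : pbwAct b ⁅⁅b i, b j⁆, b k⁆ (Finsupp.single N 1) =
          pbwAct b ⁅b i, ⁅b j, b k⁆⁆ (Finsupp.single N 1) -
          pbwAct b ⁅b j, ⁅b i, b k⁆⁆ (Finsupp.single N 1) := by
        rw [lie_lie, map_sub, LinearMap.sub_apply]
      rw [hN ⁅b i, b j⁆, sub_eq_iff_eq_add] at h3
      have h4 := congrArg (pbwAct b (b k)) (hN (b i) (b j))
      rw [map_sub] at h4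
      rw [h3, h4]
      abel
    intro i j
    rcases lt_trichotomy i j with h | rfl | h
    · rw [← lie_skew, map_neg, LinearMap.neg_apply, main j i h, neg_sub]
    · simp
    · exact main i j h

attribute [local instance 100] LieRing.ofAssociativeRing

/-- The map from a Lie algebra over a field to its universal enveloping algebra has a linear
retraction which annihilates `1`. -/
theorem exists_retraction_enveloping (K L : Type*) [Field K] [LieRing L] [LieAlgebra K L] :
    ∃ e : UniversalEnvelopingAlgebra K L →ₗ[K] L, e 1 = 0 ∧
      ∀ x, e (UniversalEnvelopingAlgebra.ι K x) = x := by
  let b := Module.Basis.ofVectorSpace K L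
  -- Any linear order on the index set would do.
  let _ : LinearOrder (Module.Basis.ofVectorSpaceIndex K L) := by
    classical exact linearOrderOfSTO WellOrderingRel
  let φ : L →ₗ⁅K⁆ Module.End K (Multiset (Module.Basis.ofVectorSpaceIndex K L) →₀ K) :=
    { toLinearMap := pbwAct b
      map_lie' := fun {x y} => LinearMap.ext fun s => pbwAct_bracket b x y s }
  let pr : (Multiset (Module.Basis.ofVectorSpaceIndex K L) →₀ K) →ₗ[K] L :=
    b.repr.symm.toLinearMap ∘ₗ
      Finsupp.lcomapDomain (fun i => ({i} : Multiset _)) fun i j h => Multiset.singleton_inj.1 h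
  have h0 : pr (Finsupp.single 0 1) = 0 := by
    have : Finsupp.lcomapDomain (R := K) (M := K) (fun i => ({i} : Multiset _))
        (fun i j h => Multiset.singleton_inj.1 h) (Finsupp.single 0 1) =
        (0 : Module.Basis.ofVectorSpaceIndex K L →₀ K) := by
      ext i
      change Finsupp.single (0 : Multiset _) (1 : K) {i} = 0
      exact Finsupp.single_eq_of_ne (Multiset.singleton_ne_zero i)
    rw [LinearMap.comp_apply, this, map_zero]
  have h1 : ∀ i, pr (Finsupp.single {i} 1) = b i := fun i => by
    have : Finsupp.lcomapDomain (R := K) (M := K) (fun i => ({i} : Multiset _))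
        (fun i j h => Multiset.singleton_inj.1 h) (Finsupp.single {i} 1) =
        (Finsupp.single i 1 : Module.Basis.ofVectorSpaceIndex K L →₀ K) := by
      ext j
      change Finsupp.single ({i} : Multiset _) (1 : K) {j} = _
      by_cases h : i = j
      · subst h; simp
      · rw [Finsupp.single_eq_of_ne (Ne.symm h), Finsupp.single_eq_of_ne]
        exact fun h' => h (Multiset.singleton_inj.1 h').symm
    rw [LinearMap.comp_apply, this]
    exact b.repr_symm_single_one i
  -- The retraction sends `u` to the linear part of `u · 1`, where `1` is the empty monomial.
  refine ⟨pr ∘ₗ (LinearMap.applyₗ (Finsupp.single 0 1)) ∘ₗ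
    (UniversalEnvelopingAlgebra.lift K φ).toLinearMap, ?_, fun x => ?_⟩
  · simpa using h0
  · suffices h : pr ∘ₗ (pbwAct b).flip (Finsupp.single 0 1) = LinearMap.id by
      have := LinearMap.congr_fun h x
      have h2 : UniversalEnvelopingAlgebra.lift K φ (UniversalEnvelopingAlgebra.ι K x) =
          pbwAct b x := UniversalEnvelopingAlgebra.lift_ι_apply K φ x
      exact (congrArg (fun T : Module.End K _ => pr (T (Finsupp.single 0 1))) h2).trans this
    refine b.ext fun i => ?_
    rw [LinearMap.comp_apply, LinearMap.flip_apply, pbwAct_of_le b (by simp)]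
    exact h1 i

end PBW

/-! ### Exactness of the Koszul complex by a homotopy of Euler type -/

section KoszulExact

variable (K A : Type u) [Field K] [Ring A] [Algebra K A] [PoissonAlgebra K A]

/-- The span of the products of fewer than `n` elements of `A` in `U(A)`. -/
def uFil (n : ℕ) : Submodule K (UEnv K A) :=
  Submodule.span K {u | ∃ l : List A, l.length < n ∧ u = (l.map (uι K)).prod}

variable {K A}

/-- Counting fewer than `n` factors, rather than at most `n`, makes the bottom step zero, so
inductions on the filtration have a trivial base. -/
lemma uFil_zero : uFil K A 0 = ⊥ := by simp [uFil]

lemma prod_mem_uFil {l : List A} {n : ℕ} (h : l.length < n) :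
    (l.map (uι K)).prod ∈ uFil K A n := Submodule.subset_span ⟨l, h, rfl⟩

lemma one_mem_uFil (n : ℕ) : 1 ∈ uFil K A (n + 1) := prod_mem_uFil (l := []) (Nat.succ_pos n)

lemma uFil_mono {m n : ℕ} (h : m ≤ n) : uFil K A m ≤ uFil K A n :=
  Submodule.span_mono fun _ ⟨l, hl, hu⟩ => ⟨l, hl.trans_le h, hu⟩

lemma mul_mem_uFil {m n : ℕ} {u v : UEnv K A} (hu : u ∈ uFil K A m) (hv : v ∈ uFil K A n) :
    u * v ∈ uFil K A (m + n) := by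
  have := Submodule.mul_mem_mul hu hv
  rw [uFil, uFil, Submodule.span_mul_span] at this
  refine Submodule.span_mono ?_ this
  rintro _ ⟨_, ⟨l, hl, rfl⟩, _, ⟨l', hl', rfl⟩, rfl⟩
  exact ⟨l ++ l', by simp; omega, by simp⟩

lemma mul_uι_mem_uFil {n : ℕ} {u : UEnv K A} (hu : u ∈ uFil K A n) (x : A) :
    u * uι K x ∈ uFil K A (n + 1) := by
  induction hu using Submodule.span_induction with
  | mem u hu =>
    obtain ⟨l, hl, rfl⟩ := hu
    exact Submodule.subset_span ⟨l ++ [x], by simpa using hl, by simp⟩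
  | zero => simp
  | add s t _ _ hs ht => rw [add_mul]; exact add_mem hs ht
  | smul c s _ hs => rw [smul_mul_assoc]; exact Submodule.smul_mem _ _ hs

lemma exists_mem_uFil (u : UEnv K A) : ∃ n, u ∈ uFil K A n := by
  induction u using UEnv.induction K with
  | hs c =>
    rw [Algebra.algebraMap_eq_smul_one]
    exact ⟨1, Submodule.smul_mem _ _ (one_mem_uFil 0)⟩
  | hι x => exact ⟨2, Submodule.subset_span ⟨[x], by simp, by simp⟩⟩
  | ha u v hu hv =>
    obtain ⟨m, hm⟩ := hu
    obtain ⟨n, hn⟩ := hv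
    exact ⟨max m n, add_mem (uFil_mono (le_max_left _ _) hm) (uFil_mono (le_max_right _ _) hn)⟩
  | hm u v hu hv =>
    obtain ⟨m, hm⟩ := hu
    obtain ⟨n, hn⟩ := hv
    exact ⟨m + n, mul_mem_uFil hm hn⟩

/-- The twisted comultiplication `uD` is computed by appending letters on the right, hence an
induction peeling them off on that side. -/
lemma UEnv.induction_right {p : UEnv K A → Prop} (h1 : p 1)
    (hm : ∀ (u : UEnv K A) (x : A), p u → p (u * uι K x)) (ha : ∀ u v, p u → p v → p (u + v))
    (hs : ∀ (c : K) u, p u → p (c • u)) (u : UEnv K A) : p u := by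
  obtain ⟨n, hn⟩ := exists_mem_uFil u
  induction hn using Submodule.span_induction with
  | mem u hu =>
    obtain ⟨l, -, rfl⟩ := hu
    induction l using List.reverseRecOn with
    | nil => simpa using h1
    | append_singleton l x ih => simpa using hm _ x ih
  | zero => simpa using hs 0 1 h1
  | add s t _ _ hs ht => exact ha s t hs ht
  | smul c s _ h => exact hs c s h

variable (K A) in
/-- The comultiplication of `U(A)`. -/
def uΔ : UEnv K A →ₐ[K] UEnv K A ⊗[K] UEnv K A :=
  uLift K ((TensorProduct.mk K _ _).flip 1 ∘ₗ uι K + TensorProduct.mk K _ _ 1 ∘ₗ uι K)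
    fun x y => by
      simp [uι_bracket, mul_add, add_mul, TensorProduct.sub_tmul, TensorProduct.tmul_sub]
      abel

lemma uΔ_uι (x : A) : uΔ K A (uι K x) = uι K x ⊗ₜ 1 + 1 ⊗ₜ uι K x := by simp [uΔ]

section

variable {W : Type u} [AddCommGroup W] [Module K W]

/-- The map `u ↦ ∑ u₁ ⊗ f(u₂)`. -/
def uD (f : UEnv K A →ₗ[K] W) : UEnv K A →ₗ[K] UEnv K A ⊗[K] W :=
  f.lTensor _ ∘ₗ (uΔ K A).toLinearMap

lemma uD_one (f : UEnv K A →ₗ[K] W) : uD f 1 = 1 ⊗ₜ f 1 := by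
  simp [uD, Algebra.TensorProduct.one_def]

/-- In `Δ(ux) = Δ(u)(x ⊗ 1 + 1 ⊗ x)` the first summand multiplies the first factor and the second is
absorbed into `f`. -/
lemma uD_mul (f : UEnv K A →ₗ[K] W) (u : UEnv K A) (x : A) :
    uD f (u * uι K x) = (uRight K A x).rTensor W (uD f u) + uD (f ∘ₗ uRight K A x) u := by
  simp only [uD, LinearMap.comp_apply, AlgHom.toLinearMap_apply, map_mul, uΔ_uι]
  generalize uΔ K A u = t
  induction t using TensorProduct.induction_on with
  | zero => simp
  | add s t hs ht => simp only [add_mul, map_add, hs, ht]; abel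
  | tmul a b => simp [mul_add]

lemma uD_sub (f g : UEnv K A →ₗ[K] W) (u : UEnv K A) : uD (f - g) u = uD f u - uD g u := by
  simp [uD, LinearMap.lTensor_sub]

/-- The counit axiom `∑ u₁ ε(u₂) = u`, tensored with `w`. -/
lemma uD_counit (w : W) (u : UEnv K A) :
    uD ((uε K).toLinearMap.smulRight w) u = u ⊗ₜ w := by
  induction u using UEnv.induction_right with
  | h1 => simp [uD_one]
  | hm u x ih =>
    have : (uε K).toLinearMap.smulRight w ∘ₗ uRight K A x = 0 := by ext; simp
    rw [uD_mul, ih, this]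
    simp [uD]
  | ha u v hu hv => rw [map_add, hu, hv, TensorProduct.add_tmul]
  | hs c u hu => rw [map_smul, hu, TensorProduct.smul_tmul']

variable (K A W) in
/-- The filtration of `U(A) ⊗ W` induced by the one of `U(A)`. -/
def uFilT (n : ℕ) : Submodule K (UEnv K A ⊗[K] W) :=
  Submodule.map₂ (TensorProduct.mk K _ W) (uFil K A n) ⊤

lemma tmul_mem_uFilT {n : ℕ} {u : UEnv K A} (hu : u ∈ uFil K A n) (w : W) :
    u ⊗ₜ w ∈ uFilT K A W n := Submodule.apply_mem_map₂ _ hu Submodule.mem_top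

lemma uFilT_mono {m n : ℕ} (h : m ≤ n) : uFilT K A W m ≤ uFilT K A W n :=
  Submodule.map₂_le_map₂ (uFil_mono h) le_rfl

lemma map_mem_of_uFilT {V : Type u} [AddCommGroup V] [Module K V] {n : ℕ}
    (f : UEnv K A ⊗[K] W →ₗ[K] V) (S : Submodule K V)
    (h : ∀ u ∈ uFil K A n, ∀ w, f (u ⊗ₜ w) ∈ S) {z : UEnv K A ⊗[K] W} (hz : z ∈ uFilT K A W n) :
    f z ∈ S :=
  (Submodule.map₂_le.2 (fun u hu w _ => h u hu w) : uFilT K A W n ≤ S.comap f) hz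

lemma exists_mem_uFilT (z : UEnv K A ⊗[K] W) : ∃ n, z ∈ uFilT K A W n := by
  induction z using TensorProduct.induction_on with
  | zero => exact ⟨0, zero_mem _⟩
  | tmul u w => exact (exists_mem_uFil u).imp fun n hn => tmul_mem_uFilT hn w
  | add u v hu hv =>
    obtain ⟨m, hm⟩ := hu
    obtain ⟨n, hn⟩ := hv
    exact ⟨max m n, add_mem (uFilT_mono (le_max_left _ _) hm) (uFilT_mono (le_max_right _ _) hn)⟩

/-- The map `f(- x)` is split into `ε(-) f(x)`, which contributes `u ⊗ f(x)`, and a remainder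
vanishing at `1`, to which `uD_mem` applies. -/
lemma uD_mul' (f : UEnv K A →ₗ[K] W) (u : UEnv K A) (x : A) :
    uD f (u * uι K x) = (uRight K A x).rTensor W (uD f u) + u ⊗ₜ f (uι K x) +
      uD (f ∘ₗ uRight K A x - (uε K).toLinearMap.smulRight (f (uι K x))) u := by
  rw [uD_mul, uD_sub, uD_counit]
  abel

lemma rTensor_uRight_mem {n : ℕ} (x : A) {t : UEnv K A ⊗[K] W} (ht : t ∈ uFilT K A W n) :
    (uRight K A x).rTensor W t ∈ uFilT K A W (n + 1) :=
  map_mem_of_uFilT _ _ (fun _ hu w => tmul_mem_uFilT (mul_uι_mem_uFil hu x) w) ht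

/-- Since `f` kills `1`, at least one letter must go to the second tensor factor, so the first
factor has one letter fewer. -/
lemma uD_mem {f : UEnv K A →ₗ[K] W} (hf : f 1 = 0) {n : ℕ} {u : UEnv K A}
    (hu : u ∈ uFil K A (n + 1)) : uD f u ∈ uFilT K A W n := by
  -- All `f` are treated at once, because the remainder in `uD_mul'` is a different map.
  suffices h : ∀ (l : List A) (f : UEnv K A →ₗ[K] W), f 1 = 0 →
      uD f (l.map (uι K)).prod ∈ uFilT K A W l.length by
    refine (Submodule.span_le.2 ?_ : uFil K A (n + 1) ≤ (uFilT K A W n).comap (uD f)) hu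
    rintro _ ⟨l, hl, rfl⟩
    exact uFilT_mono (by omega) (h l f hf)
  intro l
  induction l using List.reverseRecOn with
  | nil => intro f hf; simp [uD_one, hf]
  | append_singleton l x ih =>
    intro f hf
    have hl : (l.map (uι K)).prod ∈ uFil K A (l.length + 1) := prod_mem_uFil (Nat.lt_succ_self _)
    rw [List.map_append, List.prod_append, List.map_singleton, List.prod_singleton, uD_mul',
      List.length_append, List.length_singleton]
    exact add_mem (add_mem (rTensor_uRight_mem x (ih f hf)) (tmul_mem_uFilT hl _))
      (uFilT_mono (Nat.le_succ _) (ih _ (by simp)))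

end

variable (K A) in
/-- The map `u ⊗ x ⊗ ω ↦ u ⊗ (x ∧ ω)`. -/
def kW (j : ℕ) : (UEnv K A ⊗[K] A) ⊗[K] ⋀[K]^j A →ₗ[K] UEnv K A ⊗[K] ⋀[K]^(j + 1) A :=
  (TensorProduct.lift (exteriorPower.alternatingMapLinearEquiv.toLinearMap ∘ₗ
    wedgeAlt K j)).lTensor _ ∘ₗ (TensorProduct.assoc K _ _ _).toLinearMap

lemma kW_tmul (j : ℕ) (u : UEnv K A) (x : A) (ω : ⋀[K]^j A) :
    kW K A j ((u ⊗ₜ x) ⊗ₜ ω) = ext1 K j x (u ⊗ₜ ω) := by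
  simp [kW, ext1]

lemma kW_mem {n j : ℕ} {t : UEnv K A ⊗[K] A} (ht : t ∈ uFilT K A A n) (ω : ⋀[K]^j A) :
    kW K A j (t ⊗ₜ ω) ∈ uFilT K A _ n :=
  map_mem_of_uFilT (kW K A j ∘ₗ (TensorProduct.mk K _ _).flip ω) _ (fun u hu x => by
    simpa [kW_tmul, ext1] using tmul_mem_uFilT hu _) ht

/-- The homotopy `u ⊗ ω ↦ ∑ u₁ ⊗ (e(u₂) ∧ ω)`. -/
def kH (e : UEnv K A →ₗ[K] A) (j : ℕ) :
    UEnv K A ⊗[K] ⋀[K]^j A →ₗ[K] UEnv K A ⊗[K] ⋀[K]^(j + 1) A :=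
  kW K A j ∘ₗ (uD e).rTensor _

lemma kH_tmul (e : UEnv K A →ₗ[K] A) (j : ℕ) (u : UEnv K A) (ω : ⋀[K]^j A) :
    kH e j (u ⊗ₜ ω) = kW K A j (uD e u ⊗ₜ ω) := rfl

lemma ext1_ext1 {N : Type u} [AddCommGroup N] [Module K N] (j : ℕ) (x y : A)
    (z : N ⊗[K] ⋀[K]^j A) :
    ext1 K (j + 1) x (ext1 K j y z) = - ext1 K (j + 1) y (ext1 K j x z) := by
  suffices h : ext1 K (N := N) (j + 1) x ∘ₗ ext1 K j y = - (ext1 K (j + 1) y ∘ₗ ext1 K j x) from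
    LinearMap.congr_fun h z
  refine ext_tmul fun n v => ?_
  simp only [LinearMap.comp_apply, LinearMap.neg_apply, ext1_tmul]
  rw [ιMulti_swap, TensorProduct.tmul_neg]

/-- The homotopy wedges its factor `e(u₂)` in front, and exchanging it with `x` costs a sign. -/
lemma kH_ext1 (e : UEnv K A →ₗ[K] A) (j : ℕ) (x : A) (z : UEnv K A ⊗[K] ⋀[K]^j A) :
    kH e (j + 1) (ext1 K j x z) = - ext1 K (j + 1) x (kH e j z) := by
  suffices h : ∀ (t : UEnv K A ⊗[K] A) (ω : ⋀[K]^j A),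
      kW K A (j + 1) (t ⊗ₜ exteriorPower.alternatingMapLinearEquiv (wedgeAlt K j x) ω) =
        - ext1 K (j + 1) x (kW K A j (t ⊗ₜ ω)) by
    induction z using TensorProduct.induction_on with
    | zero => simp
    | add u v hu hv => simp only [map_add, hu, hv]; abel
    | tmul u ω => exact h (uD e u) ω
  intro t ω
  induction t using TensorProduct.induction_on with
  | zero => simp
  | add u v hu hv => simp only [map_add, TensorProduct.add_tmul, hu, hv]; abel
  | tmul u y =>
    rw [kW_tmul, kW_tmul, ← ext1_ext1]
    rfl

/-- The operator `dh + hd` on the Koszul complex. -/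
def kL (e : UEnv K A →ₗ[K] A) : ∀ j : ℕ, Module.End K (UEnv K A ⊗[K] ⋀[K]^j A)
  | 0 => koszD K A 0 ∘ₗ kH e 0
  | j + 1 => koszD K A (j + 1) ∘ₗ kH e (j + 1) + kH e j ∘ₗ koszD K A j

/-- By Cartan's formula `ceD_ext1` for `d(x ∧ z)` and by `kH_ext1`, the operator `dh + hd` commutes
with `x ∧ -` up to the commutator of `theta` with `h`. This permits induction on the exterior
degree. -/
lemma kL_ext1 [CharZero K] (e : UEnv K A →ₗ[K] A) (j : ℕ) (x : A) (z : UEnv K A ⊗[K] ⋀[K]^j A) :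
    kL e (j + 1) (ext1 K j x z) = ext1 K j x (kL e j z) +
      (theta K (uRight K A) (j + 1) x (kH e j z) - kH e j (theta K (uRight K A) j x z)) := by
  cases j with
  | zero =>
    simp only [kL, LinearMap.add_apply, LinearMap.comp_apply, kH_ext1, koszD, map_neg, ceD_ext1,
      ceD_ext1_zero]
    abel
  | succ j =>
    simp only [kL, LinearMap.add_apply, LinearMap.comp_apply, kH_ext1, koszD, map_neg, ceD_ext1,
      map_sub, map_add]
    abel

lemma theta_kW (j : ℕ) (x : A) (t : UEnv K A ⊗[K] A) (ω : ⋀[K]^j A) :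
    theta K (uRight K A) (j + 1) x (kW K A j (t ⊗ₜ ω)) =
      kW K A j ((ad K x).lTensor _ t ⊗ₜ ω) +
      kW K A j (t ⊗ₜ exteriorPower.alternatingMapLinearEquiv (lieAlt K j x) ω) -
      kW K A j ((uRight K A x).rTensor _ t ⊗ₜ ω) := by
  induction t using TensorProduct.induction_on with
  | zero => simp
  | add u v hu hv => simp only [map_add, TensorProduct.add_tmul, hu, hv]; abel
  | tmul u y =>
    rw [kW_tmul, theta_ext1, LinearMap.lTensor_tmul, LinearMap.rTensor_tmul, kW_tmul, kW_tmul,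
      kW_tmul, add_sub_assoc, ← map_sub]
    rfl

/-- The two actions of `x` on `ω` cancel; what remains is the failure of `uD e` to be equivariant.
-/
lemma theta_kH (e : UEnv K A →ₗ[K] A) (j : ℕ) (x : A) (u : UEnv K A) (ω : ⋀[K]^j A) :
    theta K (uRight K A) (j + 1) x (kH e j (u ⊗ₜ ω)) -
      kH e j (theta K (uRight K A) j x (u ⊗ₜ ω)) =
    kW K A j ((ad K x).lTensor _ (uD e u) ⊗ₜ ω) +
      kW K A j ((uD e (u * uι K x) - (uRight K A x).rTensor _ (uD e u)) ⊗ₜ ω) := by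
  have h : theta K (uRight K A) j x (u ⊗ₜ ω) =
      u ⊗ₜ exteriorPower.alternatingMapLinearEquiv (lieAlt K j x) ω - (u * uι K x) ⊗ₜ ω := rfl
  rw [h, map_sub, kH_tmul, kH_tmul, kH_tmul, theta_kW, TensorProduct.sub_tmul, map_sub]
  abel

variable {e : UEnv K A →ₗ[K] A}

/-- The term `u ⊗ e(x) = u ⊗ x` of `uD_mul'` contributes `x ∧ (u ⊗ ω)`, and all others lie lower. So
each exterior factor adds `1` to the eigenvalue of `dh + hd`. -/
lemma theta_kH_mem (he1 : e 1 = 0) (he : ∀ x, e (uι K x) = x) {n : ℕ} (j : ℕ) (x : A) {u : UEnv K A}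
    (hu : u ∈ uFil K A (n + 1)) (ω : ⋀[K]^j A) :
    theta K (uRight K A) (j + 1) x (kH e j (u ⊗ₜ ω)) -
      kH e j (theta K (uRight K A) j x (u ⊗ₜ ω)) - ext1 K j x (u ⊗ₜ ω) ∈ uFilT K A _ n := by
  rw [theta_kH, uD_mul', he, add_assoc, add_sub_cancel_left, TensorProduct.add_tmul, map_add,
    kW_tmul, add_left_comm, add_sub_cancel_left]
  refine add_mem (kW_mem ?_ ω) (kW_mem (uD_mem (by simp [he]) hu) ω)
  exact map_mem_of_uFilT _ _ (fun _ hu w => tmul_mem_uFilT hu _) (uD_mem he1 hu)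

variable (K A) in
/-- The map `u ⊗ x ↦ ux`. -/
def uMulι : UEnv K A ⊗[K] A →ₗ[K] UEnv K A := LinearMap.mul' K _ ∘ₗ (uι K).lTensor _

lemma uMulι_mem {n : ℕ} {t : UEnv K A ⊗[K] A} (ht : t ∈ uFilT K A A n) :
    uMulι K A t ∈ uFil K A (n + 1) :=
  map_mem_of_uFilT _ _ (fun _ hu x => by simpa [uMulι] using mul_uι_mem_uFil hu x) ht

lemma uMulι_uRight (x : A) (t : UEnv K A ⊗[K] A) :
    uMulι K A ((uRight K A x).rTensor _ t) =
      uMulι K A t * uι K x + uMulι K A ((ad K x).lTensor _ t) := by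
  induction t using TensorProduct.induction_on with
  | zero => simp
  | add u v hu hv => simp only [map_add, add_mul, hu, hv]; abel
  | tmul u y => simp [uMulι, uι_bracket, mul_sub, mul_assoc]

/-- Euler's identity: `∑ u₁ e(u₂)` extracts each letter of a product once and puts it back at the
right end, which changes the product only by lower terms. The sum therefore counts the letters. -/
lemma uMulι_uD_mem (he1 : e 1 = 0) (he : ∀ x, e (uι K x) = x) {n : ℕ} {u : UEnv K A}
    (hu : u ∈ uFil K A (n + 1)) : uMulι K A (uD e u) - (n : K) • u ∈ uFil K A n := by
  suffices h : ∀ l : List A, uMulι K A (uD e (l.map (uι K)).prod) -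
      (l.length : K) • (l.map (uι K)).prod ∈ uFil K A l.length by
    refine (Submodule.span_le.2 ?_ : uFil K A (n + 1) ≤ (uFil K A n).comap
      (uMulι K A ∘ₗ uD e - (n : K) • LinearMap.id)) hu
    rintro _ ⟨l, hl, rfl⟩
    change uMulι K A (uD e (l.map (uι K)).prod) - (n : K) • (l.map (uι K)).prod ∈ uFil K A n
    -- A product of fewer than `n` letters already lies in `uFil K A n`, so replacing its
    -- coefficient by `n` does no harm.
    rcases Nat.lt_succ_iff_lt_or_eq.1 hl with h' | rfl
    · rw [← sub_add_sub_cancel _ ((l.length : K) • (l.map (uι K)).prod), ← sub_smul]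
      exact add_mem (uFil_mono h'.le (h l)) (Submodule.smul_mem _ _ (prod_mem_uFil h'))
    · exact h l
  intro l
  induction l using List.reverseRecOn with
  | nil => simp [uD_one, he1]
  | append_singleton l x ih =>
    have hl : (l.map (uι K)).prod ∈ uFil K A (l.length + 1) := prod_mem_uFil (Nat.lt_succ_self _)
    rw [List.map_append, List.prod_append, List.map_singleton, List.prod_singleton,
      List.length_append, List.length_singleton]
    generalize (l.map (uι K)).prod = u at ih hl
    have h1 : uMulι K A (u ⊗ₜ[K] x) = u * uι K x := by simp [uMulι]
    have h2 : uMulι K A (uD e (u * uι K x)) - ((l.length + 1 : ℕ) : K) • (u * uι K x) =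
        (uMulι K A (uD e u) - (l.length : K) • u) * uι K x +
        (uMulι K A ((ad K x).lTensor _ (uD e u)) +
        uMulι K A (uD (e ∘ₗ uRight K A x - (uε K).toLinearMap.smulRight (e (uι K x))) u)) := by
      rw [uD_mul', map_add, map_add, uMulι_uRight, he, h1, Nat.cast_add, Nat.cast_one, add_smul,
        one_smul, sub_mul, smul_mul_assoc]
      abel
    rw [h2]
    refine add_mem (mul_uι_mem_uFil ih x) (add_mem (uMulι_mem ?_) (uMulι_mem ?_))
    · exact map_mem_of_uFilT _ _ (fun _ hu w => tmul_mem_uFilT hu _) (uD_mem he1 hl)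
    · exact uD_mem (by simp) hl

lemma koszD_kW (t : UEnv K A ⊗[K] A) (ω : ⋀[K]^0 A) :
    koszD K A 0 (kW K A 0 (t ⊗ₜ ω)) = uMulι K A t ⊗ₜ ω := by
  induction t using TensorProduct.induction_on with
  | zero => simp
  | add u v hu hv => simp only [map_add, TensorProduct.add_tmul, hu, hv]
  | tmul u y =>
    rw [kW_tmul, koszD, ceD_ext1_zero]
    simp [theta, lieAlt, uMulι]

/-- Modulo lower terms `dh + hd` is the total degree. In the induction on `j`, the letter count
`uMulι_uD_mem` is the base, and `theta_kH_mem` adds one per exterior factor. -/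
lemma kL_mem [CharZero K] (he1 : e 1 = 0) (he : ∀ x, e (uι K x) = x) (j : ℕ) {n : ℕ}
    {z : UEnv K A ⊗[K] ⋀[K]^j A} (hz : z ∈ uFilT K A _ (n + 1)) :
    kL e j z - ((n + j : ℕ) : K) • z ∈ uFilT K A _ n := by
  refine map_mem_of_uFilT (kL e j - ((n + j : ℕ) : K) • LinearMap.id) _ (fun u hu ω => ?_) hz
  clear hz z
  induction j with
  | zero =>
    change koszD K A 0 (kW K A 0 (uD e u ⊗ₜ ω)) - ((n + 0 : ℕ) : K) • u ⊗ₜ ω ∈ _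
    rw [koszD_kW, TensorProduct.smul_tmul', ← TensorProduct.sub_tmul]
    exact tmul_mem_uFilT (uMulι_uD_mem he1 he hu) ω
  | succ j ih =>
    have hω : ω ∈ Submodule.span K (Set.range (exteriorPower.ιMulti K (M := A) (j + 1))) := by
      rw [exteriorPower.ιMulti_span]; trivial
    induction hω using Submodule.span_induction with
    | mem ω hω =>
      obtain ⟨v, rfl⟩ := hω
      have hv : u ⊗ₜ exteriorPower.ιMulti K (j + 1) v =
          ext1 K j (v 0) (u ⊗ₜ exteriorPower.ιMulti K j (Fin.tail v)) := by
        rw [ext1_tmul, Fin.cons_self_tail]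
      have h1 := ih (exteriorPower.ιMulti K j (Fin.tail v))
      rw [hv]
      generalize exteriorPower.ιMulti K j (Fin.tail v) = ω at h1
      have h2 := theta_kH_mem he1 he j (v 0) hu ω
      have h3 : kL e (j + 1) (ext1 K j (v 0) (u ⊗ₜ ω)) -
          ((n + (j + 1) : ℕ) : K) • ext1 K j (v 0) (u ⊗ₜ ω) =
          ext1 K j (v 0) (kL e j (u ⊗ₜ ω) - ((n + j : ℕ) : K) • (u ⊗ₜ ω)) +
          (theta K (uRight K A) (j + 1) (v 0) (kH e j (u ⊗ₜ ω)) -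
          kH e j (theta K (uRight K A) j (v 0) (u ⊗ₜ ω)) - ext1 K j (v 0) (u ⊗ₜ ω)) := by
        rw [kL_ext1, map_sub, map_smul, ← add_assoc n j 1, Nat.cast_add (n + j), Nat.cast_one,
          add_smul, one_smul]
        abel
      change kL e (j + 1) (ext1 K j (v 0) (u ⊗ₜ ω)) -
          ((n + (j + 1) : ℕ) : K) • ext1 K j (v 0) (u ⊗ₜ ω) ∈ _
      rw [h3]
      exact add_mem (map_mem_of_uFilT _ _ (fun u hu ω => tmul_mem_uFilT hu _) h1) h2
    | zero => simp
    | add s t _ _ hs ht => rw [TensorProduct.tmul_add, map_add]; exact add_mem hs ht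
    | smul c s _ hs => rw [TensorProduct.tmul_smul, map_smul]; exact Submodule.smul_mem _ _ hs

variable (K A) in
lemma exists_retraction_uι : ∃ e : UEnv K A →ₗ[K] A, e 1 = 0 ∧ ∀ x, e (uι K x) = x :=
  exists_retraction_enveloping K (LieOf K A)

lemma uFilT_zero (W : Type u) [AddCommGroup W] [Module K W] : uFilT K A W 0 = ⊥ := by
  simp [uFilT, uFil_zero]

/-- The Koszul complex is exact in positive degrees. -/
lemma koszD_exact [CharZero K] (j : ℕ) :
    Function.Exact (koszD K A (j + 1)) (koszD K A j) := by
  obtain ⟨e, he1, he⟩ := exists_retraction_uι K A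
  refine LinearMap.exact_iff.2 (le_antisymm ?_ ?_)
  · intro z hz
    obtain ⟨n, hn⟩ := exists_mem_uFilT z
    induction n generalizing z with
    | zero =>
      rw [uFilT_zero, Submodule.mem_bot] at hn
      rw [hn]; exact zero_mem _
    | succ n ih =>
      have hz' : koszD K A j z = 0 := hz
      -- For a cycle `z`, the difference of `dhz` and `(n + j + 1)z` is a cycle lower in the
      -- filtration, hence a boundary; then so is `z`, after division by the integer.
      have h1 := ih ?_ (kL_mem he1 he (j + 1) hn)
      · have hc : ((n + (j + 1) : ℕ) : K) ≠ 0 := Nat.cast_ne_zero.2 (by omega)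
        have h2 : kL e (j + 1) z ∈ LinearMap.range (koszD K A (j + 1)) :=
          ⟨kH e (j + 1) z, by simp [kL, hz']⟩
        have h3 := sub_mem h2 h1
        rw [sub_sub_cancel] at h3
        exact (Submodule.smul_mem_iff _ hc).1 h3
      · change koszD K A j _ = 0
        simp [kL, hz', koszD_koszD]
  · rintro _ ⟨y, rfl⟩
    exact koszD_koszD j y

/-- In exterior degree zero the eigenvalue `n` vanishes on the scalars `1 ⊗ ∧⁰`. There the
augmentation is injective, and this replaces the division. -/
lemma koszAug_exact [CharZero K] : Function.Exact (koszD K A 0) (koszAug K A) := by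
  obtain ⟨e, he1, he⟩ := exists_retraction_uι K A
  refine LinearMap.exact_iff.2 (le_antisymm ?_ ?_)
  · intro z hz
    obtain ⟨n, hn⟩ := exists_mem_uFilT z
    induction n generalizing z with
    | zero =>
      rw [uFilT_zero, Submodule.mem_bot] at hn
      rw [hn]; exact zero_mem _
    | succ n ih =>
      have hz' : koszAug K A z = 0 := hz
      rcases Nat.eq_zero_or_pos n with rfl | hpos
      · have : ∃ ω : ⋀[K]^0 A, z = 1 ⊗ₜ ω := by
          refine (Submodule.map₂_le.2 ?_ : uFilT K A _ 1 ≤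
            LinearMap.range (TensorProduct.mk K (UEnv K A) (⋀[K]^0 A) 1)) hn |>.imp
              fun ω h => h.symm
          intro u hu ω _
          refine (Submodule.span_le.2 ?_ : uFil K A 1 ≤
            (LinearMap.range (TensorProduct.mk K (UEnv K A) (⋀[K]^0 A) 1)).comap
            ((TensorProduct.mk K _ _).flip ω)) hu
          rintro _ ⟨l, hl, rfl⟩
          obtain rfl : l = [] := by simpa using hl
          exact ⟨ω, rfl⟩
        obtain ⟨ω, rfl⟩ := this
        have : exteriorPower.zeroEquiv K A ω = 0 := by simpa [koszAug] using hz'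
        rw [(LinearEquiv.map_eq_zero_iff _).1 this, TensorProduct.tmul_zero]
        exact zero_mem _
      · have h1 := ih ?_ (kL_mem he1 he 0 hn)
        · have hc : ((n + 0 : ℕ) : K) ≠ 0 := Nat.cast_ne_zero.2 (by omega)
          have h2 : kL e 0 z ∈ LinearMap.range (koszD K A 0) := ⟨kH e 0 z, rfl⟩
          have h3 := sub_mem h2 h1
          rw [sub_sub_cancel] at h3
          exact (Submodule.smul_mem_iff _ hc).1 h3
        · change koszAug K A _ = 0
          simp [kL, hz', koszAug_koszD]
  · rintro _ ⟨y, rfl⟩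
    exact koszAug_koszD y

lemma koszAug_surjective : Function.Surjective (koszAug K A) := fun c =>
  ⟨algebraMap K _ c ⊗ₜ (exteriorPower.zeroEquiv K A).symm 1, by simp [koszAug]⟩

end KoszulExact

/-! ### Contraction of the bar complex -/

section BarExact

variable (K A : Type u) [Field K] [Ring A] [Algebra K A]

/-- The map `a ⊗ θ ↦ a ⊗ θ` from `A ⊗ Aᵐ` to `Aᵐ⁺¹`. -/
def tcons (m : ℕ) : A →ₗ[K] ⨂[K]^m A →ₗ[K] ⨂[K]^(m + 1) A :=
  PiTensorProduct.lift.toLinearMap ∘ₗ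
    (PiTensorProduct.tprod K (s := fun _ : Fin (m + 1) => A)).curryLeft

/-- The homotopy `a ⊗ θ ⊗ b ↦ 1 ⊗ a ⊗ θ ⊗ b` of the bar resolution. -/
def barS (m : ℕ) : Env K A ⊗[K] ⨂[K]^m A →ₗ[K] Env K A ⊗[K] ⨂[K]^(m + 1) A :=
  TensorProduct.lift (TensorProduct.lift (LinearMap.mk₂ K
    (fun a b => TensorProduct.mk K (Env K A) (⨂[K]^(m + 1) A) (1 ⊗ₜ b) ∘ₗ tcons K A m a)
    (fun a a' b => by ext; simp [TensorProduct.tmul_add])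
    (fun c a b => by ext; simp)
    (fun a b b' => by ext; simp [TensorProduct.tmul_add, TensorProduct.add_tmul])
    (fun c a b => by ext; simp [TensorProduct.smul_tmul'])))

variable {K A}

lemma barS_tmul (m : ℕ) (a : A) (b : Aᵐᵒᵖ) (v : Fin m → A) :
    barS K A m ((a ⊗ₜ b) ⊗ₜ PiTensorProduct.tprod K v) =
      (1 ⊗ₜ b) ⊗ₜ PiTensorProduct.tprod K (Fin.cons a v : Fin (m + 1) → A) := by
  simp [barS, tcons]

lemma contractNth_zero_cons {m : ℕ} (a : A) (v : Fin (m + 1) → A) :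
    Fin.contractNth 0 (· * ·) (Fin.cons a v : Fin (m + 2) → A) =
      Fin.cons (a * v 0) (Fin.tail v) := by
  ext i
  cases i using Fin.cases with
  | zero => simp [Fin.contractNth]
  | succ i => simp [Fin.contractNth, Fin.tail]

lemma contractNth_succ_cons {m : ℕ} (k : Fin (m + 1)) (a : A) (v : Fin (m + 1) → A) :
    Fin.contractNth k.succ (· * ·) (Fin.cons a v : Fin (m + 2) → A) =
      Fin.cons a (Fin.contractNth k (· * ·) v) := by
  ext i
  cases i using Fin.cases with
  | zero => simp [Fin.contractNth]
  | succ i => simp [Fin.contractNth]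

lemma init_cons {m : ℕ} (a : A) (v : Fin (m + 1) → A) :
    Fin.init (Fin.cons a v : Fin (m + 2) → A) = Fin.cons a (Fin.init v) := by
  ext i
  cases i using Fin.cases with
  | zero => simp [Fin.init]
  | succ i =>
    rw [Fin.cons_succ]
    change (Fin.cons a v : Fin (m + 2) → A) (i.castSucc.succ) = _
    rw [Fin.cons_succ]; rfl

/-- Prefixing `1` makes the first face the identity and moves every face of `z` one position
further, hence with the opposite sign. -/
lemma barD_barS (m : ℕ) (z : Env K A ⊗[K] ⨂[K]^(m + 1) A) :
    barD K A (m + 1) (barS K A (m + 1) z) + barS K A m (barD K A m z) = z := by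
  suffices h : barD K A (m + 1) ∘ₗ barS K A (m + 1) + barS K A m ∘ₗ barD K A m = LinearMap.id from
    LinearMap.congr_fun h z
  apply TensorProduct.ext
  apply TensorProduct.ext'
  intro a b
  ext v
  change hb (AlgHom.id K (Env K A)) (m + 1) (barS K A (m + 1) ((a ⊗ₜ b) ⊗ₜ _)) +
    barS K A m (hb (AlgHom.id K (Env K A)) m ((a ⊗ₜ b) ⊗ₜ _)) = (a ⊗ₜ b) ⊗ₜ _
  rw [barS_tmul, hb_tmul, hb_tmul, Fin.sum_univ_succ]
  have hl : (Fin.cons a v : Fin (m + 2) → A) (Fin.last (m + 1)) = v (Fin.last m) := by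
    rw [← Fin.succ_last, Fin.cons_succ]
  simp only [inL_apply, inR_apply, AlgHom.id_apply, Algebra.TensorProduct.tmul_mul_tmul, one_mul,
    mul_one, Fin.cons_zero, Fin.tail_cons, map_add, map_sum, map_zsmul, barS_tmul,
    Fin.castSucc_zero, contractNth_zero_cons, ← Fin.succ_castSucc, contractNth_succ_cons,
    init_cons, hl]
  have hs : ∀ k : Fin m, ∀ x : Env K A ⊗[K] ⨂[K]^(m + 1) A,
      (-1 : ℤ) ^ ((k.succ : ℕ) + 1) • x = - ((-1 : ℤ) ^ ((k : ℕ) + 1) • x) := fun k x => by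
    rw [Fin.val_succ, pow_succ, mul_neg_one, neg_smul]
  rw [Finset.sum_congr rfl fun k _ => hs k _, Finset.sum_neg_distrib, pow_succ _ (m + 1),
    mul_neg_one, neg_smul, Fin.val_zero, zero_add, pow_one, neg_smul, one_smul]
  abel

lemma barD_exact (m : ℕ) : Function.Exact (barD K A (m + 1)) (barD K A m) := fun z =>
  ⟨fun h => ⟨barS K A (m + 1) z, by
    have := barD_barS m z
    rwa [h, map_zero, add_zero] at this⟩,
  by rintro ⟨y, rfl⟩; exact hb_hb _ m y⟩

end BarExact

/-! ### Exactness of total complexes and a criterion for resolutions -/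

section TotExact

namespace Bicomplex

variable {R : Type u} [Ring R] (B : Bicomplex R)

/-- The projection of the total complex to `X i j`. -/
def proj (i j n : ℕ) (h : i + j = n) : B.totX n →ₗ[R] B.X i j :=
  DirectSum.component R {p : ℕ × ℕ // p.1 + p.2 = n} (fun p => B.X p.1.1 p.1.2) ⟨(i, j), h⟩

lemma proj_incl_self (i j n : ℕ) (h : i + j = n) (x : B.X i j) :
    B.proj i j n h (B.incl i j n h x) = x :=
  DirectSum.component.lof_self (R := R) (ι := {p : ℕ × ℕ // p.1 + p.2 = n})
    (M := fun p => B.X p.1.1 p.1.2) ⟨(i, j), h⟩ x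

lemma proj_incl_of_ne (i j i' j' n : ℕ) (h : i + j = n) (h' : i' + j' = n) (hj : j ≠ j')
    (x : B.X i' j') : B.proj i j n h (B.incl i' j' n h' x) = 0 :=
  (DirectSum.component.of (R := R) (ι := {p : ℕ × ℕ // p.1 + p.2 = n})
    (M := fun p => B.X p.1.1 p.1.2) ⟨(i, j), h⟩ ⟨(i', j'), h'⟩ x).trans
    (dif_neg fun e => hj (congrArg (fun p => p.1.2) e).symm)

lemma totX_ext {n : ℕ} {z z' : B.totX n}
    (h : ∀ i j (hij : i + j = n), B.proj i j n hij z = B.proj i j n hij z') : z = z' :=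
  DirectSum.ext_component R fun p => h p.1.1 p.1.2 p.2

lemma proj_totD (i j n : ℕ) (h : i + j = n) (z : B.totX (n + 1)) :
    B.proj i j n h (B.totD n z) = (B.dH i j).hom (B.proj i (j + 1) (n + 1) (by omega) z) +
      (B.dV i j).hom (B.proj (i + 1) j (n + 1) (by omega) z) := by
  suffices e : B.proj i j n h ∘ₗ B.totD n = (B.dH i j).hom ∘ₗ B.proj i (j + 1) (n + 1) (by omega) +
      (B.dV i j).hom ∘ₗ B.proj (i + 1) j (n + 1) (by omega) from LinearMap.congr_fun e z
  refine B.totX_hom_ext fun i' j' h' x => ?_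
  simp only [LinearMap.comp_apply, LinearMap.add_apply, totD_incl, map_add]
  congr 1
  · cases j' with
    | zero =>
      rw [proj_incl_of_ne _ _ _ _ _ _ _ _ (Nat.succ_ne_zero j), map_zero, totH]
      exact map_zero _
    | succ j' =>
      by_cases e : j = j'
      · subst e
        obtain rfl : i = i' := by omega
        rw [proj_incl_self]
        exact B.proj_incl_self _ _ _ _ _
      · rw [proj_incl_of_ne _ _ _ _ _ _ _ _ (by omega), map_zero]
        exact B.proj_incl_of_ne _ _ _ _ _ _ _ e _
  · cases i' with
    | zero =>
      rw [proj_incl_of_ne _ _ _ _ _ _ _ _ (by omega), map_zero, totV]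
      exact map_zero _
    | succ i' =>
      by_cases e : j = j'
      · subst e
        obtain rfl : i = i' := by omega
        rw [proj_incl_self]
        exact B.proj_incl_self _ _ _ _ _
      · rw [proj_incl_of_ne _ _ _ _ _ _ _ _ e, map_zero]
        exact B.proj_incl_of_ne _ _ _ _ _ _ _ e _

variable {B}

/-- The total complex of a bicomplex with exact rows is exact in positive degrees if the complex
of cokernels of its rows is. -/
lemma totD_exact (hH : ∀ i j, Function.Exact (B.dH i (j + 1)).hom (B.dH i j).hom)
    (hV : ∀ i (x : B.X (i + 1) 0), (B.dV i 0).hom x ∈ LinearMap.range (B.dH i 0).hom →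
      x ∈ LinearMap.range (B.dV (i + 1) 0).hom ⊔ LinearMap.range (B.dH (i + 1) 0).hom) (n : ℕ) :
    Function.Exact (B.totD (n + 1)) (B.totD n) := by
  refine LinearMap.exact_iff.2 (le_antisymm (fun z hz => ?_) ?_)
  swap
  · rintro _ ⟨y, rfl⟩
    exact LinearMap.congr_fun (B.totD_totD n) y
  -- Columns are cleared from left to right: `z` vanishes in the columns `j < s`, and a boundary is
  -- subtracted to clear column `s`. The number `k` counts the remaining columns `s, …, n + 1`.
  suffices H : ∀ k s : ℕ, s + k = n + 2 → ∀ z : B.totX (n + 1), B.totD n z = 0 →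
      (∀ i j (hij : i + j = n + 1), j < s → B.proj i j (n + 1) hij z = 0) →
      z ∈ LinearMap.range (B.totD (n + 1)) from
    H (n + 2) 0 (zero_add _) z hz fun i j _ hj => absurd hj (Nat.not_lt_zero j)
  clear hz z
  intro k
  induction k with
  | zero =>
    intro s hs z _ h
    have : z = 0 := B.totX_ext fun i j hij => by rw [h i j hij (by omega), map_zero]
    rw [this]; exact zero_mem _
  | succ k ih =>
    intro s hs z hz h
    obtain ⟨y, hy⟩ : ∃ y : B.totX (n + 2), ∀ i j (hij : i + j = n + 1), j ≤ s →
        B.proj i j (n + 1) hij (B.totD (n + 1) y) = B.proj i j (n + 1) hij z := by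
      cases s with
      | zero =>
        -- The component of `dz = 0` at `(n, 0)` puts the vertical image of the component of `z` at
        -- `(n + 1, 0)` into the range of the horizontal differential, so `hV` applies.
        have h1 := B.proj_totD n 0 n rfl z
        rw [hz, map_zero] at h1
        have h2 := hV n (B.proj (n + 1) 0 (n + 1) rfl z)
          ⟨- B.proj n 1 (n + 1) rfl z, by rw [map_neg, neg_eq_iff_add_eq_zero]; exact h1.symm⟩
        obtain ⟨_, ⟨v, rfl⟩, _, ⟨w, rfl⟩, hvw⟩ := Submodule.mem_sup.1 h2
        refine ⟨B.incl (n + 2) 0 (n + 2) rfl v + B.incl (n + 1) 1 (n + 2) rfl w,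
          fun i j hij hj => ?_⟩
        obtain rfl : j = 0 := by omega
        obtain rfl : i = n + 1 := by omega
        have e1 : B.proj (n + 1) 1 (n + 2) rfl
            (B.incl (n + 2) 0 (n + 2) rfl v + B.incl (n + 1) 1 (n + 2) rfl w) = w := by
          rw [map_add, proj_incl_self, proj_incl_of_ne _ _ _ _ _ _ _ _ (by omega)]
          exact zero_add w
        have e2 : B.proj (n + 2) 0 (n + 2) rfl
            (B.incl (n + 2) 0 (n + 2) rfl v + B.incl (n + 1) 1 (n + 2) rfl w) = v := by
          rw [map_add, proj_incl_self, proj_incl_of_ne _ _ _ _ _ _ _ _ (by omega)]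
          exact add_zero v
        rw [proj_totD, ← hvw, e1, e2]
        exact add_comm _ _
      | succ s =>
        obtain ⟨r, rfl⟩ : ∃ r, n = r + s := ⟨n - s, by omega⟩
        -- Column `s` of `z` is already zero, so `dz = 0` at `(r, s)` says that the component in
        -- column `s + 1` is a cycle of its row. A preimage `w` in column `s + 2` leaves the columns
        -- up to `s` untouched.
        have h1 := B.proj_totD r s (r + s) rfl z
        rw [hz, map_zero, h (r + 1) s (by omega) (Nat.lt_succ_self s), map_zero, add_zero] at h1
        obtain ⟨w, hw⟩ := (hH r s _).1 h1.symm
        refine ⟨B.incl r (s + 2) _ (by omega) w, fun i j hij hj => ?_⟩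
        rw [proj_totD, B.proj_incl_of_ne (i + 1) j _ _ _ _ _ (by omega), map_zero, add_zero]
        rcases Nat.lt_or_eq_of_le hj with hj | rfl
        · rw [h i j hij hj, proj_incl_of_ne _ _ _ _ _ _ _ _ (by omega), map_zero]
        · obtain rfl : r = i := by omega
          rw [proj_incl_self, hw]
    have h3 := ih (s + 1) (by omega) (z - B.totD (n + 1) y) (by
      rw [map_sub, hz, zero_sub, neg_eq_zero]
      exact LinearMap.congr_fun (B.totD_totD n) y) fun i j hij hj => by
        rw [map_sub, hy i j hij (by omega), sub_self]
    rw [← sub_add_cancel z (B.totD (n + 1) y)]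
    exact add_mem h3 ⟨y, rfl⟩

end Bicomplex

/-- The target has no homology in positive degrees, and in degree zero the condition is exactness of
`T₁ → T₀ → M → 0`. -/
lemma quasiIso_toSingle₀ {R : Type u} [Ring R] {T : ChainComplex (ModuleCat.{u} R) ℕ}
    {M : ModuleCat.{u} R} (ε : T.X 0 ⟶ M) (w : T.d 1 0 ≫ ε = 0)
    (h : ∀ n, Function.Exact (T.d (n + 2) (n + 1)).hom (T.d (n + 1) n).hom)
    (h0 : ∀ x, ε.hom x = 0 → ∃ y, (T.d 1 0).hom y = x) (hs : Function.Surjective ε.hom) :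
    QuasiIso ((ChainComplex.toSingle₀Equiv T M).symm ⟨ε, w⟩) := by
  refine ⟨fun n => ?_⟩
  cases n with
  | zero =>
    have e : ((ChainComplex.toSingle₀Equiv T M).symm ⟨ε, w⟩).f 0 = ε :=
      ChainComplex.toSingle₀Equiv_symm_apply_f_zero ε w
    rw [ChainComplex.quasiIsoAt₀_iff, ShortComplex.quasiIso_iff_of_zeros']
    · constructor
      · rw [ShortComplex.moduleCat_exact_iff]
        intro x hx
        exact h0 x ((congrArg (fun φ => φ.hom x) e).symm.trans hx)
      · change Epi (((ChainComplex.toSingle₀Equiv T M).symm ⟨ε, w⟩).f 0)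
        rw [e]
        exact (ModuleCat.epi_iff_surjective ε).2 hs
    · exact T.shape 0 0 (by simp)
    · exact HomologicalComplex.single_obj_d (ComplexShape.down ℕ) 0 M 1 0
    · exact HomologicalComplex.single_obj_d (ComplexShape.down ℕ) 0 M 0 0
  | succ n =>
    rw [quasiIsoAt_iff_exactAt' _ _ (ChainComplex.exactAt_succ_single_obj _ _),
      HomologicalComplex.exactAt_iff' _ (n + 2) (n + 1) n (by simp) (by simp),
      ShortComplex.ShortExact.moduleCat_exact_iff_function_exact]
    exact h n

end TotExact

/-! ### The complexes `T''` and `T'` are resolutions -/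

section Resolutions

variable (K A : Type u) [Field K] [CharZero K] [Ring A] [Algebra K A] [PoissonAlgebra K A]

variable {K A}

/-- Exactness is a question about vector spaces, and `V` is flat over `K`, so the Koszul resolution
of `K` stays exact after tensoring with `V`. -/
lemma aug_exact {V : Type u} [AddCommGroup V] [Module K V] (r : QRep K A V) :
    Function.Exact (r.homL (kosz K A 1) (kosz K A 0) (koszD K A 0) (koszD_act 0)).hom
      r.aug.hom := by
  have h := Module.Flat.lTensor_exact (R := K) V (koszAug_exact (K := K) (A := A))
  intro z
  refine Iff.trans ?_ (h z)
  exact (TensorProduct.rid K V).map_eq_zero_iff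

lemma aug_surjective {V : Type u} [AddCommGroup V] [Module K V] (r : QRep K A V) :
    Function.Surjective r.aug.hom :=
  (TensorProduct.rid K V).surjective.comp (LinearMap.lTensor_surjective V koszAug_surjective)

lemma homL_exact {V : Type u} [AddCommGroup V] [Module K V] (r : QRep K A V) (j : ℕ) :
    Function.Exact
      (r.homL (kosz K A (j + 2)) (kosz K A (j + 1)) (koszD K A (j + 1)) (koszD_act (j + 1))).hom
      (r.homL (kosz K A (j + 1)) (kosz K A j) (koszD K A j) (koszD_act j)).hom :=
  Module.Flat.lTensor_exact (R := K) V (koszD_exact j)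

variable (K A) in
lemma quasiIso_T2aug : QuasiIso (T2aug K A) := by
  refine quasiIso_toSingle₀ _ _ (fun n => ?_) (fun x hx => ?_) (aug_surjective _)
  · rw [T2_d, T2_d]
    exact homL_exact _ n
  · rw [T2_d]
    exact (aug_exact _ x).1 hx

lemma aug_barD (m : ℕ) (z : (Env K A ⊗[K] ⨂[K]^(m + 1) A) ⊗[K] (UEnv K A ⊗[K] ⋀[K]^0 A)) :
    (barRep K A m).aug.hom ((barD K A m).rTensor _ z) =
      barD K A m ((barRep K A (m + 1)).aug.hom z) :=
  rid_lTensor_rTensor (barD K A m) (koszAug K A) z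

lemma T1bi_dV_zero (i : ℕ) (z : (T1bi K A).X (i + 1) 0) :
    ((T1bi K A).dV i 0).hom z = (barD K A (i + 2)).rTensor (UEnv K A ⊗[K] ⋀[K]^0 A) z := by
  change ((-1 : ℤ) ^ 0 • (barRep K A (i + 3)).homR (barRep K A (i + 2)) (kosz K A 0)
    (barD K A (i + 2)) (barD_env (i + 2)) (barD_lie (i + 2))).hom z = _
  rw [pow_zero, one_smul]; rfl

/-- The lift of a boundary under the augmentation of `U(A)`. -/
lemma mem_range_of_aug (i : ℕ) (z : (T1bi K A).X i 0)
    (h : ∃ y, barD K A (i + 2) y = (barRep K A (i + 2)).aug.hom z) :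
    z ∈ LinearMap.range ((T1bi K A).dV i 0).hom ⊔ LinearMap.range ((T1bi K A).dH i 0).hom := by
  obtain ⟨y, hy⟩ := h
  -- Once the bar preimage is lifted along the augmentation, the difference of `z` and its vertical
  -- image is killed by the augmentation, hence comes from the row.
  obtain ⟨y', rfl⟩ := aug_surjective (barRep K A (i + 3)) y
  have h1 : (barRep K A (i + 2)).aug.hom (z - ((T1bi K A).dV i 0).hom y') = 0 := by
    have e : (barRep K A (i + 2)).aug.hom (((T1bi K A).dV i 0).hom y') =
        (barRep K A (i + 2)).aug.hom z :=
      (congrArg (barRep K A (i + 2)).aug.hom (T1bi_dV_zero i y')).trans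
        ((aug_barD (i + 2) y').trans hy)
    exact (map_sub (barRep K A (i + 2)).aug.hom z _).trans (sub_eq_zero.2 e.symm)
  obtain ⟨w, hw⟩ := (aug_exact (barRep K A (i + 2)) _).1 h1
  refine Submodule.mem_sup.2 ⟨_, ⟨y', rfl⟩, _, ⟨w, rfl⟩, ?_⟩
  exact eq_sub_iff_add_eq'.1 hw

lemma aug_dH (i : ℕ) (w : (T1bi K A).X i 1) :
    (barRep K A (i + 2)).aug.hom (((T1bi K A).dH i 0).hom w) = 0 :=
  (aug_exact (barRep K A (i + 2))).apply_apply_eq_zero w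

-- The cokernels of the rows are the bar terms `Aⁱ⁺⁴`, so `Bicomplex.totD_exact` reduces positive
-- degrees to `barD_exact`. In degree zero, `mem_syzRel` identifies the kernel of `A⁴ → Ω²(A)` with
-- the image of `A⁵`.
variable (K A) in
lemma quasiIso_T1aug : QuasiIso (T1aug K A) := by
  refine quasiIso_toSingle₀ _ _ (fun n => ?_) (fun x hx => ?_) ?_
  · rw [show (T1 K A).d (n + 2) (n + 1) = _ from (T1bi K A).tot_d (n + 1),
      show (T1 K A).d (n + 1) n = _ from (T1bi K A).tot_d n]
    refine Bicomplex.totD_exact (fun i j => homL_exact _ j) (fun i x hx => ?_) n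
    -- The vertical image of `x` lies in the range of the horizontal differential, which the
    -- augmentation kills; hence the augmentation of `x` is a bar cycle.
    refine mem_range_of_aug (i + 1) x ((barD_exact (i + 2) _).1 ?_)
    obtain ⟨w, hw⟩ := hx
    refine (aug_barD (i + 2) x).symm.trans ?_
    rw [← T1bi_dV_zero i x, ← hw]
    exact aug_dH i w
  · rw [show (T1 K A).d 1 0 = _ from (T1bi K A).tot_d 0]
    obtain ⟨x, rfl⟩ : ∃ x', (T1bi K A).incl 0 0 0 rfl x' = x :=
      ⟨(T1bi K A).proj 0 0 0 rfl x, (T1bi K A).totX_ext fun i j hij => by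
        obtain rfl : i = 0 := by omega
        obtain rfl : j = 0 := by omega
        exact Bicomplex.proj_incl_self _ _ _ _ _ _⟩
    have h1 : (barRep K A 2).aug.hom x ∈ syzRelQ K A :=
      (Submodule.Quotient.mk_eq_zero _).1 ((T1augZero_incl K A x).symm.trans hx)
    obtain ⟨_, ⟨v, rfl⟩, _, ⟨w, rfl⟩, hvw⟩ := Submodule.mem_sup.1
      (mem_range_of_aug 0 x ((mem_syzRel K A _).1 h1))
    refine ⟨(T1bi K A).incl 1 0 1 rfl v + (T1bi K A).incl 0 1 1 rfl w, ?_⟩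
    change (T1bi K A).totD 0 _ = _
    rw [map_add, Bicomplex.totD_incl, Bicomplex.totD_incl, ← hvw, map_add]
    simp [Bicomplex.totH, Bicomplex.totV]
  · intro y
    obtain ⟨y, rfl⟩ := Submodule.mkQ_surjective (syzRelQ K A) y
    obtain ⟨x, rfl⟩ := aug_surjective (barRep K A 2) y
    exact ⟨(T1bi K A).incl 0 0 0 rfl x, T1augZero_incl K A x⟩

end Resolutions

/-! ### Extension of scalars as a left adjoint -/

section Balanced

variable {R S : Type u} [Ring R] [Ring S] (φ : R →+* S)

variable {M N : Type u} [AddCommGroup M] [Module R M] [AddCommGroup N] [Module S N]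

/-- The `S`-linear map `s ⊗ m ↦ s f(m)` induced by a semilinear map `f`. -/
def Bal.lift (f : M →ₛₗ[φ] N) : Bal φ M →ₗ[S] N :=
  (balanced φ M).liftQ (TensorProduct.AlgebraTensorModule.lift
    (LinearMap.toSpanSingleton S (M →ₗ[ℤ] N) f.toAddMonoidHom.toIntLinearMap))
    (Submodule.span_le.2 (by
      rintro _ ⟨s, r, m, rfl⟩
      change _ = (0 : N)
      rw [map_sub, sub_eq_zero]
      change (s * φ r) • f m = s • f (r • m)
      rw [map_smulₛₗ, mul_smul]))

@[simp] lemma Bal.lift_tmul (f : M →ₛₗ[φ] N) (s : S) (m : M) :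
    Bal.lift φ f (Bal.tmul φ s m) = s • f m := rfl

lemma Bal.tmul_smul (s : S) (r : R) (m : M) :
    Bal.tmul φ s (r • m) = Bal.tmul φ (s * φ r) m := by
  rw [eq_comm, ← sub_eq_zero]
  exact (Submodule.Quotient.mk_eq_zero (balanced φ M)).2 (Submodule.subset_span ⟨s, r, m, rfl⟩)

lemma Bal.smul_tmul (s t : S) (m : M) : s • Bal.tmul φ t m = Bal.tmul φ (s * t) m := rfl

lemma Bal.tmul_add (s : S) (m m' : M) :
    Bal.tmul φ s (m + m') = Bal.tmul φ s m + Bal.tmul φ s m' := by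
  simp [Bal.tmul, TensorProduct.tmul_add]

lemma Bal.add_tmul (s s' : S) (m : M) :
    Bal.tmul φ (s + s') m = Bal.tmul φ s m + Bal.tmul φ s' m := by
  simp [Bal.tmul, TensorProduct.add_tmul]

lemma Bal.tmul_zero (s : S) : Bal.tmul φ s (0 : M) = 0 := by
  rw [Bal.tmul, TensorProduct.tmul_zero, map_zero]

lemma Bal.zero_tmul (m : M) : Bal.tmul φ (0 : S) m = 0 := by
  rw [Bal.tmul, TensorProduct.zero_tmul, map_zero]

lemma Bal.induction {p : Bal φ M → Prop} (h : ∀ s m, p (Bal.tmul φ s m))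
    (ha : ∀ x y, p x → p y → p (x + y)) (z : Bal φ M) : p z := by
  obtain ⟨z, rfl⟩ := Submodule.mkQ_surjective _ z
  induction z using TensorProduct.induction_on with
  | zero => simpa [Bal.tmul] using h 0 0
  | tmul s m => exact h s m
  | add x y hx hy => rw [map_add]; exact ha _ _ hx hy

variable (M) in
/-- The semilinear map `m ↦ 1 ⊗ m`. -/
def Bal.unit : M →ₛₗ[φ] Bal φ M where
  toFun := Bal.tmul φ 1
  map_add' := Bal.tmul_add φ 1
  map_smul' r m := by rw [Bal.tmul_smul, Bal.smul_tmul, one_mul, mul_one]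

/-- Extension of scalars is left adjoint to restriction of scalars. -/
def scalarExtAdj : scalarExt φ ⊣ ModuleCat.restrictScalars.{u} φ :=
  Adjunction.mkOfHomEquiv
    { homEquiv := fun M N =>
        { toFun := fun f => ModuleCat.semilinearMapAddEquiv φ M N
            (f.hom.comp (Bal.unit φ M))
          invFun := fun g => ModuleCat.ofHom
            (Bal.lift φ ((ModuleCat.semilinearMapAddEquiv φ M N).symm g))
          left_inv := fun f => by
            apply ModuleCat.hom_ext
            refine Bal.hom_ext φ fun s m => ?_
            change s • f.hom (Bal.tmul φ 1 m) = f.hom (Bal.tmul φ s m)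
            refine (f.hom.map_smul s (Bal.tmul φ 1 m)).symm.trans (congrArg f.hom ?_)
            exact (Bal.smul_tmul φ s 1 m).trans (by rw [mul_one])
          right_inv := fun g => by
            apply ModuleCat.hom_ext
            ext m
            exact one_smul S _ }
      homEquiv_naturality_left_symm := fun f g => by
        apply ModuleCat.hom_ext
        exact Bal.hom_ext φ fun s m => rfl
      homEquiv_naturality_right := fun f g => by
        apply ModuleCat.hom_ext
        ext m
        rfl }

/-- Left adjoints preserve finite colimits. This right exactness makes the canonical map from the
zeroth left derived functor to the functor invertible, as the last claim of the theorem requires. -/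
instance : (scalarExt φ).IsLeftAdjoint := (scalarExtAdj φ).isLeftAdjoint

end Balanced

/-! ### Extension of scalars of a free module -/

section BalancedFree

variable {K : Type u} [Field K] {R S : Type u} [Ring R] [Algebra K R] [Ring S] [Algebra K S]
  (φ : R →ₐ[K] S) {V M : Type u} [AddCommGroup V] [Module K V] [AddCommGroup M] [Module R M]
  (e : R ⊗[K] V ≃ₗ[R] M)

/-- The map `s ⊗ v ↦ s ⊗ (1 ⊗ v)` from `S ⊗ V` to `S ⊗_R M` for a free `R`-module `M ≅ R ⊗ V`. -/
def balFreeHom : S ⊗[K] V →+ Bal φ.toRingHom M :=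
  TensorProduct.liftAddHom
    ({ toFun := fun s =>
        { toFun := fun v => Bal.tmul φ.toRingHom s (e (1 ⊗ₜ v))
          map_zero' := by rw [TensorProduct.tmul_zero, map_zero, Bal.tmul_zero]
          map_add' := fun v w => by rw [TensorProduct.tmul_add, map_add, Bal.tmul_add] }
       map_zero' := by ext v; exact Bal.zero_tmul _ _
       map_add' := fun s t => by ext v; exact Bal.add_tmul _ _ _ _ } : S →+ V →+ Bal φ.toRingHom M)
    (fun c s v => by
      -- A scalar leaves `V` through `R` and arrives to the right of `s`; its centrality in `S`
      -- turns this into `c • s`.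
      have h : (1 : R) ⊗ₜ[K] (c • v) = algebraMap K R c • ((1 : R) ⊗ₜ[K] v) := by
        rw [TensorProduct.tmul_smul, algebraMap_smul]
      change Bal.tmul φ.toRingHom (c • s) (e (1 ⊗ₜ v)) =
        Bal.tmul φ.toRingHom s (e (1 ⊗ₜ (c • v)))
      rw [h, map_smul, Bal.tmul_smul]
      change _ = Bal.tmul φ.toRingHom (s * φ (algebraMap K R c)) (e (1 ⊗ₜ v))
      rw [AlgHom.commutes, ← Algebra.commutes, Algebra.smul_def])

lemma balFreeHom_tmul (s : S) (v : V) :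
    balFreeHom φ e (s ⊗ₜ v) = Bal.tmul φ.toRingHom s (e (1 ⊗ₜ v)) := rfl

/-- The inverse `S ⊗_R M → S ⊗ V` of `balFreeHom`. -/
def balFreeInv : Bal φ.toRingHom M →ₗ[S] S ⊗[K] V :=
  Bal.lift φ.toRingHom
    { toFun := fun m => φ.toLinearMap.rTensor V (e.symm m)
      map_add' := fun m m' => by rw [map_add, map_add]
      map_smul' := fun r m => by
        rw [map_smul]
        generalize e.symm m = z
        induction z using TensorProduct.induction_on with
        | zero => simp only [smul_zero, map_zero]
        | add x y hx hy => simp only [smul_add, map_add, hx, hy]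
        | tmul r' v => simp [TensorProduct.smul_tmul'] }

lemma balFreeInv_tmul (s : S) (z : R ⊗[K] V) :
    balFreeInv φ e (Bal.tmul φ.toRingHom s (e z)) = s • φ.toLinearMap.rTensor V z := by
  rw [balFreeInv, Bal.lift_tmul]
  change s • φ.toLinearMap.rTensor V (e.symm (e z)) = _
  rw [e.symm_apply_apply]

/-- The isomorphism `S ⊗ V ≅ S ⊗_R M` for a free `R`-module `M ≅ R ⊗ V`. -/
def balFree : S ⊗[K] V ≃ₗ[S] Bal φ.toRingHom M :=
  LinearEquiv.symm
    { balFreeInv φ e with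
      invFun := balFreeHom φ e
      left_inv := fun z => by
        change balFreeHom φ e (balFreeInv φ e z) = z
        induction z using Bal.induction with
        | ha x y hx hy => rw [map_add, map_add, hx, hy]
        | h s m =>
          obtain ⟨z, rfl⟩ := e.surjective m
          rw [balFreeInv_tmul]
          induction z using TensorProduct.induction_on with
          | zero => rw [map_zero, map_zero, smul_zero, map_zero, Bal.tmul_zero]
          | add x y hx hy => rw [map_add, map_add, smul_add, map_add, hx, hy, Bal.tmul_add]
          | tmul r v =>
            rw [LinearMap.rTensor_tmul, TensorProduct.smul_tmul', balFreeHom_tmul]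
            refine (Bal.tmul_smul φ.toRingHom s r _).symm.trans ?_
            rw [← map_smul, TensorProduct.smul_tmul', smul_eq_mul, mul_one]
      right_inv := fun z => by
        change balFreeInv φ e (balFreeHom φ e z) = z
        induction z using TensorProduct.induction_on with
        | zero => rw [map_zero, map_zero]
        | add x y hx hy => rw [map_add, map_add, hx, hy]
        | tmul s v =>
          rw [balFreeHom_tmul, balFreeInv_tmul]
          simp [TensorProduct.smul_tmul'] }

lemma balFree_symm_tmul (s : S) (r : R) (v : V) :
    (balFree φ e).symm (Bal.tmul φ.toRingHom s (e (r ⊗ₜ v))) = (s * φ r) ⊗ₜ v := by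
  refine (balFreeInv_tmul φ e s _).trans ?_
  simp [TensorProduct.smul_tmul']

end BalancedFree

/-! ### Freeness of the terms over `Q` -/

section Free

variable {K A : Type u} [Field K] [Ring A] [Algebra K A] [PoissonAlgebra K A]
  {V W X Z : Type u} [AddCommGroup V] [Module K V] [AddCommGroup W] [Module K W]
  [AddCommGroup X] [Module K X] [AddCommGroup Z] [Module K Z]

/-- A linear isomorphism `Q ⊗ V ≅ X`, `q ⊗ v ↦ q s(v)`, as an isomorphism of `Q`-modules. -/
def QRep.freeEquiv (r : QRep K A X) (e : QEnv K A ⊗[K] V ≃ₗ[K] X)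
    (he : ∀ q v, e (q ⊗ₜ v) = r.actLin q (e (1 ⊗ₜ v))) : QEnv K A ⊗[K] V ≃ₗ[QEnv K A] r.obj :=
  @LinearEquiv.mk (QEnv K A) (QEnv K A) _ _ (RingHom.id _) (RingHom.id _) _ _ _ X _ _ _
    (Module.compHom X r.toAlgHom.toRingHom)
    (@LinearMap.mk (QEnv K A) (QEnv K A) _ _ (RingHom.id _) _ X _ _ _
      (Module.compHom X r.toAlgHom.toRingHom) e.toAddEquiv.toAddHom (fun q z => by
        change e (q • z) = r.toAlgHom q (e z)
        induction z using TensorProduct.induction_on with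
        | zero => simp only [smul_zero, map_zero]
        | add x y hx hy => simp only [smul_add, map_add, hx, hy]
        | tmul q' v =>
          rw [TensorProduct.smul_tmul', he, he q', smul_eq_mul]
          change r.toAlgHom (q * q') _ = r.toAlgHom q (r.toAlgHom q' _)
          rw [map_mul]; rfl))
    e.symm e.left_inv e.right_inv

variable (K A) in
/-- The isomorphism `Q ⊗ Z ≅ A² ⊗ (U(A) ⊗ Z)`. -/
def regularFree (Z : Type u) [AddCommGroup Z] [Module K Z] :
    QEnv K A ⊗[K] Z ≃ₗ[K] Env K A ⊗[K] (UEnv K A ⊗[K] Z) :=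
  TensorProduct.assoc K (Env K A) (UEnv K A) Z

lemma regularFree_tmul (b : Env K A) (u : UEnv K A) (z : Z) :
    regularFree K A Z (QEnv.mk K b u ⊗ₜ z) = b ⊗ₜ (u ⊗ₜ z) := rfl

/-- On an invariant vector `y` the diagonal action has no bracket term, so only left multiplication
on `U(A)` remains. -/
lemma uLift_kosz (r : QRep K A X) (y : X) (hy : ∀ x, r.lie x y = 0) (j : ℕ) (ω : ⋀[K]^j A)
    (u v : UEnv K A) :
    uLift K (r.tensor (kosz K A j)).lie (r.tensor (kosz K A j)).lie_bracket u
      (y ⊗ₜ (v ⊗ₜ ω)) = y ⊗ₜ ((u * v) ⊗ₜ ω) := by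
  induction u using UEnv.induction K generalizing v with
  | hs c =>
    rw [AlgHom.commutes, ← Algebra.smul_def, Module.algebraMap_end_apply, ← TensorProduct.smul_tmul',
      TensorProduct.tmul_smul]
  | hι x => simp [hy, kosz]
  | ha u u' h h' => simp [h, h', add_mul, TensorProduct.add_tmul, TensorProduct.tmul_add]
  | hm u u' h h' => simp [h, h', mul_assoc]

/-- The unit of `Aᵉ` is invariant, so for `A²` plain associativity is already `Q`-linear and no
untwisting is needed. -/
lemma regularFree_act (j : ℕ) (q : QEnv K A) (ω : ⋀[K]^j A) :
    regularFree K A _ (q ⊗ₜ ω) = ((QRep.regular K A).tensor (kosz K A j)).actLin q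
      (regularFree K A _ ((1 : QEnv K A) ⊗ₜ ω)) := by
  induction q using QEnv.ind with
  | h0 => simp
  | ha s t hs ht => simp only [TensorProduct.add_tmul, map_add, hs, ht, LinearMap.add_apply]
  | ht b u =>
    rw [QEnv.one_def, regularFree_tmul, regularFree_tmul, QRep.actLin_mk, Module.End.mul_apply,
      uLift_kosz _ _ (fun x => envLie_one K x), QRep.tensor_env, mul_one]
    change _ = (b * 1) ⊗ₜ _
    rw [mul_one]

/-! ### The tensor identity for `U(A)` -/

section TensorIdentity

variable (l : LieRep K A W)

/-- The diagonal action of `U(A)` on `W ⊗ U(A)`. -/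
def tiD : UEnv K A →ₐ[K] Module.End K (W ⊗[K] UEnv K A) :=
  uLift K (LinearMap.rTensorHom _ ∘ₗ l.act +
    LinearMap.lTensorHom _ ∘ₗ LinearMap.mul K (UEnv K A) ∘ₗ uι K) fun x y => by
      ext w u
      simp [l.act_bracket, uι_bracket, mul_assoc]
      abel

lemma tiD_uι (x : A) (w : W) (u : UEnv K A) :
    tiD l (uι K x) (w ⊗ₜ u) = l.act x w ⊗ₜ u + w ⊗ₜ (uι K x * u) := by
  simp [tiD]

/-- The right action of `U(A)` on `U(A) ⊗ W`, in which `x ∈ A` acts by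
`u ⊗ w ↦ ux ⊗ w - u ⊗ {x, w}`. -/
def tiR : UEnv K A →ₐ[K] (Module.End K (UEnv K A ⊗[K] W))ᵐᵒᵖ :=
  uLift K ((MulOpposite.opLinearEquiv K).toLinearMap ∘ₗ
    (LinearMap.rTensorHom _ ∘ₗ uRight K A - LinearMap.lTensorHom _ ∘ₗ l.act)) fun x y => by
      apply MulOpposite.unop_injective
      ext u w
      simp [l.act_bracket, uι_bracket, TensorProduct.sub_tmul, mul_assoc, mul_sub]
      abel

lemma tiR_uι (x : A) (u : UEnv K A) (w : W) :
    (tiR l (uι K x)).unop (u ⊗ₜ w) = (u * uι K x) ⊗ₜ w - u ⊗ₜ l.act x w := by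
  simp [tiR]

/-- The map `u ⊗ w ↦ ∑ u₁w ⊗ u₂`. -/
def tiHom : UEnv K A ⊗[K] W →ₗ[K] W ⊗[K] UEnv K A :=
  TensorProduct.lift ((tiD l).toLinearMap.compl₂ ((TensorProduct.mk K W (UEnv K A)).flip 1))

/-- The map `w ⊗ u ↦ ∑ u₁ ⊗ S(u₂)w`. -/
def tiInv : W ⊗[K] UEnv K A →ₗ[K] UEnv K A ⊗[K] W :=
  TensorProduct.lift (((MulOpposite.opLinearEquiv K).symm.toLinearMap ∘ₗ
    (tiR l).toLinearMap).compl₂ (TensorProduct.mk K (UEnv K A) W 1)).flip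

lemma tiHom_tmul (u : UEnv K A) (w : W) : tiHom l (u ⊗ₜ w) = tiD l u (w ⊗ₜ 1) := rfl

lemma tiInv_tmul (u : UEnv K A) (w : W) : tiInv l (w ⊗ₜ u) = (tiR l u).unop (1 ⊗ₜ w) := rfl

lemma tiD_mulRight (u v : UEnv K A) (t : W ⊗[K] UEnv K A) :
    tiD l u ((LinearMap.mulRight K v).lTensor W t) =
      (LinearMap.mulRight K v).lTensor W (tiD l u t) := by
  induction u using UEnv.induction K generalizing t with
  | hs c => simp [Algebra.algebraMap_eq_smul_one]
  | hι x =>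
    induction t using TensorProduct.induction_on with
    | zero => simp
    | add s t hs ht => simp only [map_add, hs, ht]
    | tmul w u => simp [tiD_uι, mul_assoc]
  | ha u u' h h' => simp [h, h']
  | hm u u' h h' => simp [h, h']

lemma tiR_mulLeft (u v : UEnv K A) (t : UEnv K A ⊗[K] W) :
    (tiR l u).unop ((LinearMap.mulLeft K v).rTensor W t) =
      (LinearMap.mulLeft K v).rTensor W ((tiR l u).unop t) := by
  induction u using UEnv.induction K generalizing t with
  | hs c => simp [Algebra.algebraMap_eq_smul_one]
  | hι x =>
    induction t using TensorProduct.induction_on with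
    | zero => simp
    | add s t hs ht => simp only [map_add, hs, ht]
    | tmul w u => simp [tiR_uι, mul_assoc]
  | ha u u' h h' => simp [h, h']
  | hm u u' h h' => simp [h, h']

/-- For a letter `x`, the two terms containing `{x, w}` cancel, so `tiHom` turns the right action
`tiR` into right multiplication. As `w ⊗ u` is `w ⊗ 1` multiplied by `u`, one inverse law follows.
-/
lemma tiHom_tiR (u : UEnv K A) (t : UEnv K A ⊗[K] W) :
    tiHom l ((tiR l u).unop t) = (LinearMap.mulRight K u).lTensor W (tiHom l t) := by
  induction u using UEnv.induction K generalizing t with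
  | hs c =>
    have : LinearMap.mulRight K (algebraMap K (UEnv K A) c) = c • LinearMap.id := by
      ext y; simp [Algebra.algebraMap_eq_smul_one]
    rw [this, LinearMap.lTensor_smul]
    simp [Algebra.algebraMap_eq_smul_one]
  | hι x =>
    induction t using TensorProduct.induction_on with
    | zero => simp
    | add s t hs ht => simp only [map_add, hs, ht]
    | tmul v w =>
      rw [tiR_uι, map_sub, tiHom_tmul, tiHom_tmul, tiHom_tmul, map_mul, Module.End.mul_apply,
        tiD_uι, map_add, add_sub_cancel_left, ← tiD_mulRight]
      simp
  | ha u u' h h' =>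
    have : LinearMap.mulRight K (u + u') = LinearMap.mulRight K u + LinearMap.mulRight K u' := by
      ext y; simp [mul_add]
    simp [h, h', this, LinearMap.lTensor_add]
  | hm u u' h h' => simp [h, h', LinearMap.lTensor_comp]

/-- The mirror image of `tiHom_tiR`, giving the other inverse law. The right action `tiR` does the
work of the antipode, which need not be constructed. -/
lemma tiInv_tiD (u : UEnv K A) (t : W ⊗[K] UEnv K A) :
    tiInv l (tiD l u t) = (LinearMap.mulLeft K u).rTensor _ (tiInv l t) := by
  induction u using UEnv.induction K generalizing t with
  | hs c =>
    have : LinearMap.mulLeft K (algebraMap K (UEnv K A) c) = c • LinearMap.id := by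
      ext y; simp [Algebra.algebraMap_eq_smul_one]
    rw [this, LinearMap.rTensor_smul]
    simp [Algebra.algebraMap_eq_smul_one]
  | hι x =>
    induction t using TensorProduct.induction_on with
    | zero => simp
    | add s t hs ht => simp only [map_add, hs, ht]
    | tmul w v =>
      rw [tiD_uι, map_add, tiInv_tmul, tiInv_tmul, tiInv_tmul, map_mul, MulOpposite.unop_mul,
        Module.End.mul_apply, tiR_uι, map_sub, add_sub_cancel, ← tiR_mulLeft]
      simp
  | ha u u' h h' =>
    have : LinearMap.mulLeft K (u + u') = LinearMap.mulLeft K u + LinearMap.mulLeft K u' := by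
      ext y; simp [add_mul]
    simp [h, h', this, LinearMap.rTensor_add]
  | hm u u' h h' => simp [h, h', LinearMap.rTensor_comp]

/-- The isomorphism `U(A) ⊗ W ≅ W ⊗ U(A)`, `u ⊗ w ↦ ∑ u₁w ⊗ u₂`, for a Lie module `W`. -/
def tiEquiv : UEnv K A ⊗[K] W ≃ₗ[K] W ⊗[K] UEnv K A :=
  LinearEquiv.ofLinearMap (tiHom l) (tiInv l)
    (TensorProduct.ext' fun w u => by
      rw [LinearMap.comp_apply, tiInv_tmul, tiHom_tiR, tiHom_tmul]
      simp)
    (TensorProduct.ext' fun u w => by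
      rw [LinearMap.comp_apply, tiHom_tmul, tiInv_tiD, tiInv_tmul]
      simp)

/-- The isomorphism `Q ⊗ (W ⊗ Z) ≅ (Aᵉ ⊗ W) ⊗ (U(A) ⊗ Z)`. -/
def tensorFree (Z : Type u) [AddCommGroup Z] [Module K Z] :
    QEnv K A ⊗[K] (W ⊗[K] Z) ≃ₗ[K] (Env K A ⊗[K] W) ⊗[K] (UEnv K A ⊗[K] Z) :=
  (TensorProduct.assoc K (QEnv K A) W Z).symm ≪≫ₗ
  TensorProduct.congr (TensorProduct.assoc K (Env K A) (UEnv K A) W ≪≫ₗ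
    TensorProduct.congr (LinearEquiv.refl K _) (tiEquiv l) ≪≫ₗ
    (TensorProduct.assoc K (Env K A) W (UEnv K A)).symm) (LinearEquiv.refl K Z) ≪≫ₗ
  TensorProduct.assoc K (Env K A ⊗[K] W) (UEnv K A) Z

variable (K A W) in
/-- The map `w ⊗ u ↦ (b ⊗ w) ⊗ (u ⊗ z)`. -/
def tensorFreeAux (b : Env K A) (z : Z) :
    W ⊗[K] UEnv K A →ₗ[K] (Env K A ⊗[K] W) ⊗[K] (UEnv K A ⊗[K] Z) :=
  TensorProduct.map (TensorProduct.mk K _ _ b) ((TensorProduct.mk K _ _).flip z)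

lemma tensorFree_tmul (b : Env K A) (u : UEnv K A) (w : W) (z : Z) :
    tensorFree l Z (QEnv.mk K b u ⊗ₜ (w ⊗ₜ z)) = tensorFreeAux K A W b z (tiD l u (w ⊗ₜ 1)) := by
  change TensorProduct.assoc K (Env K A ⊗[K] W) (UEnv K A) Z
    ((TensorProduct.assoc K (Env K A) W (UEnv K A)).symm (b ⊗ₜ tiHom l (u ⊗ₜ w)) ⊗ₜ z) = _
  rw [tiHom_tmul]
  generalize tiD l u (w ⊗ₜ 1) = t
  induction t using TensorProduct.induction_on with
  | zero => simp
  | add s t hs ht =>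
    rw [TensorProduct.tmul_add, map_add, TensorProduct.add_tmul, map_add, hs, ht, map_add]
  | tmul w u => rfl

lemma tensorFree_one_tmul (w : W) (z : Z) :
    tensorFree l Z ((1 : QEnv K A) ⊗ₜ (w ⊗ₜ z)) = (1 ⊗ₜ w) ⊗ₜ (1 ⊗ₜ z) := by
  rw [QEnv.one_def, tensorFree_tmul, map_one]; rfl

/-- The invariance of `1 ∈ Aᵉ` again removes one term of the diagonal action; what is left is the
action on `W ⊗ U(A)` that `tiEquiv` untwists. -/
lemma uLift_tensorFreeAux (j : ℕ) (ω : ⋀[K]^j A) (u : UEnv K A) (t : W ⊗[K] UEnv K A) :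
    uLift K (S := Module.End K ((Env K A ⊗[K] W) ⊗[K] (UEnv K A ⊗[K] ⋀[K]^j A)))
      (((QRep.regular K A).tensor l).tensor (kosz K A j)).lie
      (((QRep.regular K A).tensor l).tensor (kosz K A j)).lie_bracket u
      (tensorFreeAux K A W 1 ω t) = tensorFreeAux K A W 1 ω (tiD l u t) := by
  induction u using UEnv.induction K generalizing t with
  | hs c => simp [Algebra.algebraMap_eq_smul_one]
  | hι x =>
    induction t using TensorProduct.induction_on with
    | zero => simp
    | add s t hs ht => simp only [map_add, hs, ht]
    | tmul w v =>
      rw [tiD_uι, uLift_uι, map_add]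
      change (envLie K x 1 ⊗ₜ w + 1 ⊗ₜ l.act x w) ⊗ₜ (v ⊗ₜ ω) + _ = _
      rw [envLie_one, TensorProduct.zero_tmul, zero_add]
      rfl
  | ha u u' h h' => simp [h, h']
  | hm u u' h h' => simp [h, h']

lemma tensorFree_act (j : ℕ) (q : QEnv K A) (v : W ⊗[K] ⋀[K]^j A) :
    tensorFree l _ (q ⊗ₜ v) = (((QRep.regular K A).tensor l).tensor (kosz K A j)).actLin q
      (tensorFree l _ ((1 : QEnv K A) ⊗ₜ v)) := by
  induction v using TensorProduct.induction_on with
  | zero => simp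
  | add v v' h h' => simp only [TensorProduct.tmul_add, map_add, h, h']
  | tmul w ω =>
    induction q using QEnv.ind with
    | h0 => simp
    | ha s t hs ht => simp only [TensorProduct.add_tmul, map_add, hs, ht, LinearMap.add_apply]
    | ht b u =>
      rw [QEnv.one_def, tensorFree_tmul, tensorFree_tmul, QRep.actLin_mk, Module.End.mul_apply,
        uLift_tensorFreeAux, map_one, Module.End.one_apply]
      generalize tiD l u (w ⊗ₜ 1) = t
      induction t using TensorProduct.induction_on with
      | zero => simp
      | add s t hs ht => simp only [map_add, hs, ht]
      | tmul w v =>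
        change (b ⊗ₜ w) ⊗ₜ _ = ((b * 1) ⊗ₜ w) ⊗ₜ _
        rw [mul_one]
        rfl

end TensorIdentity

variable (K A)

/-- The `Q`-module `A² ⊗ U(A) ⊗ ∧ʲ` is free on `∧ʲ`. -/
def koszFree (j : ℕ) : QEnv K A ⊗[K] ⋀[K]^j A ≃ₗ[QEnv K A]
    ((QRep.regular K A).tensor (kosz K A j)).obj :=
  QRep.freeEquiv _ (regularFree K A _) (regularFree_act j)

/-- The `Q`-module `Aᵐ⁺² ⊗ U(A) ⊗ ∧ʲ` is free on `Aᵐ ⊗ ∧ʲ`. -/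
def barFree (m j : ℕ) : QEnv K A ⊗[K] (⨂[K]^m A ⊗[K] ⋀[K]^j A) ≃ₗ[QEnv K A]
    ((barRep K A m).tensor (kosz K A j)).obj :=
  QRep.freeEquiv _ (tensorFree (tpow K A m) _) (tensorFree_act (tpow K A m) j)

lemma free_T2 [CharZero K] (n : ℕ) : Module.Free (QEnv K A) ((T2 K A).X n) :=
  Module.Free.of_equiv (koszFree K A n)

lemma free_T1 [CharZero K] (n : ℕ) : Module.Free (QEnv K A) ((T1 K A).X n) := by
  have h : ∀ p : {p : ℕ × ℕ // p.1 + p.2 = n},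
      Module.Free (QEnv K A) ((T1bi K A).X p.1.1 p.1.2) := fun p =>
    Module.Free.of_equiv (barFree K A (p.1.1 + 2) p.1.2)
  exact Module.Free.directSum (R := QEnv K A) fun p : {p : ℕ × ℕ // p.1 + p.2 = n} =>
    (T1bi K A).X p.1.1 p.1.2

end Free

/-! ### Row zero and `P ⊗_Q T''` -/

section RowZero

variable {K A : Type u} [Field K] [Ring A] [Algebra K A] [PoissonAlgebra K A]
  {V V' : Type u} [AddCommGroup V] [Module K V] [AddCommGroup V'] [Module K V']

/-- The `P`-module `P ⊗_Q M` for a quasi-Poisson module `M`. -/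
def QRep.ext (r : QRep K A V) : Type u := Bal (toP K A).toRingHom r.obj

instance (r : QRep K A V) : AddCommGroup r.ext :=
  inferInstanceAs (AddCommGroup (Bal (toP K A).toRingHom r.obj))

instance (r : QRep K A V) : Module (PEnv K A) r.ext :=
  inferInstanceAs (Module (PEnv K A) (Bal (toP K A).toRingHom r.obj))

/-- The map `P ⊗_Q M → P ⊗_Q N` induced by a map `M → N` of quasi-Poisson modules. -/
def QRep.extMap {r : QRep K A V} {r' : QRep K A V'} (f : r.obj ⟶ r'.obj) :
    r.ext →ₗ[PEnv K A] r'.ext :=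
  Bal.map (toP K A).toRingHom f.hom

variable (K A)

/-- The isomorphism `P ⊗ ∧ⁿ ≅ P ⊗_Q (A² ⊗ U(A) ⊗ ∧ⁿ)`. -/
def rowZeroIso (n : ℕ) : PEnv K A ⊗[K] ⋀[K]^n A ≃ₗ[PEnv K A]
    ((QRep.regular K A).tensor (kosz K A n)).ext :=
  balFree (toP K A) (koszFree K A n)

variable {K A}

/-- The map `m ↦ p ⊗ m` from a quasi-Poisson module `M` to `P ⊗_Q M`. -/
def ptmulHom (r : QRep K A V) (p : PEnv K A) : V →+ r.ext where
  toFun m := Bal.tmul (M := r.obj) (toP K A).toRingHom p m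
  map_zero' := Bal.tmul_zero (M := r.obj) _ _
  map_add' := Bal.tmul_add (M := r.obj) _ _

lemma ptmulHom_act (r : QRep K A V) (p : PEnv K A) (q : QEnv K A) (m : V) :
    ptmulHom r p (r.actLin q m) = ptmulHom r (p * toP K A q) m :=
  Bal.tmul_smul (M := r.obj) (toP K A).toRingHom p q m

lemma ptmulHom_lie (r : QRep K A V) (p : PEnv K A) (x : A) (m : V) :
    ptmulHom r p (r.lie x m) = ptmulHom r (p * lieToP x) m := by
  have h := ptmulHom_act r p (QEnv.ofLie x) m
  rw [QEnv.ofLie_apply, QRep.actLin_mk, map_one, one_mul, uLift_uι] at h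
  exact h

lemma ptmulHom_env (r : QRep K A V) (p : PEnv K A) (b : Env K A) (m : V) :
    ptmulHom r p (r.env b m) = ptmulHom r (p * envToP b) m := by
  have h := ptmulHom_act r p (QEnv.ofEnv K A b) m
  rw [QEnv.ofEnv_apply, QRep.actLin_mk, map_one, mul_one] at h
  exact h

lemma QRep.ext_hom_ext {r : QRep K A V} {X : Type u} [AddCommGroup X]
    [Module (PEnv K A) X] {f g : r.ext →ₗ[PEnv K A] X}
    (h : ∀ p m, f (ptmulHom r p m) = g (ptmulHom r p m)) : f = g :=
  Bal.hom_ext _ h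

/-- The map `U(A) → P`, `u ↦ p(b # u)`. -/
def mulMk (p : PEnv K A) (b : Env K A) : UEnv K A →ₗ[K] PEnv K A :=
  LinearMap.mulLeft K p ∘ₗ (toP K A).toLinearMap ∘ₗ QEnv.mk K b

/-- The factor `b` is not affected, because `u` acts on the unit of `Aᵉ` through the counit
(`diag_mk_one`). This makes `u ↦ p(b # u)` a map of right Lie modules. -/
lemma mk_mul_ofLie (b : Env K A) (u : UEnv K A) (x : A) :
    QEnv.mk K b u * QEnv.ofLie x = QEnv.mk K b (u * uι K x) := by
  rw [QEnv.ofLie_apply, QEnv.mul_def, QEnv.mulMap_mk, QEnv.diag_mk_one, QEnv.lmulEnv_mk, mul_one]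

lemma mulMk_uRight (p : PEnv K A) (b : Env K A) (x : A) (u : UEnv K A) :
    mulMk p b (uRight K A x u) = pRight K A x (mulMk p b u) := by
  change p * toP K A (QEnv.mk K b (u * uι K x)) =
    p * toP K A (QEnv.mk K b u) * toP K A (QEnv.ofLie x)
  rw [← mk_mul_ofLie, map_mul, mul_assoc]

lemma rowZeroIso_symm_tmul (n : ℕ) (p : PEnv K A) (b : Env K A)
    (z : UEnv K A ⊗[K] ⋀[K]^n A) :
    (rowZeroIso K A n).symm (ptmulHom _ p (b ⊗ₜ z)) = (mulMk p b).rTensor _ z := by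
  induction z using TensorProduct.induction_on with
  | zero => rw [TensorProduct.tmul_zero, map_zero, map_zero, map_zero]
  | add z z' h h' => rw [TensorProduct.tmul_add, map_add, map_add, map_add, h, h']
  | tmul u ω => exact balFree_symm_tmul (toP K A) (koszFree K A n) p (QEnv.mk K b u) ω

/-- Naturality of the Chevalley–Eilenberg differential along `u ↦ p(b # u)`, which commutes with the
right actions of `A` by `mulMk_uRight`. -/
lemma rowZeroIso_symm_d (n : ℕ)
    (y : ((QRep.regular K A).tensor (kosz K A (n + 1))).ext) :
    (rowZeroIso K A n).symm (QRep.extMap ((QRep.regular K A).homL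
      (kosz K A (n + 1)) (kosz K A n) (koszD K A n) (koszD_act n)) y) =
    chiH0 K A n ((rowZeroIso K A (n + 1)).symm y) := by
  suffices h : (rowZeroIso K A n).symm.toLinearMap ∘ₗ QRep.extMap
      ((QRep.regular K A).homL (kosz K A (n + 1)) (kosz K A n) (koszD K A n) (koszD_act n)) =
      chiH0 K A n ∘ₗ (rowZeroIso K A (n + 1)).symm.toLinearMap from LinearMap.congr_fun h y
  refine QRep.ext_hom_ext fun p m => ?_
  change (rowZeroIso K A n).symm (ptmulHom _ p ((koszD K A n).lTensor _ m)) =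
    chiH0 K A n ((rowZeroIso K A (n + 1)).symm (ptmulHom _ p m))
  induction m using TensorProduct.induction_on with
  | zero => simp only [map_zero]
  | add m m' h h' => simp only [map_add, h, h']
  | tmul b z =>
    rw [LinearMap.lTensor_tmul, rowZeroIso_symm_tmul, rowZeroIso_symm_tmul]
    exact ceD_natural K (uRight K A) (pRight K A) (mulMk p b) (mulMk_uRight p b) n z

end RowZero

/-! ### The higher rows and `P ⊗_Q T'` -/

section Rows

variable (K A : Type u) [Field K] [Ring A] [Algebra K A] [PoissonAlgebra K A]

/-- The isomorphism `P ⊗ Aᵐ ⊗ ∧ʲ ≅ P ⊗_Q (Aᵐ⁺² ⊗ U(A) ⊗ ∧ʲ)`. -/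
def rowIso (m j : ℕ) : (PEnv K A ⊗[K] ⨂[K]^m A) ⊗[K] ⋀[K]^j A ≃ₗ[PEnv K A]
    ((barRep K A m).tensor (kosz K A j)).ext :=
  TensorProduct.AlgebraTensorModule.assoc K K (PEnv K A) (PEnv K A) (⨂[K]^m A) (⋀[K]^j A) ≪≫ₗ
    balFree (toP K A) (barFree K A m j)

/-- The right action of `U(A)` on `P ⊗ Aᵐ`. -/
def rowActU (m : ℕ) : UEnv K A →ₐ[K] (Module.End K (PEnv K A ⊗[K] ⨂[K]^m A))ᵐᵒᵖ :=
  uLift K ((MulOpposite.opLinearEquiv K).toLinearMap ∘ₗ rowAct K A m) fun x y => by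
    apply MulOpposite.unop_injective
    exact rowAct_bracket m x y

variable {K A}

lemma rowActU_uι (m : ℕ) (x : A) (z : PEnv K A ⊗[K] ⨂[K]^m A) :
    (rowActU K A m (uι K x)).unop z = rowAct K A m x z := by
  rw [rowActU, uLift_uι]; rfl

lemma rowActU_uι_mul (m : ℕ) (x : A) (u : UEnv K A) (z : PEnv K A ⊗[K] ⨂[K]^m A) :
    (rowActU K A m (uι K x * u)).unop z = (rowActU K A m u).unop (rowAct K A m x z) := by
  rw [map_mul, MulOpposite.unop_mul, Module.End.mul_apply]
  exact congrArg _ (rowActU_uι m x z)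

lemma rowIso_tmul (m j : ℕ) (p : PEnv K A) (θ : ⨂[K]^m A) (ω : ⋀[K]^j A) :
    rowIso K A m j ((p ⊗ₜ θ) ⊗ₜ ω) = ptmulHom _ p ((1 ⊗ₜ θ) ⊗ₜ (1 ⊗ₜ ω)) :=
  congrArg (ptmulHom ((barRep K A m).tensor (kosz K A j)) p)
    (tensorFree_one_tmul (tpow K A m) θ ω)

lemma barRep_kosz_lie (m j : ℕ) (x : A) (θ : ⨂[K]^m A) (u : UEnv K A) (ω : ⋀[K]^j A) :
    ((barRep K A m).tensor (kosz K A j)).lie x ((1 ⊗ₜ θ) ⊗ₜ (u ⊗ₜ ω)) =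
      (1 ⊗ₜ (tpow K A m).act x θ) ⊗ₜ (u ⊗ₜ ω) + (1 ⊗ₜ θ) ⊗ₜ ((uι K x * u) ⊗ₜ ω) := by
  have h : (barRep K A m).lie x (1 ⊗ₜ θ) = 1 ⊗ₜ (tpow K A m).act x θ := by
    change envLie K x 1 ⊗ₜ θ + 1 ⊗ₜ (tpow K A m).act x θ = _
    rw [envLie_one, TensorProduct.zero_tmul, zero_add]
  rw [QRep.tensor_lie, h]
  rfl

/-- The map `U(A) → P ⊗ Aᵐ`, `u ↦ zu`. -/
def rowOrbit {m : ℕ} (z : PEnv K A ⊗[K] ⨂[K]^m A) : UEnv K A →ₗ[K] PEnv K A ⊗[K] ⨂[K]^m A :=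
  LinearMap.applyₗ z ∘ₗ (MulOpposite.opLinearEquiv K).symm.toLinearMap ∘ₗ
    (rowActU K A m).toLinearMap

lemma rowOrbit_apply {m : ℕ} (z : PEnv K A ⊗[K] ⨂[K]^m A) (u : UEnv K A) :
    rowOrbit z u = (rowActU K A m u).unop z := rfl

lemma rowOrbit_uRight {m : ℕ} (z : PEnv K A ⊗[K] ⨂[K]^m A) (x : A) (u : UEnv K A) :
    rowOrbit z (uRight K A x u) = rowAct K A m x (rowOrbit z u) := by
  rw [rowOrbit_apply, rowOrbit_apply, uRight_apply, map_mul, MulOpposite.unop_mul,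
    Module.End.mul_apply, rowActU_uι]

/-- The map `u ↦ p ⊗ (1 ⊗ θ) ⊗ u ⊗ ω` from `U(A)` to `P ⊗_Q (Aᵐ⁺² ⊗ U(A) ⊗ ∧ʲ)`. -/
def barSlot (m j : ℕ) (ω : ⋀[K]^j A) (p : PEnv K A) (θ : ⨂[K]^m A) :
    UEnv K A →+ ((barRep K A m).tensor (kosz K A j)).ext :=
  (ptmulHom ((barRep K A m).tensor (kosz K A j)) p).comp
    ((TensorProduct.mk K _ _ ((1 : Env K A) ⊗ₜ θ) ∘ₗ
      (TensorProduct.mk K (UEnv K A) (⋀[K]^j A)).flip ω).toAddMonoidHom)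

lemma barSlot_apply (m j : ℕ) (ω : ⋀[K]^j A) (p : PEnv K A) (θ : ⨂[K]^m A) (u : UEnv K A) :
    barSlot m j ω p θ u =
      ptmulHom ((barRep K A m).tensor (kosz K A j)) p ((1 ⊗ₜ θ) ⊗ₜ (u ⊗ₜ ω)) := rfl

/-- The map `z ↦ z ⊗ ω`, from `P ⊗ Aᵐ` to `P ⊗ Aᵐ ⊗ ∧ʲ`, followed by `rowIso`. -/
def rowSlot (m j : ℕ) (ω : ⋀[K]^j A) :
    PEnv K A ⊗[K] ⨂[K]^m A →+ ((barRep K A m).tensor (kosz K A j)).ext :=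
  (rowIso K A m j).toLinearMap.toAddMonoidHom.comp
    ((TensorProduct.mk K (PEnv K A ⊗[K] ⨂[K]^m A) (⋀[K]^j A)).flip ω).toAddMonoidHom

/-- Moving `x` across `⊗_Q` applies the diagonal action, with one term on `θ` and one on `u`. The
term on `θ` is the origin of `-p ⊗ {x, θ}` in `rowAct`. -/
lemma barSlot_uι (m j : ℕ) (ω : ⋀[K]^j A) (p : PEnv K A) (θ : ⨂[K]^m A) (x : A)
    (u : UEnv K A) : barSlot m j ω p θ (uι K x * u) =
      barSlot m j ω (p * lieToP x) θ u - barSlot m j ω p ((tpow K A m).act x θ) u := by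
  have h := ptmulHom_lie ((barRep K A m).tensor (kosz K A j)) p x
    (((1 : Env K A) ⊗ₜ θ) ⊗ₜ (u ⊗ₜ ω))
  rw [barRep_kosz_lie, map_add] at h
  exact eq_sub_of_add_eq' h

lemma barSlot_smul (m j : ℕ) (ω : ⋀[K]^j A) (p : PEnv K A) (θ : ⨂[K]^m A) (c : K)
    (u : UEnv K A) : barSlot m j ω p θ (c • u) = barSlot m j ω p (c • θ) u := by
  rw [barSlot_apply, barSlot_apply, TensorProduct.tmul_smul, ← TensorProduct.smul_tmul',
    ← TensorProduct.smul_tmul', TensorProduct.tmul_smul]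

/-- By `barSlot_uι`, the letters of `u` can be carried one after another into `P ⊗ Aᵐ`, where they
act through `rowAct`. This computes `rowIso` beyond the generators with `u = 1`. -/
lemma barSlot_eq (m j : ℕ) (ω : ⋀[K]^j A) (p : PEnv K A) (θ : ⨂[K]^m A) (u : UEnv K A) :
    barSlot m j ω p θ u = rowSlot m j ω (rowOrbit (p ⊗ₜ θ) u) := by
  -- Placing `u` in front of any `v` that satisfies the claim gives a property closed under
  -- products; the claim itself is the case `v = 1`.
  suffices H : ∀ u v : UEnv K A,
      (∀ p θ, barSlot m j ω p θ v = rowSlot m j ω (rowOrbit (p ⊗ₜ θ) v)) →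
      ∀ p θ, barSlot m j ω p θ (u * v) = rowSlot m j ω (rowOrbit (p ⊗ₜ θ) (u * v)) by
    have h := H u 1 (fun p θ => by
      have h1 : rowOrbit (p ⊗ₜ θ) (1 : UEnv K A) = p ⊗ₜ θ := by
        rw [rowOrbit_apply, map_one]; rfl
      rw [h1]
      exact (rowIso_tmul m j p θ ω).symm) p θ
    rwa [mul_one] at h
  clear p θ u
  intro u
  induction u using UEnv.induction K with
  | hs c =>
    intro v hv p θ
    rw [← Algebra.smul_def, barSlot_smul, hv, map_smul, TensorProduct.tmul_smul]
    congr 1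
    exact map_smul (rowActU K A m v).unop c (p ⊗ₜ θ)
  | hι x =>
    intro v hv p θ
    rw [barSlot_uι, hv, hv, rowOrbit_apply, rowOrbit_apply, rowOrbit_apply,
      rowActU_uι_mul, rowAct_tmul, map_sub]
    exact (map_sub (rowSlot m j ω) _ _).symm
  | ha u u' h h' =>
    intro v hv p θ
    rw [add_mul, map_add (rowOrbit (p ⊗ₜ θ)) (u * v) (u' * v)]
    refine (map_add (barSlot m j ω p θ) _ _).trans ?_
    refine Eq.trans ?_ (map_add (rowSlot m j ω) _ _).symm
    exact congrArg₂ (· + ·) (h v hv p θ) (h' v hv p θ)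
  | hm u u' h h' =>
    intro v hv
    rw [mul_assoc]
    exact h _ (h' v hv)

lemma ptmulHom_bar_kosz (m j : ℕ) (p : PEnv K A) (θ : ⨂[K]^m A) (y : UEnv K A ⊗[K] ⋀[K]^j A) :
    ptmulHom ((barRep K A m).tensor (kosz K A j)) p ((1 ⊗ₜ θ) ⊗ₜ y) =
      rowIso K A m j ((rowOrbit (p ⊗ₜ θ)).rTensor _ y) := by
  induction y using TensorProduct.induction_on with
  | zero => rw [TensorProduct.tmul_zero, map_zero, map_zero, map_zero]
  | add y y' h h' => rw [TensorProduct.tmul_add, map_add, map_add, map_add, h, h']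
  | tmul u ω => exact barSlot_eq m j ω p θ u

/-- Naturality of `ceD` along the orbit map `u ↦ (p ⊗ θ)u`, evaluated at `1 ⊗ ω`. -/
lemma rowIso_chiH (m j : ℕ) (z : (PEnv K A ⊗[K] ⨂[K]^m A) ⊗[K] ⋀[K]^(j + 1) A) :
    rowIso K A m j (chiH K A m j z) = QRep.extMap
      ((barRep K A m).homL (kosz K A (j + 1)) (kosz K A j) (koszD K A j) (koszD_act j))
      (rowIso K A m (j + 1) z) := by
  induction z using TensorProduct.induction_on with
  | zero => simp only [map_zero]
  | add z z' h h' => simp only [map_add, h, h']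
  | tmul n ω =>
    induction n using TensorProduct.induction_on with
    | zero => simp only [map_zero, TensorProduct.zero_tmul]
    | add z z' h h' => simp only [map_add, h, h', TensorProduct.add_tmul]
    | tmul p θ =>
      rw [rowIso_tmul]
      change _ = ptmulHom ((barRep K A m).tensor (kosz K A j)) p
        ((1 ⊗ₜ θ) ⊗ₜ koszD K A j (1 ⊗ₜ ω))
      rw [ptmulHom_bar_kosz, koszD,
        ceD_natural K (uRight K A) (rowAct K A m) (rowOrbit (p ⊗ₜ θ)) (rowOrbit_uRight (p ⊗ₜ θ)),
        LinearMap.rTensor_tmul, rowOrbit_apply, map_one]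
      rfl

/-- The map `Aᵉ → P`, `b ↦ pb`. -/
def mulEnvToP (p : PEnv K A) : Env K A →ₗ[K] PEnv K A :=
  LinearMap.mulLeft K p ∘ₗ envToP.toLinearMap

lemma ptmulHom_bar_env (m j : ℕ) (p : PEnv K A) (y : Env K A ⊗[K] ⨂[K]^m A) (ω : ⋀[K]^j A) :
    ptmulHom ((barRep K A m).tensor (kosz K A j)) p (y ⊗ₜ (1 ⊗ₜ ω)) =
      rowIso K A m j ((mulEnvToP p).rTensor _ y ⊗ₜ ω) := by
  induction y using TensorProduct.induction_on with
  | zero => simp only [map_zero, TensorProduct.zero_tmul]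
  | add z z' h h' => simp only [map_add, h, h', TensorProduct.add_tmul]
  | tmul b θ =>
    have h := ptmulHom_env ((barRep K A m).tensor (kosz K A j)) p b ((1 ⊗ₜ θ) ⊗ₜ (1 ⊗ₜ ω))
    rw [QRep.tensor_env, barRep_env, TensorProduct.smul_tmul', smul_eq_mul, mul_one] at h
    rw [h, LinearMap.rTensor_tmul, rowIso_tmul]
    rfl

/-- Naturality of `hb` along the map `b ↦ pb` from `Aᵉ` to `P`, evaluated at `1 ⊗ θ`. -/
lemma rowIso_chiB (m j : ℕ) (z : (PEnv K A ⊗[K] ⨂[K]^(m + 1) A) ⊗[K] ⋀[K]^j A) :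
    rowIso K A m j (chiB K A m j z) = QRep.extMap
      ((barRep K A (m + 1)).homR (barRep K A m) (kosz K A j)
        (barD K A m) (barD_env m) (barD_lie m)) (rowIso K A (m + 1) j z) := by
  induction z using TensorProduct.induction_on with
  | zero => simp only [map_zero]
  | add z z' h h' => simp only [map_add, h, h']
  | tmul n ω =>
    induction n using TensorProduct.induction_on with
    | zero => simp only [map_zero, TensorProduct.zero_tmul]
    | add z z' h h' => simp only [map_add, h, h', TensorProduct.add_tmul]
    | tmul p θ =>
      rw [rowIso_tmul]
      change _ = ptmulHom ((barRep K A m).tensor (kosz K A j)) p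
        (barD K A m (1 ⊗ₜ θ) ⊗ₜ (1 ⊗ₜ ω))
      rw [ptmulHom_bar_env]
      have h := hb_natural (AlgHom.id K (Env K A)) (envToP (K := K) (A := A)) (mulEnvToP p)
        (fun s b => by
          change p * envToP (s * b) = p * envToP s * envToP b
          rw [map_mul, mul_assoc]) m (1 ⊗ₜ θ)
      have h1 : (mulEnvToP p).rTensor (⨂[K]^(m + 1) A) ((1 : Env K A) ⊗ₜ θ) = p ⊗ₜ θ := by
        rw [LinearMap.rTensor_tmul]
        change (p * envToP 1) ⊗ₜ θ = _
        rw [map_one, mul_one]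
      rw [h1] at h
      exact congrArg (fun t => rowIso K A m j (t ⊗ₜ ω)) h.symm

end Rows

/-! ### Functoriality and additivity of extension of scalars -/

section BalancedMaps

variable {R S : Type u} [Ring R] [Ring S] (φ : R →+* S) {M M' M'' : Type u} [AddCommGroup M]
  [Module R M] [AddCommGroup M'] [Module R M'] [AddCommGroup M''] [Module R M'']

lemma Bal.map_map (f : M →ₗ[R] M') (g : M' →ₗ[R] M'') (z : Bal φ M) :
    Bal.map φ g (Bal.map φ f z) = Bal.map φ (g ∘ₗ f) z :=
  LinearMap.congr_fun (f := Bal.map φ g ∘ₗ Bal.map φ f) (g := Bal.map φ (g ∘ₗ f))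
    (Bal.hom_ext φ fun _ _ => rfl) z

lemma Bal.map_id (z : Bal φ M) : Bal.map φ (LinearMap.id : M →ₗ[R] M) z = z :=
  LinearMap.congr_fun (f := Bal.map φ LinearMap.id) (g := LinearMap.id)
    (Bal.hom_ext φ fun _ _ => rfl) z

lemma Bal.map_zero (z : Bal φ M) : Bal.map φ (0 : M →ₗ[R] M') z = 0 :=
  LinearMap.congr_fun (f := Bal.map φ (0 : M →ₗ[R] M')) (g := 0)
    (Bal.hom_ext φ fun s _ => Bal.tmul_zero φ s) z

lemma Bal.map_add (f g : M →ₗ[R] M') (z : Bal φ M) :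
    Bal.map φ (f + g) z = Bal.map φ f z + Bal.map φ g z :=
  LinearMap.congr_fun (f := Bal.map φ (f + g)) (g := Bal.map φ f + Bal.map φ g)
    (Bal.hom_ext φ fun s m => Bal.tmul_add φ s (f m) (g m)) z

lemma Bal.map_zsmul (c : ℤ) (f : M →ₗ[R] M') (z : Bal φ M) :
    Bal.map φ (c • f) z = c • Bal.map φ f z := by
  induction z using Bal.induction with
  | ha x y hx hy => rw [_root_.map_add, _root_.map_add, smul_add, hx, hy]
  | h s m => exact _root_.map_zsmul ((TensorProduct.mk ℤ S M' s).toAddMonoidHom.comp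
      (AddMonoidHom.id M') |> (balanced φ M').mkQ.toAddMonoidHom.comp) c (f m)

end BalancedMaps

lemma Bicomplex.totX_induction {R : Type u} [Ring R] {B : Bicomplex R} {n : ℕ}
    {p : B.totX n → Prop} (h0 : p 0) (hi : ∀ i j (h : i + j = n) x, p (B.incl i j n h x))
    (ha : ∀ x y, p x → p y → p (x + y)) (z : B.totX n) : p z :=
  DirectSum.induction_on (motive := p) z h0 (fun q x => hi q.1.1 q.1.2 q.2 x) ha

variable (K A : Type u) [Field K] [CharZero K] [Ring A] [Algebra K A] [PoissonAlgebra K A]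

/-! ### The map `f` -/

section Inclusion

/-- The map `P ⊗_Q T''ₙ → χₙ(A)`. -/
def inclLin (n : ℕ) :
    ((QRep.regular K A).tensor (kosz K A n)).ext →ₗ[PEnv K A] (chiBi K A).totX n :=
  (chiBi K A).incl 0 n n (zero_add n) ∘ₗ (rowZeroIso K A n).symm.toLinearMap

variable {K A}

lemma inclLin_apply (n : ℕ) (y : ((QRep.regular K A).tensor (kosz K A n)).ext) :
    inclLin K A n y = inChi0 n ((rowZeroIso K A n).symm y) := rfl

/-- No vertical differential leaves row `0`, so this row is a subcomplex. -/
lemma totD_inChi0 (n : ℕ) (z : PEnv K A ⊗[K] ⋀[K]^(n + 1) A) :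
    (chiBi K A).totD n (inChi0 (n + 1) z) = inChi0 n (chiH0 K A n z) :=
  ((chiBi K A).totD_incl 0 (n + 1) n (zero_add _) z).trans (add_zero _)

lemma inclLin_d (n : ℕ) (y : ((QRep.regular K A).tensor (kosz K A (n + 1))).ext) :
    (chiBi K A).totD n (inclLin K A (n + 1) y) = inclLin K A n (QRep.extMap
      ((QRep.regular K A).homL (kosz K A (n + 1)) (kosz K A n) (koszD K A n) (koszD_act n)) y) := by
  rw [inclLin_apply, inclLin_apply, rowZeroIso_symm_d]
  exact totD_inChi0 n _

variable (K A) in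
/-- The map `f : P ⊗_Q T'' → χ(A)`. -/
def inclMap : extPC K A (T2 K A) ⟶ chi K A where
  f n := ModuleCat.ofHom (inclLin K A n)
  comm' i j h := by
    obtain rfl : j + 1 = i := h
    rw [show (chi K A).d (j + 1) j = _ from (chiBi K A).tot_d j]
    change _ = (extP K A).map ((T2 K A).d (j + 1) j) ≫ _
    rw [T2_d]
    apply ModuleCat.hom_ext
    exact LinearMap.ext fun y => inclLin_d j y

lemma inclMap_apply (n : ℕ) (p : PEnv K A) (b : Env K A) (v : UEnv K A) (ω : ⋀[K]^n A) :
    ((inclMap K A).f n).hom (ptmul p (inT2 n (b ⊗ₜ[K] (v ⊗ₜ[K] ω)))) =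
      inChi0 n ((p * toP K A (QEnv.mk K b v)) ⊗ₜ[K] ω) :=
  congrArg (inChi0 n) (rowZeroIso_symm_tmul n p b (v ⊗ₜ ω))

end Inclusion

/-! ### The map `g` -/

section Projection

/-- The isomorphism `rowIso` on the terms of the bicomplexes. -/
def rowEquiv (i j : ℕ) : (chiBi K A).X (i + 1) (j + 1) ≃ₗ[PEnv K A]
    Bal (toP K A).toRingHom ((T1bi K A).X i j) := rowIso K A (i + 2) j

/-- The components of the map `χₙ₊₂(A) → P ⊗_Q T'ₙ`. -/
def projComp (n : ℕ) : ∀ i j : ℕ, i + j = n + 2 →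
    ((chiBi K A).X i j →ₗ[PEnv K A] Bal (toP K A).toRingHom ((T1bi K A).totX n))
  | 0, _, _ => 0
  | _ + 1, 0, _ => 0
  | i + 1, j + 1, h => Bal.map (toP K A).toRingHom ((T1bi K A).incl i j n (by omega)) ∘ₗ
      (rowEquiv K A i j).toLinearMap

/-- The map `χₙ₊₂(A) → P ⊗_Q T'ₙ`. -/
def projLin (n : ℕ) :
    (chiBi K A).totX (n + 2) →ₗ[PEnv K A] Bal (toP K A).toRingHom ((T1bi K A).totX n) :=
  DirectSum.toModule (PEnv K A) {p : ℕ × ℕ // p.1 + p.2 = n + 2} _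
    fun p => projComp K A n p.1.1 p.1.2 p.2

variable {K A}

lemma projLin_incl (n i j : ℕ) (h : i + j = n + 2) (x : (chiBi K A).X i j) :
    projLin K A n ((chiBi K A).incl i j (n + 2) h x) = projComp K A n i j h x :=
  DirectSum.toModule_lof (R := PEnv K A) (ι := {p : ℕ × ℕ // p.1 + p.2 = n + 2})
    (M := fun p => (chiBi K A).X p.1.1 p.1.2)
    (N := Bal (toP K A).toRingHom ((T1bi K A).totX n))
    (φ := fun p => projComp K A n p.1.1 p.1.2 p.2) ⟨(i, j), h⟩ x

lemma projLin_incl_zero (n j : ℕ) (h : 0 + j = n + 2) (x : (chiBi K A).X 0 j) :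
    projLin K A n ((chiBi K A).incl 0 j (n + 2) h x) = 0 := projLin_incl n 0 j h x

lemma projLin_incl_succ (n i j : ℕ) (h : i + j = n)
    (x : (chiBi K A).X (i + 1) (j + 1)) :
    projLin K A n ((chiBi K A).incl (i + 1) (j + 1) (n + 2) (by omega) x) =
      Bal.map (toP K A).toRingHom ((T1bi K A).incl i j n h) (rowEquiv K A i j x) :=
  projLin_incl n (i + 1) (j + 1) (by omega) x

lemma rowEquiv_dH (i j : ℕ) (x : (chiBi K A).X (i + 1) (j + 2)) :
    Bal.map (toP K A).toRingHom ((T1bi K A).dH i j).hom (rowEquiv K A i (j + 1) x) =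
      rowEquiv K A i j (((chiBi K A).dH (i + 1) (j + 1)).hom x) :=
  (rowIso_chiH (i + 2) j x).symm

lemma rowEquiv_dV (i j : ℕ) (x : (chiBi K A).X (i + 2) (j + 1)) :
    Bal.map (toP K A).toRingHom ((T1bi K A).dV i j).hom (rowEquiv K A (i + 1) j x) =
      rowEquiv K A i j (((chiBi K A).dV (i + 1) (j + 1)).hom x) := by
  refine (Bal.map_zsmul (toP K A).toRingHom ((-1 : ℤ) ^ j)
    ((barRep K A (i + 3)).homR (barRep K A (i + 2)) (kosz K A j)
      (barD K A (i + 2)) (barD_env (i + 2)) (barD_lie (i + 2))).hom _).trans ?_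
  refine (congrArg ((-1 : ℤ) ^ j • ·) (rowIso_chiB (i + 2) j x).symm).trans ?_
  exact (map_zsmul (rowIso K A (i + 2) j) _ _).symm

/-- Position `(i + 1, j + 1)` of the characteristic bicomplex matches `(i, j)` of the bicomplex of
`T'`, with the same sign `(-1)ʲ` on the vertical maps. The maps out of this block, into column `0`
or into row `0`, disappear under the projection, as does everything starting in row `0`. -/
lemma projLin_d (n : ℕ) (z : (chiBi K A).totX (n + 3)) :
    projLin K A n ((chiBi K A).totD (n + 2) z) =
      Bal.map (toP K A).toRingHom ((T1bi K A).totD n) (projLin K A (n + 1) z) := by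
  suffices h : projLin K A n ∘ₗ (chiBi K A).totD (n + 2) =
      Bal.map (toP K A).toRingHom ((T1bi K A).totD n) ∘ₗ projLin K A (n + 1) from
    LinearMap.congr_fun h z
  refine (chiBi K A).totX_hom_ext fun i j hij x => ?_
  rw [LinearMap.comp_apply, LinearMap.comp_apply, Bicomplex.totD_incl, map_add]
  match i, j, hij, x with
  | 0, 0, hij, x => omega
  | 0, j + 1, hij, x =>
    rw [projLin_incl_zero, map_zero]
    change projLin K A n ((chiBi K A).incl 0 j (n + 2) _ _) + projLin K A n 0 = 0
    rw [projLin_incl_zero, map_zero, add_zero]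
  | i + 1, 0, hij, x =>
    -- In the rows `i ≥ 1`, column `0` is the zero module.
    obtain rfl : x = 0 := Subsingleton.elim (α := PUnit) x 0
    simp only [map_zero, add_zero]
  | i + 1, j + 1, hij, x =>
    have hn : i + j = n + 1 := by omega
    have e : (T1bi K A).totD n ∘ₗ (T1bi K A).incl i j (n + 1) hn =
        (T1bi K A).totH n i j hn + (T1bi K A).totV n i j hn :=
      LinearMap.ext fun y => (T1bi K A).totD_incl i j n hn y
    rw [projLin_incl_succ (n + 1) i j hn x, Bal.map_map, e, Bal.map_add]
    congr 1
    · match j, hij, hn, x with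
      | 0, hij, hn, x =>
        rw [Bicomplex.totH, Bal.map_zero]
        change projLin K A n ((chiBi K A).incl (i + 1) 0 (n + 2) _ 0) = 0
        rw [map_zero, map_zero]
      | j + 1, hij, hn, x =>
        rw [Bicomplex.totH, Bicomplex.totH, ← Bal.map_map, rowEquiv_dH]
        exact projLin_incl_succ n i j _ _
    · match i, hij, hn, x with
      | 0, hij, hn, x =>
        rw [Bicomplex.totV, Bal.map_zero]
        exact projLin_incl_zero n (j + 1) _ _
      | i + 1, hij, hn, x =>
        rw [Bicomplex.totV, Bicomplex.totV, ← Bal.map_map, rowEquiv_dV]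
        exact projLin_incl_succ n i j _ _

lemma isZero_shiftTwo {R : Type u} [Ring R] (C : ChainComplex (ModuleCat.{u} R) ℕ) (n : ℕ)
    (h : ∀ i, i + 2 ≠ n) : Limits.IsZero ((shiftTwo C).X n) :=
  C.isZero_extend_X plusTwo n h

variable (K A) in
/-- The map `χₙ₊₂(A) → P ⊗_Q T'ₙ`, as a morphism. -/
def projHom (n : ℕ) : (chi K A).X (n + 2) ⟶ (extPC K A (T1 K A)).X n :=
  ModuleCat.ofHom (projLin K A n)

lemma projHom_d (n : ℕ) : projHom K A (n + 1) ≫ (extPC K A (T1 K A)).d (n + 1) n =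
    (chi K A).d (n + 3) (n + 2) ≫ projHom K A n := by
  rw [show (chi K A).d (n + 3) (n + 2) = _ from (chiBi K A).tot_d (n + 2)]
  change _ ≫ (extP K A).map ((T1 K A).d (n + 1) n) = _
  rw [show (T1 K A).d (n + 1) n = _ from (T1bi K A).tot_d n]
  apply ModuleCat.hom_ext
  exact LinearMap.ext fun z => (projLin_d n z).symm

variable (K A) in
/-- The isomorphism of `P ⊗_Q T'ₙ` with the term in degree `n + 2` of `(P ⊗_Q T')[2]`. -/
def shiftIso (n : ℕ) :
    (extPC K A (T1 K A)).X n ≅ (shiftTwo (extPC K A (T1 K A))).X (n + 2) :=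
  ((extPC K A (T1 K A)).extendXIso plusTwo (show plusTwo.f n = n + 2 from rfl)).symm

lemma shiftIso_d (n : ℕ) : (shiftTwo (extPC K A (T1 K A))).d (n + 3) (n + 2) =
    (shiftIso K A (n + 1)).inv ≫ (extPC K A (T1 K A)).d (n + 1) n ≫ (shiftIso K A n).hom :=
  (extPC K A (T1 K A)).extend_d_eq plusTwo (show plusTwo.f (n + 1) = n + 3 from rfl)
    (show plusTwo.f n = n + 2 from rfl)

variable (K A) in
/-- The components of the map `g : χ(A) → (P ⊗_Q T')[2]`. -/
def projMapF : ∀ n : ℕ, (chi K A).X n ⟶ (shiftTwo (extPC K A (T1 K A))).X n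
  | 0 => 0
  | 1 => 0
  | n + 2 => projHom K A n ≫ (shiftIso K A n).hom

variable (K A) in
/-- The map `g : χ(A) → (P ⊗_Q T')[2]`. -/
def projMap : chi K A ⟶ shiftTwo (extPC K A (T1 K A)) where
  f := projMapF K A
  comm' i j h := by
    obtain rfl : j + 1 = i := h
    match j with
    | 0 => exact (isZero_shiftTwo _ 0 (by omega)).eq_of_tgt _ _
    | 1 => exact (isZero_shiftTwo _ 1 (by omega)).eq_of_tgt _ _
    | n + 2 =>
      rw [shiftIso_d, projMapF, projMapF, Category.assoc, Iso.hom_inv_id_assoc, ← Category.assoc,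
        ← Category.assoc, projHom_d]

lemma projMap_apply (i j : ℕ) (p : PEnv K A) (θ : ⨂[K]^(i + 2) A) (ω : ⋀[K]^j A) :
    ((projMap K A).f (i + j + 2)).hom (inChi i j ((p ⊗ₜ[K] θ) ⊗ₜ[K] ω)) =
      toShift (extPC K A (T1 K A)) (i + j)
        (ptmul p (inT1 i j (((1 : Env K A) ⊗ₜ[K] θ) ⊗ₜ[K] ((1 : UEnv K A) ⊗ₜ[K] ω)))) := by
  refine congrArg (toShift (extPC K A (T1 K A)) (i + j)) ?_
  refine (projLin_incl_succ (i + j) i j rfl ((p ⊗ₜ θ) ⊗ₜ ω)).trans ?_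
  exact congrArg (Bal.map (toP K A).toRingHom ((T1bi K A).incl i j (i + j) rfl))
    (rowIso_tmul (i + 2) j p θ ω)

end Projection

/-! ### The short exact sequence of complexes -/

section ShortExact

variable {K A}

lemma inclLin_injective (n : ℕ) : Function.Injective (inclLin K A n) :=
  (Function.LeftInverse.injective ((chiBi K A).proj_incl_self 0 n n (zero_add n))).comp
    (rowZeroIso K A n).symm.injective

/-- A chain of the characteristic complex lies in row `0` if its components in the rows `i + 1` and
columns `j + 1` vanish. -/
lemma mem_range_inclLin (n : ℕ) (z : (chiBi K A).totX n)
    (h : ∀ i j (hij : (i + 1) + (j + 1) = n),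
      (chiBi K A).proj (i + 1) (j + 1) n hij z = 0) : ∃ y, inclLin K A n y = z := by
  refine ⟨rowZeroIso K A n ((chiBi K A).proj 0 n n (zero_add n) z), ?_⟩
  have e : inclLin K A n (rowZeroIso K A n ((chiBi K A).proj 0 n n (zero_add n) z)) =
      (chiBi K A).incl 0 n n (zero_add n) ((chiBi K A).proj 0 n n (zero_add n) z) :=
    congrArg ((chiBi K A).incl 0 n n (zero_add n)) ((rowZeroIso K A n).symm_apply_apply _)
  rw [e]
  refine (chiBi K A).totX_ext fun i j hij => ?_
  match i, j, hij with
  | 0, j, hij =>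
    obtain rfl : j = n := by omega
    exact (chiBi K A).proj_incl_self _ _ _ _ _
  | i + 1, 0, hij => exact Subsingleton.elim (α := PUnit) _ _
  | i + 1, j + 1, hij =>
    rw [(chiBi K A).proj_incl_of_ne _ _ _ _ _ _ _ (by omega), h i j hij]

lemma projLin_inclLin (n : ℕ) (y : ((QRep.regular K A).tensor (kosz K A (n + 2))).ext) :
    projLin K A n (inclLin K A (n + 2) y) = 0 := projLin_incl_zero n _ _ _

/-- Used to recover the components of a chain outside row `0` from its projection, and so to find
the kernel. -/
lemma map_proj_projLin (n i j : ℕ) (h : i + j = n) (z : (chiBi K A).totX (n + 2)) :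
    Bal.map (toP K A).toRingHom ((T1bi K A).proj i j n h) (projLin K A n z) =
      rowEquiv K A i j
        ((chiBi K A).proj (i + 1) (j + 1) (n + 2) (by omega) z) := by
  suffices e : Bal.map (toP K A).toRingHom ((T1bi K A).proj i j n h) ∘ₗ projLin K A n =
      (rowEquiv K A i j).toLinearMap ∘ₗ
        (chiBi K A).proj (i + 1) (j + 1) (n + 2) (by omega) from LinearMap.congr_fun e z
  refine (chiBi K A).totX_hom_ext fun i' j' h' x => ?_
  rw [LinearMap.comp_apply, LinearMap.comp_apply, LinearEquiv.coe_coe]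
  match i', j', h', x with
  | 0, j', h', x =>
    rw [projLin_incl_zero, map_zero, (chiBi K A).proj_incl_of_ne _ _ _ _ _ _ _ (by omega), map_zero]
  | i' + 1, 0, h', x =>
    obtain rfl : x = 0 := Subsingleton.elim (α := PUnit) x 0
    simp only [map_zero]
  | i' + 1, j' + 1, h', x =>
    rw [projLin_incl_succ n i' j' (by omega), Bal.map_map]
    by_cases hj : j = j'
    · subst hj
      obtain rfl : i = i' := by omega
      have e : (T1bi K A).proj i j n h ∘ₗ (T1bi K A).incl i j n h = LinearMap.id :=
        LinearMap.ext fun y => (T1bi K A).proj_incl_self i j n h y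
      rw [e, Bal.map_id, (chiBi K A).proj_incl_self]
    · have e : (T1bi K A).proj i j n h ∘ₗ (T1bi K A).incl i' j' n (by omega) = 0 :=
        LinearMap.ext fun y => (T1bi K A).proj_incl_of_ne _ _ _ _ _ _ _ hj y
      rw [e, Bal.map_zero, (chiBi K A).proj_incl_of_ne _ _ _ _ _ _ _ (by omega), map_zero]

lemma projLin_surjective (n : ℕ) : Function.Surjective (projLin K A n) := by
  rw [← LinearMap.range_eq_top, eq_top_iff]
  rintro z -
  induction z using Bal.induction with
  | ha x y hx hy => exact add_mem hx hy
  | h p m =>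
    induction m using Bicomplex.totX_induction with
    | h0 => rw [Bal.tmul_zero]; exact zero_mem _
    | ha x y hx hy => rw [Bal.tmul_add]; exact add_mem hx hy
    | hi i j h x =>
      refine ⟨(chiBi K A).incl (i + 1) (j + 1) (n + 2) (by omega)
        ((rowEquiv K A i j).symm (Bal.tmul (toP K A).toRingHom p x)), ?_⟩
      rw [projLin_incl_succ n i j h, LinearEquiv.apply_symm_apply, Bal.map_tmul]

/-- Since `rowEquiv` is injective, a chain killed by the projection has no component at any `(i + 1,
j + 1)`. Column `0` being zero in the rows `i ≥ 1`, only row `0` remains. -/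
lemma projLin_exact (n : ℕ) : Function.Exact (inclLin K A (n + 2)) (projLin K A n) := fun z => by
  constructor
  · intro hz
    refine mem_range_inclLin (n + 2) z fun i j hij => ?_
    have h := map_proj_projLin n i j (by omega) z
    rw [hz, map_zero] at h
    exact (rowEquiv K A i j).map_eq_zero_iff.1 h.symm
  · rintro ⟨y, rfl⟩
    exact projLin_inclLin n y

/-- A position `(i + 1, j + 1)` has total degree at least two. -/
lemma inclLin_surjective_of_lt (n : ℕ) (hn : n < 2) : Function.Surjective (inclLin K A n) :=
  fun z => mem_range_inclLin n z fun i j hij => by omega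

variable (K A)

lemma inclMap_projMap : inclMap K A ≫ projMap K A = 0 := by
  apply HomologicalComplex.hom_ext
  intro n
  match n with
  | 0 => exact (isZero_shiftTwo _ 0 (by omega)).eq_of_tgt _ _
  | 1 => exact (isZero_shiftTwo _ 1 (by omega)).eq_of_tgt _ _
  | n + 2 =>
    have h : (inclMap K A).f (n + 2) ≫ projHom K A n = 0 :=
      ModuleCat.hom_ext (LinearMap.ext fun y => projLin_inclLin n y)
    change (inclMap K A).f (n + 2) ≫ projHom K A n ≫ (shiftIso K A n).hom = 0
    rw [← Category.assoc, h, Limits.zero_comp]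

lemma epi_projMapF (n : ℕ) : Epi (projMapF K A n) := by
  match n with
  | 0 => exact (isZero_shiftTwo _ 0 (by omega)).epi _
  | 1 => exact (isZero_shiftTwo _ 1 (by omega)).epi _
  | n + 2 =>
    have : Epi (projHom K A n) := (ModuleCat.epi_iff_surjective _).2 (projLin_surjective n)
    exact epi_comp (projHom K A n) (shiftIso K A n).hom

lemma exact_inclMap_projMapF (n : ℕ) :
    Function.Exact ((inclMap K A).f n).hom (projMapF K A n).hom := by
  have h0 : n < 2 → Function.Exact ((inclMap K A).f n).hom (projMapF K A n).hom := fun hn z => by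
    have := ModuleCat.subsingleton_of_isZero
      (isZero_shiftTwo (extPC K A (T1 K A)) n (by omega))
    exact ⟨fun _ => inclLin_surjective_of_lt n hn z, fun _ => Subsingleton.elim _ _⟩
  match n, h0 with
  | 0, h0 => exact h0 (by omega)
  | 1, h0 => exact h0 (by omega)
  | n + 2, _ =>
    intro z
    refine Iff.trans ?_ (projLin_exact n z)
    exact (shiftIso K A n).toLinearEquiv.map_eq_zero_iff

lemma shortExact_chi :
    (ShortComplex.mk (inclMap K A) (projMap K A) (inclMap_projMap K A)).ShortExact := by
  apply HomologicalComplex.shortExact_of_degreewise_shortExact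
  intro n
  exact
    { exact := (ShortComplex.ShortExact.moduleCat_exact_iff_function_exact _).2
        (exact_inclMap_projMapF K A n)
      mono_f := (ModuleCat.mono_iff_injective _).2 (inclLin_injective n)
      epi_g := epi_projMapF K A n }

end ShortExact

/-! ### The long exact sequence -/

section LongExact

variable {K A : Type u} [Field K] [Ring A] [Algebra K A] [PoissonAlgebra K A]
  {X'' X' : ModuleCat.{u} (QEnv K A)} {T'' T' : ChainComplex (ModuleCat.{u} (QEnv K A)) ℕ}
  {C : ChainComplex (ModuleCat.{u} (PEnv K A)) ℕ}
  (π'' : T'' ⟶ (ChainComplex.single₀ _).obj X'') (hT'' : ∀ n, Module.Free (QEnv K A) (T''.X n))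
  (hπ'' : QuasiIso π'') (π' : T' ⟶ (ChainComplex.single₀ _).obj X')
  (hT' : ∀ n, Module.Free (QEnv K A) (T'.X n)) (hπ' : QuasiIso π')
  {f : extPC K A T'' ⟶ C} {g : C ⟶ shiftTwo (extPC K A T')} {w : f ≫ g = 0}

/-- Exactness of a pair of composable morphisms is invariant under isomorphisms. -/
lemma exact_of_isos {R : Type u} [Ring R] {X Y Z X₁ Y₁ Z₁ : ModuleCat.{u} R} {f : X ⟶ Y}
    {g : Y ⟶ Z} (hw : f ≫ g = 0) (h : (ShortComplex.mk f g hw).Exact) (a : X₁ ≅ X) (b : Y₁ ≅ Y)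
    (c : Z₁ ≅ Z) {f₁ : X₁ ⟶ Y₁} {g₁ : Y₁ ⟶ Z₁} (hf : f₁ ≫ b.hom = a.hom ≫ f)
    (hg : g₁ ≫ c.hom = b.hom ≫ g) : Function.Exact f₁.hom g₁.hom := by
  have hw₁ : f₁ ≫ g₁ = 0 := by
    rw [← cancel_mono c.hom, Category.assoc, hg, reassoc_of% hf, hw, Limits.comp_zero,
      Limits.zero_comp]
  refine (ShortComplex.ShortExact.moduleCat_exact_iff_function_exact
    (ShortComplex.mk f₁ g₁ hw₁)).1 ?_
  exact (ShortComplex.exact_iff_of_iso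
    (ShortComplex.isoMk (S₁ := ShortComplex.mk f₁ g₁ hw₁) (S₂ := ShortComplex.mk f g hw)
      a b c hf.symm hg.symm)).2 h

/-- The identification of `Tor_n^Q(P, X'')` with the homology of `P ⊗_Q T''`. -/
def torIso (n : ℕ) : torP K A n X'' ≅ (extPC K A T'').homology n :=
  (resolution π'' hT'' hπ'').isoLeftDerivedObj (extP K A) n

variable (T') in
/-- The identification of `H_{n+2}((P ⊗_Q T')[2])` with `H_n(P ⊗_Q T')`. -/
def shiftHomologyIso (n : ℕ) :
    (shiftTwo (extPC K A T')).homology (n + 2) ≅ (extPC K A T').homology n :=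
  (extPC K A T').extendHomologyIso plusTwo (show plusTwo.f n = n + 2 from rfl)

/-- This and the next two identities exhibit the maps of the sequence as those of the homology
sequence conjugated by isomorphisms, the form in which `exact_of_isos` transports exactness. -/
lemma torToH_eq (n : ℕ) : torToH π'' hT'' hπ'' f n =
    (torIso π'' hT'' hπ'' n).hom ≫ HomologicalComplex.homologyMap f n := rfl

lemma hToTor_eq (n : ℕ) : hToTor π' hT' hπ' g n = HomologicalComplex.homologyMap g (n + 2) ≫
    (shiftHomologyIso T' n).hom ≫ (torIso π' hT' hπ' n).inv := rfl

lemma torToTor_eq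
    (hS : (ShortComplex.mk f g w).ShortExact) (n : ℕ) :
    torToTor π'' hT'' hπ'' π' hT' hπ' hS n =
    (torIso π' hT' hπ' n).hom ≫ (shiftHomologyIso T' n).inv ≫ hS.δ (n + 2) (n + 1) rfl ≫
      (torIso π'' hT'' hπ'' (n + 1)).inv := rfl

lemma exact_torToH_hToTor
    (hS : (ShortComplex.mk f g w).ShortExact) (n : ℕ) :
    Function.Exact (torToH π'' hT'' hπ'' f (n + 2)).hom
      (hToTor π' hT' hπ' g n).hom :=
  exact_of_isos _ (hS.homology_exact₂ (n + 2)) (torIso π'' hT'' hπ'' (n + 2)) (Iso.refl _)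
    (torIso π' hT' hπ' n ≪≫ (shiftHomologyIso T' n).symm) (by simp [torToH_eq])
    (by simp [hToTor_eq])

lemma exact_hToTor_torToTor
    (hS : (ShortComplex.mk f g w).ShortExact) (n : ℕ) :
    Function.Exact (hToTor π' hT' hπ' g n).hom
      (torToTor π'' hT'' hπ'' π' hT' hπ' hS n).hom :=
  exact_of_isos _ (hS.homology_exact₃ (n + 2) (n + 1) rfl) (Iso.refl _)
    (torIso π' hT' hπ' n ≪≫ (shiftHomologyIso T' n).symm) (torIso π'' hT'' hπ'' (n + 1))
    (by simp [hToTor_eq]) (by simp [torToTor_eq])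

lemma exact_torToTor_torToH
    (hS : (ShortComplex.mk f g w).ShortExact) (n : ℕ) :
    Function.Exact (torToTor π'' hT'' hπ'' π' hT' hπ' hS n).hom
      (torToH π'' hT'' hπ'' f (n + 1)).hom :=
  exact_of_isos _ (hS.homology_exact₁ (n + 2) (n + 1) rfl)
    (torIso π' hT' hπ' n ≪≫ (shiftHomologyIso T' n).symm) (torIso π'' hT'' hπ'' (n + 1))
    (Iso.refl _) (by simp [torToTor_eq]) (by simp [torToH_eq])

/-- The shifted complex has no homology below degree two, so nothing obstructs surjectivity there.
-/
lemma epi_homologyMap_of_lt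
    (hS : (ShortComplex.mk f g w).ShortExact) (n : ℕ) (hn : n < 2) :
    Epi (HomologicalComplex.homologyMap f n) := by
  have hz : Limits.IsZero ((shiftTwo (extPC K A T')).homology n) :=
    ((extPC K A T').extend_exactAt plusTwo n (fun j => by
      change j + 2 ≠ n
      omega)).isZero_homology
  exact (hS.homology_exact₂ n).epi_f (hz.eq_of_tgt _ _)

/-- The connecting map into degree `0` starts from the first homology of the shifted complex, which
vanishes. -/
lemma mono_homologyMap_zero
    (hS : (ShortComplex.mk f g w).ShortExact) : Mono (HomologicalComplex.homologyMap f 0) := by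
  have hz : Limits.IsZero ((shiftTwo (extPC K A T')).homology 1) :=
    ((extPC K A T').extend_exactAt plusTwo 1 (fun j => by
      change j + 2 ≠ 1
      omega)).isZero_homology
  exact (hS.homology_exact₁ 1 0 rfl).mono_g (hz.eq_of_src _ _)

lemma torToH_one_surjective
    (hS : (ShortComplex.mk f g w).ShortExact) :
    Function.Surjective (torToH π'' hT'' hπ'' f 1).hom := by
  have : Epi (HomologicalComplex.homologyMap f 1) := epi_homologyMap_of_lt hS 1 (by omega)
  refine (ModuleCat.epi_iff_surjective _).1 ?_
  rw [torToH_eq]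
  infer_instance

lemma isIso_torToH_zero
    (hS : (ShortComplex.mk f g w).ShortExact) : IsIso (torToH π'' hT'' hπ'' f 0) := by
  have : Epi (HomologicalComplex.homologyMap f 0) := epi_homologyMap_of_lt hS 0 (by omega)
  have : Mono (HomologicalComplex.homologyMap f 0) := mono_homologyMap_zero hS
  have : IsIso (HomologicalComplex.homologyMap f 0) := isIso_of_mono_of_epi _
  rw [torToH_eq]
  infer_instance

end LongExact

end Poisson

end

open Poisson

theorem mainTheorem4 {K A : Type u} [Field K] [CharZero K] [Ring A] [Algebra K A]
    [PoissonAlgebra K A] :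
    ∃ (hT'' : ∀ n, Module.Free (QEnv K A) ((T2 K A).X n)) (hπ'' : QuasiIso (T2aug K A))
      (hT' : ∀ n, Module.Free (QEnv K A) ((T1 K A).X n)) (hπ' : QuasiIso (T1aug K A))
      (f : extPC K A (T2 K A) ⟶ chi K A) (g : chi K A ⟶ shiftTwo (extPC K A (T1 K A)))
      (w : f ≫ g = 0) (hS : (ShortComplex.mk f g w).ShortExact),
      (∀ (n : ℕ) (p : PEnv K A) (b : Env K A) (v : UEnv K A) (ω : ⋀[K]^n A),
        (f.f n).hom (ptmul p (inT2 n (b ⊗ₜ[K] (v ⊗ₜ[K] ω)))) =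
          inChi0 n ((p * toP K A (QEnv.mk K b v)) ⊗ₜ[K] ω)) ∧
      (∀ (i j : ℕ) (p : PEnv K A) (θ : ⨂[K]^(i + 2) A) (ω : ⋀[K]^j A),
        (g.f (i + j + 2)).hom (inChi i j ((p ⊗ₜ[K] θ) ⊗ₜ[K] ω)) =
          toShift (extPC K A (T1 K A)) (i + j)
            (ptmul p (inT1 i j (((1 : Env K A) ⊗ₜ[K] θ) ⊗ₜ[K] ((1 : UEnv K A) ⊗ₜ[K] ω))))) ∧
      (∀ n : ℕ, Function.Exact (torToH (T2aug K A) hT'' hπ'' f (n + 2)).hom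
        (hToTor (T1aug K A) hT' hπ' g n).hom) ∧
      (∀ n : ℕ, Function.Exact (hToTor (T1aug K A) hT' hπ' g n).hom
        (torToTor (T2aug K A) hT'' hπ'' (T1aug K A) hT' hπ' hS n).hom) ∧
      (∀ n : ℕ, Function.Exact (torToTor (T2aug K A) hT'' hπ'' (T1aug K A) hT' hπ' hS n).hom
        (torToH (T2aug K A) hT'' hπ'' f (n + 1)).hom) ∧
      Function.Surjective (torToH (T2aug K A) hT'' hπ'' f 1).hom ∧
      ∃ ε : (extP K A).obj (A2 K A) ≅ (chi K A).homology 0,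
        (extP K A).fromLeftDerivedZero.app (A2 K A) ≫ ε.hom =
          torToH (T2aug K A) hT'' hπ'' f 0 := by
  have h0 := isIso_torToH_zero (T2aug K A) (free_T2 K A) (quasiIso_T2aug K A) (shortExact_chi K A)
  refine ⟨free_T2 K A, quasiIso_T2aug K A, free_T1 K A, quasiIso_T1aug K A, inclMap K A,
    projMap K A, inclMap_projMap K A, shortExact_chi K A, inclMap_apply, projMap_apply,
    exact_torToH_hToTor _ _ _ _ _ _ (shortExact_chi K A),
    exact_hToTor_torToTor _ _ _ _ _ _ (shortExact_chi K A),
    exact_torToTor_torToH _ _ _ _ _ _ (shortExact_chi K A),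
    torToH_one_surjective _ _ _ (shortExact_chi K A),
    -- The canonical map `Tor₀ → P ⊗_Q A²` is invertible by right exactness, and `h0` inverts the
    -- map to `H₀`.
    (asIso ((extP K A).fromLeftDerivedZero.app (A2 K A))).symm ≪≫
      asIso (torToH (T2aug K A) (free_T2 K A) (quasiIso_T2aug K A) (inclMap K A) 0), ?_⟩
  simp
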